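/- **Conventions.** A generic plane curve is a smooth immersion $\gamma$ of the oriented circle into $\mathbb R^2$ whose multiple points are finitely many transverse double points; isotopy means homotopy through generic plane curves. A self-tangency perestroika is direct (inverse) if the two tangent branches have the same (opposite) direction, and positive if it creates a bigon. The sign of a triple-point perestroika is the sign $(-1)^q$ of the created triangle: if $e_1,e_2,e_3$ are its edges in the order in which the curve runs through them, and its boundary is oriented so that it meets $e_1,e_2,e_3$ in this order, then $q$ is the number of edges on which this orientation agrees with that of the curve. The Arnold invariants $J^+,J^-,St$ are the functions of generic plane curves which are invariant under isotopy and independent of the orientation and satisfy: * $J^+$ increases by $2$ under a positive direct self-tangency perestroika and does not change under inverse self-tangency and triple-point perestroikas; * $J^-$ decreases by $2$ under a positive inverse self-tangency perestroika and does not change under direct self-tangency and triple-point perestroikas; * $St$ increases by $1$ under a positive triple-point perestroika and does not change under self-tangency perestroikas; * for the figure eight $K_0$: $J^+=0$, $J^-=-1$, $St=0$; for the circle with $i\ge 0$ small inner kinks $K_{i+1}$: $J^+=-2i$, $J^-=-3i$, $St=i$. Explicitly, choose a base point, let $d$ be the number of double points and $\mathrm{ind}$ the Whitney index, and give each double point the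 sign of the frame (first tangent, second tangent). Let $S_{1},S_{2},S_{3}$ be the sums of the products of the two signs over the pairs $\{a,b\}$ of double points passed in the order $aabb$, $abba$, $abab$, respectively. Then $$J^+=S_1-S_2-3S_3-\tfrac{d-1}2-\tfrac{\mathrm{ind}^2}2,\qquad J^-=J^+-d,\qquad St=\tfrac12(-S_1+S_2+S_3)+\tfrac{d-1}4+\tfrac{\mathrm{ind}^2}4 .$$ For a knot diagram $D$ let $\bar D$ be the underlying curve, $w(D)$ the writhe (the sum of the signs of the crossings), and $x(D)$ the cowrithe (the sum, over the pairs of crossings $a,b$ met along the knot in the cyclic order $abab$, of the products of the signs of $a$ and $b$). For an integer $n\ge 2$ let $D_n$ be the diagram with the underlying curve $r=2+\cos\frac{n\theta}{n+1}$, $0\le\theta\le 2(n+1)\pi$, in polar coordinates, oriented by increasing $\theta$, in which at each crossing the second passage, counted from the base point $(r,\theta)=(3,0)$, goes over the first one. **Proposition 3.1.** The functions $J^+,J^-,St$ given by the explicit formulae have the listed defining properties of the Arnold invariants. For every integer $n\ge2$ the curve $\bar D_n$ is generic, and $$\tfrac12J^-(\bar D_n)+St(\bar D_n)-\tfrac12w(D_n)=-\left(\tbinom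 n1+\tbinom n2+\tbinom n3\right)=-\frac{n(n^2+5)}6,$$ $$\tfrac12J^+(\bar D_n)+St(\bar D_n)=-x(D_n)=-\binom n3=-\frac{(n-2)(n-1)n}6 .$$ -/

import Mathlib

open scoped ContDiff

namespace PlaneCurves

noncomputable section

/-! ## Generic plane curves

A closed curve in the plane `ℝ² = ℂ` is a `2π`-periodic map `ℝ → ℂ`; it is oriented by its
parameter, and its base point is the point of parameter `0`. -/

/-- The determinant of two plane vectors. -/
def cross (u v : ℂ) : ℝ := u.re * v.im - u.im * v.re

/-- A smooth immersion of the oriented circle into the plane. -/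
structure IsPlaneCurve (γ : ℝ → ℂ) : Prop where
  smooth : ContDiff ℝ ∞ γ
  periodic : Function.Periodic γ (2 * Real.pi)
  immersed : ∀ s, deriv γ s ≠ 0

/-- The double points of a curve: a double point is recorded as the pair of parameters
`s < t` in `[0, 2π)` of the first and the second passage through it. -/
def doublePairs (γ : ℝ → ℂ) : Set (ℝ × ℝ) :=
  {p | 0 ≤ p.1 ∧ p.1 < p.2 ∧ p.2 < 2 * Real.pi ∧ γ p.1 = γ p.2}

/-- Three distinct passages, of parameters `s < t < u` in `[0, 2π)`, through one point. -/
def IsTriplePassage (γ : ℝ → ℂ) (s t u : ℝ) : Prop :=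
  (s, t) ∈ doublePairs γ ∧ (t, u) ∈ doublePairs γ

/-- The two branches through a double point have independent tangents. -/
def TransverseAt (γ : ℝ → ℂ) (p : ℝ × ℝ) : Prop :=
  cross (deriv γ p.1) (deriv γ p.2) ≠ 0

/-- A generic plane curve: an immersion with only finitely many multiple points, all of them
transverse double points. -/
structure IsGenericCurve (γ : ℝ → ℂ) : Prop extends IsPlaneCurve γ where
  finite : (doublePairs γ).Finite
  transverse : ∀ p ∈ doublePairs γ, TransverseAt γ p
  no_triple : ∀ s t u, ¬ IsTriplePassage γ s t u

/-- The number of double points. -/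
def doubleCount (γ : ℝ → ℂ) : ℕ := (doublePairs γ).ncard

/-- The Whitney index: the number of turns of the velocity vector,
`(1 / 2π) ∫ Im (γ'' / γ')`. -/
def whitneyIndex (γ : ℝ → ℂ) : ℝ :=
  (∫ s in (0 : ℝ)..(2 * Real.pi), (deriv (deriv γ) s / deriv γ s).im) / (2 * Real.pi)

/-! ## Gauss diagrams

The chords of the Gauss diagram are the elements of `doublePairs γ`. Two chords are in exactly
one of three relative positions with respect to the base point. -/

/-- The endpoints of the chords occur in the order `c d c d`. -/
def Interleaved (c d : ℝ × ℝ) : Prop := c.1 < d.1 ∧ d.1 < c.2 ∧ c.2 < d.2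

/-- The endpoints of the chords occur in the order `c d d c`. -/
def Nested (c d : ℝ × ℝ) : Prop := c.1 < d.1 ∧ d.2 < c.2

/-- The endpoints of the chords occur in the order `c c d d`. -/
def Separated (c d : ℝ × ℝ) : Prop := c.2 < d.1

/-- The sum, over the pairs of double points in the relative position `R`, of the products of
their weights `ε`. For the three relations above every unordered pair is counted once. -/
def pairSum (γ : ℝ → ℂ) (ε : ℝ × ℝ → ℝ) (R : ℝ × ℝ → ℝ × ℝ → Prop) : ℝ :=
  ∑ᶠ q ∈ {q : (ℝ × ℝ) × (ℝ × ℝ) |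
    q.1 ∈ doublePairs γ ∧ q.2 ∈ doublePairs γ ∧ R q.1 q.2}, ε q.1 * ε q.2

/-- The sign of a double point of a based oriented curve: the orientation of the frame
(first tangent, second tangent). -/
def doubleSign (γ : ℝ → ℂ) (p : ℝ × ℝ) : ℝ :=
  Real.sign (cross (deriv γ p.1) (deriv γ p.2))

/-! ## The Arnold invariants

`Jplus`, `Jminus` and `St` are given by explicit formulae (Polyak's Gauss diagram formulae).
Below, `IsArnoldTriple` expresses Arnold's defining properties of the three invariants. -/

/-- The invariant `J⁺`. -/
def Jplus (γ : ℝ → ℂ) : ℝ :=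
  pairSum γ (doubleSign γ) Separated - pairSum γ (doubleSign γ) Nested
    - 3 * pairSum γ (doubleSign γ) Interleaved
    - ((doubleCount γ : ℝ) - 1) / 2 - whitneyIndex γ ^ 2 / 2

/-- The invariant `J⁻`. -/
def Jminus (γ : ℝ → ℂ) : ℝ :=
  pairSum γ (doubleSign γ) Separated - pairSum γ (doubleSign γ) Nested
    - 3 * pairSum γ (doubleSign γ) Interleaved
    - (3 * (doubleCount γ : ℝ) - 1) / 2 - whitneyIndex γ ^ 2 / 2

/-- The strangeness `St`. -/
def St (γ : ℝ → ℂ) : ℝ :=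
  (- pairSum γ (doubleSign γ) Separated + pairSum γ (doubleSign γ) Nested
    + pairSum γ (doubleSign γ) Interleaved) / 2
    + ((doubleCount γ : ℝ) - 1) / 4 + whitneyIndex γ ^ 2 / 4

/-! ## Regular homotopies and perestroikas -/

/-- A regular homotopy `(H t)`, `-1 ≤ t ≤ 1`, of closed curves. -/
structure IsRegularHomotopy (H : ℝ → ℝ → ℂ) : Prop where
  smooth : ContDiff ℝ ∞ (fun q : ℝ × ℝ => H q.1 q.2)
  curve : ∀ t ∈ Set.Icc (-1 : ℝ) 1, IsPlaneCurve (H t)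

/-- The velocity, at time `0`, of the point of parameter `s`. -/
def motion (H : ℝ → ℝ → ℂ) (s : ℝ) : ℂ := deriv (fun t => H t s) 0

/-- A regular homotopy that undergoes exactly one self-tangency perestroika, at time `0` and
between the branches of parameters `p.1` and `p.2`: the branches have there a tangency of
exactly first order, they pass through each other with nonzero speed, and the rest of the
curve is generic. -/
structure IsSelfTangency (H : ℝ → ℝ → ℂ) (p : ℝ × ℝ) : Prop
    extends IsRegularHomotopy H where
  generic : ∀ t ∈ Set.Icc (-1 : ℝ) 1, t ≠ 0 → IsGenericCurve (H t)
  finite : (doublePairs (H 0)).Finite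
  no_triple : ∀ s t u, ¬ IsTriplePassage (H 0) s t u
  transverse : ∀ q ∈ doublePairs (H 0), q ≠ p → TransverseAt (H 0) q
  mem : p ∈ doublePairs (H 0)
  tangent : cross (deriv (H 0) p.1) (deriv (H 0) p.2) = 0
  curvature : cross (deriv (H 0) p.1) (deriv (deriv (H 0)) p.1) / ‖deriv (H 0) p.1‖ ^ 2 ≠
    cross (deriv (H 0) p.1) (deriv (deriv (H 0)) p.2) / ‖deriv (H 0) p.2‖ ^ 2
  speed : cross (deriv (H 0) p.1) (motion H p.2 - motion H p.1) ≠ 0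

/-- At a direct self-tangency the two velocities have the same direction. -/
def IsDirect (H : ℝ → ℝ → ℂ) (p : ℝ × ℝ) : Prop :=
  0 < inner ℝ (deriv (H 0) p.1) (deriv (H 0) p.2)

/-- At an inverse self-tangency the two velocities have opposite directions. -/
def IsInverse (H : ℝ → ℝ → ℂ) (p : ℝ × ℝ) : Prop :=
  inner ℝ (deriv (H 0) p.1) (deriv (H 0) p.2) < 0

/-- A positive self-tangency perestroika creates a bigon, hence two double points. -/
def CreatesBigon (H : ℝ → ℝ → ℂ) : Prop := doubleCount (H (-1)) < doubleCount (H 1)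

/-- For two branches, of parameters `s` and `s'`, which are transverse at time `0` at a common
point: at time `t`, the branch `s` meets the branch `s'` at the parameter
`s + passage H s s' * t + o(t)`. -/
def passage (H : ℝ → ℝ → ℂ) (s s' : ℝ) : ℝ :=
  cross (motion H s' - motion H s) (deriv (H 0) s') / cross (deriv (H 0) s) (deriv (H 0) s')

/-- A regular homotopy that undergoes exactly one triple-point perestroika, at time `0` and
between the branches of parameters `s₁ < s₂ < s₃`: the three branches are pairwise transverse,
any one of them passes the crossing of the two others with nonzero speed, and the rest of the
curve is generic. -/
structure IsTriplePoint (H : ℝ → ℝ → ℂ) (s₁ s₂ s₃ : ℝ) : Prop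
    extends IsRegularHomotopy H where
  generic : ∀ t ∈ Set.Icc (-1 : ℝ) 1, t ≠ 0 → IsGenericCurve (H t)
  finite : (doublePairs (H 0)).Finite
  transverse : ∀ q ∈ doublePairs (H 0), TransverseAt (H 0) q
  triple : IsTriplePassage (H 0) s₁ s₂ s₃
  unique : ∀ s t u, IsTriplePassage (H 0) s t u → s = s₁ ∧ t = s₂ ∧ u = s₃
  speed : passage H s₁ s₂ ≠ passage H s₁ s₃

open Classical in
/-- The number `q` of edges of the triangle created by a triple-point perestroika on which the
orientation of the curve agrees with that orientation of the boundary of the triangle which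
meets the edges `e₁, e₂, e₃` (on the branches `s₁ < s₂ < s₃`) in this cyclic order. In the
latter orientation, `e₁` goes from `e₃ ∩ e₁` to `e₁ ∩ e₂`, and cyclically. -/
def triangleMatches (H : ℝ → ℝ → ℂ) (s₁ s₂ s₃ : ℝ) : ℕ :=
  (if passage H s₁ s₃ < passage H s₁ s₂ then 1 else 0)
    + (if passage H s₂ s₁ < passage H s₂ s₃ then 1 else 0)
    + (if passage H s₃ s₂ < passage H s₃ s₁ then 1 else 0)

/-- The sign of a triple-point perestroika is the sign `(-1) ^ q` of the created triangle. -/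
def tripleSign (H : ℝ → ℝ → ℂ) (s₁ s₂ s₃ : ℝ) : ℤ := (-1) ^ triangleMatches H s₁ s₂ s₃

/-! ## Arnold's defining properties -/

/-- The standard curve `K₀`, a figure eight. -/
def figureEight (s : ℝ) : ℂ := ⟨Real.cos s, Real.sin (2 * s)⟩

/-- The standard curve `K_{i+1}`, of index `i + 1`: a circle with `i` small disjoint inner
kinks (the epitrochoid `(2 i + 1) e ^ (√-1 s) + 2 e ^ (√-1 (i + 1) s)`). -/
def kinkedCircle (i : ℕ) (s : ℝ) : ℂ :=
  (2 * i + 1) * Complex.exp (s * Complex.I) + 2 * Complex.exp (((i + 1) * s : ℝ) * Complex.I)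

/-- Arnold's characterization of the three invariants of generic plane curves: they are
independent of the orientation and invariant under isotopy, they change as prescribed under
the perestroikas, and they have the prescribed values on the standard curves. (The change
under a negative perestroika follows by reversing time.) -/
structure IsArnoldTriple (Jp Jm S : (ℝ → ℂ) → ℝ) : Prop where
  reverse : ∀ γ, IsGenericCurve γ →
    Jp (fun s => γ (-s)) = Jp γ ∧ Jm (fun s => γ (-s)) = Jm γ ∧ S (fun s => γ (-s)) = S γ
  isotopy : ∀ H, IsRegularHomotopy H → (∀ t ∈ Set.Icc (-1 : ℝ) 1, IsGenericCurve (H t)) →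
    Jp (H 1) = Jp (H (-1)) ∧ Jm (H 1) = Jm (H (-1)) ∧ S (H 1) = S (H (-1))
  direct : ∀ H p, IsSelfTangency H p → IsDirect H p → CreatesBigon H →
    Jp (H 1) = Jp (H (-1)) + 2 ∧ Jm (H 1) = Jm (H (-1)) ∧ S (H 1) = S (H (-1))
  inverse : ∀ H p, IsSelfTangency H p → IsInverse H p → CreatesBigon H →
    Jp (H 1) = Jp (H (-1)) ∧ Jm (H 1) = Jm (H (-1)) - 2 ∧ S (H 1) = S (H (-1))
  triple : ∀ H s₁ s₂ s₃, IsTriplePoint H s₁ s₂ s₃ → tripleSign H s₁ s₂ s₃ = 1 →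
    Jp (H 1) = Jp (H (-1)) ∧ Jm (H 1) = Jm (H (-1)) ∧ S (H 1) = S (H (-1)) + 1
  figure_eight : Jp figureEight = 0 ∧ Jm figureEight = -1 ∧ S figureEight = 0
  kinked_circle : ∀ i : ℕ, Jp (kinkedCircle i) = -2 * i ∧ Jm (kinkedCircle i) = -3 * i ∧
    S (kinkedCircle i) = i

/-! ## Knot diagrams -/

/-- A knot diagram: a curve (generic, whenever it is used) with over-under information, given
by the set of those double points at which the second passage, counted from the base point,
goes over the first one. -/
structure KnotDiagram where
  curve : ℝ → ℂ
  secondOver : Set (ℝ × ℝ)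

open Classical in
/-- The sign of a crossing: the orientation of the frame (tangent of the overpass, tangent of
the underpass). -/
def crossingSign (D : KnotDiagram) (p : ℝ × ℝ) : ℝ :=
  if p ∈ D.secondOver then Real.sign (cross (deriv D.curve p.2) (deriv D.curve p.1))
  else Real.sign (cross (deriv D.curve p.1) (deriv D.curve p.2))

/-- The writhe: the sum of the signs of the crossings. -/
def writhe (D : KnotDiagram) : ℝ := ∑ᶠ p ∈ doublePairs D.curve, crossingSign D p

/-- The cowrithe: the sum, over the pairs of crossings whose chords in the Gauss diagram
intersect, of the products of the signs of the two crossings. -/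
def cowrithe (D : KnotDiagram) : ℝ := pairSum D.curve (crossingSign D) Interleaved

/-- The curve `r = 2 + cos (n θ / (n + 1))`, `0 ≤ θ ≤ 2 (n + 1) π`, parametrized by
`θ = (n + 1) s`. -/
def Gamma (n : ℕ) (s : ℝ) : ℂ :=
  (2 + Real.cos (n * s) : ℝ) * Complex.exp (((n + 1) * s : ℝ) * Complex.I)

/-- The ascending diagram on the curve `Gamma n` with base point `(r, θ) = (3, 0)`: at every
crossing the second passage goes over the first one. -/
def diagramD (n : ℕ) : KnotDiagram where
  curve := Gamma n
  secondOver := Set.univ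

end

end PlaneCurves

open PlaneCurves

namespace PlaneCurves

open Set Filter Topology

/-! ### Sums over pairs of chords -/

/-! Comparing coefficients gives `J⁻ = J⁺ - d` and `St = -J⁺ / 2 - S₃`. Hence everything is read off
from four quantities: `S₁ - S₂` (`sepSubNest`), `S₃` (`interSum`), the number `d` of double points,
and `ind ^ 2`. The index is an integer and depends continuously on the curve, so it is constant
along every regular homotopy; only the Gauss diagram with its signs has to be followed.

Base point. When the base point passes a double point, its chord changes sign, and separated and
nested positions relative to it are exchanged, so `S₁ - S₂` is preserved. The chords interleaved
with it stay interleaved, so `S₃` is preserved exactly when their signs add up to zero. They are the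
intersections of the two loops into which the double point cuts the curve, and the intersection
number of two closed plane curves vanishes (`sum_doubleSign_eq_zero`, proved by integrating a
mollified Jacobian). Thus `arnold_comp_add` allows the base point to be kept off the double points;
reversal of the orientation is then a direct comparison of chords.

Isotopy. By the implicit function theorem transverse double points move smoothly, and by compactness
no others appear nearby. Order and signs persist, so the invariants are locally constant at generic
times (`eventually_arnold_eq`), and the jump of a perestroika can be computed at times `±t` close to
`0`.

Self-tangency. Near the tangency the double points form a smooth curve on which time has a fold
(`exists_tangency_branches`). Two chords are born, of opposite signs and equally placed with respect
to all other chords, so only their mutual position counts: interleaved in the direct case (`S₃`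
drops by `1`), nested in the inverse case (`S₁ - S₂` grows by `1`), while `d` grows by `2`.

Triple point. Three chords persist, but the two endpoints near each of the three passages are
exchanged. One determinant `D` governs the three exchanges, and its sign is the sign of the triangle
(`passage_sub_mul`, `IsTriplePoint.pos_of_tripleSign`). For `D > 0`, `S₁ - S₂` drops by `3` and `S₃`
by `1` (`sum_bits_eq`).

Normalization is a computation of the double points of the figure eight and of the epitrochoids.

For `Gamma n` the relations above give `J⁺ / 2 + St = -S₃` and `J⁻ / 2 + St = -d / 2 - S₃`, so
neither the index nor `S₁ - S₂` is needed. The chords are the pairs `x < y` in `[0, 2n]` of equal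
parity, ordered lexicographically by endpoints and with sign `-(-1) ^ x`; counting gives `d = n ^
2`, writhe `n` and `S₃ = n.choose 3`. In the ascending diagram all crossing signs are opposite to
the signs of the double points, whence the cowrithe is `S₃`. -/

open Classical in
/-- The sum of the products of weights over the pairs of elements of `C` in the relation `R`. -/
noncomputable def chordSum {ι : Type*} (C : Finset ι) (e : ι → ℝ) (R : ι → ι → Prop) : ℝ :=
  ∑ c ∈ C, ∑ d ∈ C, if R c d then e c * e d else 0

theorem chordSum_congr {ι : Type*} {C : Finset ι} {e e' : ι → ℝ} {R R' : ι → ι → Prop}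
    (he : ∀ c ∈ C, e c = e' c) (hR : ∀ c ∈ C, ∀ d ∈ C, R c d ↔ R' c d) :
    chordSum C e R = chordSum C e' R' := by
  unfold chordSum
  refine Finset.sum_congr rfl fun c hc => Finset.sum_congr rfl fun d hd => ?_
  rw [he c hc, he d hd]
  classical exact if_congr (hR c hc d hd) rfl rfl

open Classical in
theorem chordSum_insert {ι : Type*} [DecidableEq ι] {C : Finset ι} {p : ι} (hp : p ∉ C)
    (e : ι → ℝ) {R : ι → ι → Prop} (hR : ¬ R p p) :
    chordSum (insert p C) e R = chordSum C e R +
      ∑ d ∈ C, ((if R p d then e p * e d else 0) + (if R d p then e p * e d else 0)) := by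
  unfold chordSum
  rw [Finset.sum_insert hp]
  simp only [Finset.sum_insert hp, hR, if_false, zero_add, Finset.sum_add_distrib]
  simp only [mul_comm (e p)]
  ring

/-- Labelling the chords of several curves by one index set turns a comparison of their pair sums
into a termwise comparison over that set. -/
theorem pairSum_eq_chordSum {ι : Type*} {γ : ℝ → ℂ} {C : Finset ι} {f : ι → ℝ × ℝ}
    (hf : BijOn f C (doublePairs γ)) (ε : ℝ × ℝ → ℝ) (R : ℝ × ℝ → ℝ × ℝ → Prop) :
    pairSum γ ε R = chordSum C (fun c => ε (f c)) (fun c d => R (f c) (f d)) := by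
  classical
  unfold pairSum chordSum
  rw [← Finset.sum_product', ← Finset.sum_filter]
  rw [← finsum_mem_coe_finset]
  symm
  refine finsum_mem_eq_of_bijOn (fun q => (f q.1, f q.2)) ⟨?_, ?_, ?_⟩ fun q _ => rfl
  · rintro ⟨c, d⟩ h
    simp only [Finset.coe_filter, Finset.mem_product, mem_ofPred_eq] at h
    exact ⟨hf.mapsTo h.1.1, hf.mapsTo h.1.2, h.2⟩
  · rintro ⟨c, d⟩ h ⟨c', d'⟩ h' he
    simp only [Finset.coe_filter, Finset.mem_product, mem_ofPred_eq] at h h'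
    simp only [Prod.mk.injEq] at he
    rw [hf.injOn h.1.1 h'.1.1 he.1, hf.injOn h.1.2 h'.1.2 he.2]
  · rintro ⟨p, q⟩ ⟨hp, hq, hR⟩
    obtain ⟨c, hc, rfl⟩ := hf.surjOn hp
    obtain ⟨d, hd, rfl⟩ := hf.surjOn hq
    refine ⟨(c, d), ?_, rfl⟩
    simp only [Finset.coe_filter, Finset.mem_product, mem_ofPred_eq]
    exact ⟨⟨hc, hd⟩, hR⟩

theorem doubleCount_eq_card {ι : Type*} {γ : ℝ → ℂ} {C : Finset ι} {f : ι → ℝ × ℝ}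
    (hf : BijOn f C (doublePairs γ)) : doubleCount γ = C.card := by
  unfold doubleCount
  rw [← hf.image_eq, hf.injOn.ncard_image, Set.ncard_coe_finset]

/-- The three invariants together. -/
noncomputable def arnold (γ : ℝ → ℂ) : ℝ × ℝ × ℝ := (Jplus γ, Jminus γ, St γ)

/-- The difference `S₁ - S₂` of the sums over separated and nested pairs. -/
noncomputable def sepSubNest (γ : ℝ → ℂ) : ℝ :=
  pairSum γ (doubleSign γ) Separated - pairSum γ (doubleSign γ) Nested

/-- The sum over interleaved pairs. -/
noncomputable def interSum (γ : ℝ → ℂ) : ℝ := pairSum γ (doubleSign γ) Interleaved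

theorem Jplus_eq (γ : ℝ → ℂ) : Jplus γ = sepSubNest γ - 3 * interSum γ
    - ((doubleCount γ : ℝ) - 1) / 2 - whitneyIndex γ ^ 2 / 2 := rfl

theorem Jminus_eq (γ : ℝ → ℂ) : Jminus γ = Jplus γ - doubleCount γ := by
  unfold Jplus Jminus; ring

/-- The terms in `d` and `ind` of `St` are `-1/2` times those of `J⁺`, and so is the term in `S₁ -
S₂`; for `S₃` one has `1/2 = 3/2 - 1`. Changes of `St` thus follow from those of `J⁺` and `S₃`. -/
theorem St_eq (γ : ℝ → ℂ) : St γ = -(Jplus γ) / 2 - interSum γ := by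
  unfold Jplus St interSum; ring

theorem arnold_congr {γ γ' : ℝ → ℂ} (h1 : sepSubNest γ = sepSubNest γ')
    (h2 : interSum γ = interSum γ') (h3 : doubleCount γ = doubleCount γ')
    (h4 : whitneyIndex γ ^ 2 = whitneyIndex γ' ^ 2) : arnold γ = arnold γ' := by
  have : Jplus γ = Jplus γ' := by rw [Jplus_eq, Jplus_eq, h1, h2, h3, h4]
  unfold arnold
  rw [Jminus_eq, Jminus_eq, St_eq, St_eq, this, h2, h3]

theorem arnold_eq_iff {γ γ' : ℝ → ℂ} :
    arnold γ = arnold γ' ↔ Jplus γ = Jplus γ' ∧ Jminus γ = Jminus γ' ∧ St γ = St γ' := by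
  simp [arnold]

/-- `J⁺ - J⁻ = d`. This transports a count of double points from the endpoints of a homotopy to
times close to a perestroika. -/
theorem doubleCount_eq_of_arnold_eq {γ γ' : ℝ → ℂ} (h : arnold γ = arnold γ') :
    doubleCount γ = doubleCount γ' := by
  rw [arnold_eq_iff, Jminus_eq, Jminus_eq] at h
  have : (doubleCount γ : ℝ) = doubleCount γ' := by linarith [h.1, h.2.1]
  exact_mod_cast this

/-- Curves whose chords and signs correspond have the same pair sums. -/
theorem arnold_eq_of_bijOn {ι : Type*} {γ γ' : ℝ → ℂ} {C : Finset ι} {f f' : ι → ℝ × ℝ}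
    (hf : BijOn f C (doublePairs γ)) (hf' : BijOn f' C (doublePairs γ'))
    (hε : ∀ c ∈ C, doubleSign γ (f c) = doubleSign γ' (f' c))
    (hS : ∀ c ∈ C, ∀ d ∈ C, Separated (f c) (f d) ↔ Separated (f' c) (f' d))
    (hN : ∀ c ∈ C, ∀ d ∈ C, Nested (f c) (f d) ↔ Nested (f' c) (f' d))
    (hI : ∀ c ∈ C, ∀ d ∈ C, Interleaved (f c) (f d) ↔ Interleaved (f' c) (f' d))
    (h4 : whitneyIndex γ ^ 2 = whitneyIndex γ' ^ 2) : arnold γ = arnold γ' := by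
  refine arnold_congr ?_ ?_ ?_ h4
  · unfold sepSubNest
    simp only [pairSum_eq_chordSum hf, pairSum_eq_chordSum hf']
    rw [chordSum_congr hε hS, chordSum_congr hε hN]
  · unfold interSum
    simp only [pairSum_eq_chordSum hf, pairSum_eq_chordSum hf']
    rw [chordSum_congr hε hI]
  · rw [doubleCount_eq_card hf, doubleCount_eq_card hf']

/-- The endpoints of `c` and `d` occur in the same order as those of `c'` and `d'`. -/
def SameOrder (c d c' d' : ℝ × ℝ) : Prop :=
  (c.1 < d.1 ↔ c'.1 < d'.1) ∧ (c.1 < d.2 ↔ c'.1 < d'.2) ∧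
  (c.2 < d.1 ↔ c'.2 < d'.1) ∧ (c.2 < d.2 ↔ c'.2 < d'.2) ∧
  (d.1 < c.1 ↔ d'.1 < c'.1) ∧ (d.1 < c.2 ↔ d'.1 < c'.2) ∧
  (d.2 < c.1 ↔ d'.2 < c'.1) ∧ (d.2 < c.2 ↔ d'.2 < c'.2)

theorem SameOrder.separated {c d c' d' : ℝ × ℝ} (h : SameOrder c d c' d') :
    Separated c d ↔ Separated c' d' := h.2.2.1

theorem SameOrder.nested {c d c' d' : ℝ × ℝ} (h : SameOrder c d c' d') :
    Nested c d ↔ Nested c' d' := and_congr h.1 h.2.2.2.2.2.2.2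

theorem SameOrder.interleaved {c d c' d' : ℝ × ℝ} (h : SameOrder c d c' d') :
    Interleaved c d ↔ Interleaved c' d' :=
  and_congr h.1 (and_congr h.2.2.2.2.2.1 h.2.2.2.1)

theorem arnold_eq_of_sameOrder {ι : Type*} {γ γ' : ℝ → ℂ} {C : Finset ι} {f f' : ι → ℝ × ℝ}
    (hf : BijOn f C (doublePairs γ)) (hf' : BijOn f' C (doublePairs γ'))
    (hε : ∀ c ∈ C, doubleSign γ (f c) = doubleSign γ' (f' c))
    (hR : ∀ c ∈ C, ∀ d ∈ C, SameOrder (f c) (f d) (f' c) (f' d))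
    (h4 : whitneyIndex γ ^ 2 = whitneyIndex γ' ^ 2) : arnold γ = arnold γ' :=
  arnold_eq_of_bijOn hf hf' hε (fun c hc d hd => (hR c hc d hd).separated)
    (fun c hc d hd => (hR c hc d hd).nested) (fun c hc d hd => (hR c hc d hd).interleaved) h4

/-! ### Endpoints of chords -/

/-- A shared endpoint of two chords would give three passages through one point. With the next two
lemmas: without triple points distinct chords have four distinct endpoints, which makes their
relative position stable. -/
theorem doublePairs_fst_injOn {γ : ℝ → ℂ} (h : ∀ s t u, ¬ IsTriplePassage γ s t u)
    {c d : ℝ × ℝ} (hc : c ∈ doublePairs γ) (hd : d ∈ doublePairs γ) (hcd : c.1 = d.1) :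
    c = d := by
  obtain ⟨c1, c2⟩ := c
  obtain ⟨d1, d2⟩ := d
  obtain ⟨h1, h2, h3, h4⟩ := hc
  obtain ⟨k1, k2, k3, k4⟩ := hd
  dsimp only at *
  subst hcd
  rcases lt_trichotomy c2 d2 with hlt | rfl | hlt
  · exact absurd ⟨⟨h1, h2, h3, h4⟩, ⟨h1.trans h2.le, hlt, k3, h4.symm.trans k4⟩⟩ (h c1 c2 d2)
  · rfl
  · exact absurd ⟨⟨k1, k2, k3, k4⟩, ⟨h1.trans k2.le, hlt, h3, k4.symm.trans h4⟩⟩ (h c1 d2 c2)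

theorem doublePairs_snd_injOn {γ : ℝ → ℂ} (h : ∀ s t u, ¬ IsTriplePassage γ s t u)
    {c d : ℝ × ℝ} (hc : c ∈ doublePairs γ) (hd : d ∈ doublePairs γ) (hcd : c.2 = d.2) :
    c = d := by
  obtain ⟨c1, c2⟩ := c
  obtain ⟨d1, d2⟩ := d
  obtain ⟨h1, h2, h3, h4⟩ := hc
  obtain ⟨k1, k2, k3, k4⟩ := hd
  dsimp only at *
  subst hcd
  rcases lt_trichotomy c1 d1 with hlt | rfl | hlt
  · exact absurd ⟨⟨h1, hlt, k2.trans h3, h4.trans k4.symm⟩, ⟨k1, k2, k3, k4⟩⟩ (h c1 d1 c2)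
  · rfl
  · exact absurd ⟨⟨k1, hlt, h2.trans h3, k4.trans h4.symm⟩, ⟨h1, h2, h3, h4⟩⟩ (h d1 c1 c2)

theorem doublePairs_fst_ne_snd {γ : ℝ → ℂ} (h : ∀ s t u, ¬ IsTriplePassage γ s t u)
    {c d : ℝ × ℝ} (hc : c ∈ doublePairs γ) (hd : d ∈ doublePairs γ) : c.1 ≠ d.2 := by
  intro hcd
  refine h d.1 d.2 c.2 ⟨hd, ?_⟩
  rw [← hcd]
  exact hc

/-! ### The determinant of plane vectors -/

theorem cross_neg_neg (u v : ℂ) : cross (-u) (-v) = cross u v := by simp [cross]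

theorem cross_swap (u v : ℂ) : cross v u = -cross u v := by simp [cross]; ring

theorem cross_self (u : ℂ) : cross u u = 0 := by simp [cross]; ring

theorem cross_add_left (u v w : ℂ) : cross (u + v) w = cross u w + cross v w := by
  simp [cross]; ring

theorem cross_add_right (u v w : ℂ) : cross u (v + w) = cross u v + cross u w := by
  simp [cross]; ring

theorem cross_sub_left (u v w : ℂ) : cross (u - v) w = cross u w - cross v w := by
  simp [cross]; ring

theorem cross_smul_left (a : ℝ) (u v : ℂ) : cross (a • u) v = a * cross u v := by
  simp [cross]; ring

theorem cross_smul_right (a : ℝ) (u v : ℂ) : cross u (a • v) = a * cross u v := by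
  simp [cross]; ring

theorem cross_neg_left (u v : ℂ) : cross (-u) v = -cross u v := by simp [cross]; ring

theorem cross_neg_right (u v : ℂ) : cross u (-v) = -cross u v := by simp [cross]; ring

theorem continuous_cross {X : Type*} [TopologicalSpace X] {f g : X → ℂ} (hf : Continuous f)
    (hg : Continuous g) : Continuous fun x => cross (f x) (g x) := by
  unfold PlaneCurves.cross
  fun_prop

theorem continuousAt_cross {X : Type*} [TopologicalSpace X] {f g : X → ℂ} {x : X}
    (hf : ContinuousAt f x) (hg : ContinuousAt g x) :
    ContinuousAt (fun x => cross (f x) (g x)) x := by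
  unfold PlaneCurves.cross
  fun_prop

end PlaneCurves

namespace PlaneCurves

open Set Filter Topology

/-! ### Derivatives of families of curves -/

section Families

variable {H : ℝ → ℝ → ℂ}

theorem hasDerivAt_snd (hH : ContDiff ℝ ∞ (fun q : ℝ × ℝ => H q.1 q.2)) (t s : ℝ) :
    HasDerivAt (H t) (fderiv ℝ (fun q : ℝ × ℝ => H q.1 q.2) (t, s) (0, 1)) s := by
  have h1 := (hH.differentiable (by simp) (t, s)).hasFDerivAt
  have h2 : HasDerivAt (fun s : ℝ => (t, s)) ((0 : ℝ), (1 : ℝ)) s :=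
    (hasDerivAt_const s t).prodMk (hasDerivAt_id s)
  exact h1.comp_hasDerivAt s h2

theorem hasDerivAt_fst (hH : ContDiff ℝ ∞ (fun q : ℝ × ℝ => H q.1 q.2)) (t s : ℝ) :
    HasDerivAt (fun t => H t s) (fderiv ℝ (fun q : ℝ × ℝ => H q.1 q.2) (t, s) (1, 0)) t := by
  have h1 := (hH.differentiable (by simp) (t, s)).hasFDerivAt
  have h2 : HasDerivAt (fun t : ℝ => (t, s)) ((1 : ℝ), (0 : ℝ)) t :=
    (hasDerivAt_id t).prodMk (hasDerivAt_const t s)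
  exact h1.comp_hasDerivAt t h2

theorem contDiff_deriv_snd (hH : ContDiff ℝ ∞ (fun q : ℝ × ℝ => H q.1 q.2)) :
    ContDiff ℝ ∞ (fun q : ℝ × ℝ => deriv (H q.1) q.2) := by
  have : (fun q : ℝ × ℝ => deriv (H q.1) q.2) =
      fun q => fderiv ℝ (fun q : ℝ × ℝ => H q.1 q.2) q (0, 1) := by
    ext q; exact (hasDerivAt_snd hH q.1 q.2).deriv
  rw [this]
  exact (hH.fderiv_right (m := ∞) (by simp)).clm_apply contDiff_const

theorem contDiff_deriv_fst (hH : ContDiff ℝ ∞ (fun q : ℝ × ℝ => H q.1 q.2)) :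
    ContDiff ℝ ∞ (fun q : ℝ × ℝ => deriv (fun t => H t q.2) q.1) := by
  have : (fun q : ℝ × ℝ => deriv (fun t => H t q.2) q.1) =
      fun q => fderiv ℝ (fun q : ℝ × ℝ => H q.1 q.2) q (1, 0) := by
    ext q; exact (hasDerivAt_fst hH q.1 q.2).deriv
  rw [this]
  exact (hH.fderiv_right (m := ∞) (by simp)).clm_apply contDiff_const

theorem fderiv_family_apply (hH : ContDiff ℝ ∞ (fun q : ℝ × ℝ => H q.1 q.2)) (t s : ℝ)
    (v : ℝ × ℝ) : fderiv ℝ (fun q : ℝ × ℝ => H q.1 q.2) (t, s) v =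
      v.1 • deriv (fun t => H t s) t + v.2 • deriv (H t) s := by
  rw [(hasDerivAt_snd hH t s).deriv, (hasDerivAt_fst hH t s).deriv, ← map_smul, ← map_smul,
    ← map_add]
  simp

end Families

theorem IsPlaneCurve.differentiable {γ : ℝ → ℂ} (h : IsPlaneCurve γ) : Differentiable ℝ γ :=
  h.smooth.differentiable (by simp)

theorem IsPlaneCurve.contDiff_deriv {γ : ℝ → ℂ} (h : IsPlaneCurve γ) :
    ContDiff ℝ ∞ (deriv γ) := (contDiff_infty_iff_deriv.mp h.smooth).2

theorem IsPlaneCurve.continuous_deriv {γ : ℝ → ℂ} (h : IsPlaneCurve γ) :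
    Continuous (deriv γ) := h.contDiff_deriv.continuous

theorem IsPlaneCurve.periodic_deriv {γ : ℝ → ℂ} (h : IsPlaneCurve γ) :
    Function.Periodic (deriv γ) (2 * Real.pi) := by
  intro s
  rw [← deriv_comp_add_const]
  exact congrArg (fun f => deriv f s) (funext h.periodic)

theorem IsPlaneCurve.comp_add {γ : ℝ → ℂ} (h : IsPlaneCurve γ) (c : ℝ) :
    IsPlaneCurve (fun s => γ (s + c)) where
  smooth := h.smooth.comp (contDiff_id.add contDiff_const)
  periodic := fun s => by
    show γ (s + 2 * Real.pi + c) = γ (s + c)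
    rw [add_right_comm]; exact h.periodic _
  immersed := fun s => by
    rw [deriv_comp_add_const]; exact h.immersed _

theorem IsPlaneCurve.comp_neg {γ : ℝ → ℂ} (h : IsPlaneCurve γ) :
    IsPlaneCurve (fun s => γ (-s)) where
  smooth := h.smooth.comp contDiff_neg
  periodic := fun s => by
    show γ (-(s + 2 * Real.pi)) = γ (-s)
    rw [neg_add]; exact h.periodic.sub_eq (-s)
  immersed := fun s => by
    rw [deriv_comp_neg]; simpa using h.immersed _

/-! ### The Whitney index -/

theorem IsPlaneCurve.periodic_turning {γ : ℝ → ℂ} (h : IsPlaneCurve γ) :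
    Function.Periodic (fun s => (deriv (deriv γ) s / deriv γ s).im) (2 * Real.pi) := by
  intro s
  have h1 := h.periodic_deriv
  have h2 : deriv (deriv γ) (s + 2 * Real.pi) = deriv (deriv γ) s := by
    rw [← deriv_comp_add_const]
    exact congrArg (fun f => deriv f s) (funext h1)
  simp only [h1 s, h2]

theorem whitneyIndex_comp_add {γ : ℝ → ℂ} (h : IsPlaneCurve γ) (c : ℝ) :
    whitneyIndex (fun s => γ (s + c)) = whitneyIndex γ := by
  unfold whitneyIndex
  congr 1
  have h1 : deriv (fun s => γ (s + c)) = fun s => deriv γ (s + c) := by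
    ext s; rw [deriv_comp_add_const]
  have h2 : deriv (fun s => deriv γ (s + c)) = fun s => deriv (deriv γ) (s + c) := by
    ext s; rw [deriv_comp_add_const]
  rw [h1, h2]
  rw [intervalIntegral.integral_comp_add_right (fun s => (deriv (deriv γ) s / deriv γ s).im) c]
  have := h.periodic_turning.intervalIntegral_add_eq c 0
  rw [zero_add] at this ⊢
  rw [← this, add_comm]

theorem whitneyIndex_comp_neg {γ : ℝ → ℂ} (h : IsPlaneCurve γ) :
    whitneyIndex (fun s => γ (-s)) = -whitneyIndex γ := by
  unfold whitneyIndex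
  have h1 : deriv (fun s => γ (-s)) = fun s => -deriv γ (-s) := by
    ext s; rw [deriv_comp_neg]
  have h2 : deriv (fun s => -deriv γ (-s)) = fun s => deriv (deriv γ) (-s) := by
    ext s; rw [deriv.fun_neg, deriv_comp_neg, neg_neg]
  rw [h1, h2, ← neg_div]
  congr 1
  simp only [div_neg, Complex.neg_im, intervalIntegral.integral_neg]
  rw [intervalIntegral.integral_comp_neg (fun s => (deriv (deriv γ) s / deriv γ s).im)]
  have := h.periodic_turning.intervalIntegral_add_eq (-(2 * Real.pi)) 0
  simp only [neg_add_cancel, zero_add] at this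
  rw [neg_zero, this]

/-- With `I` the primitive of `γ'' / γ'`, the product `γ' * exp (-I)` is constant; as `γ'` returns
to its initial value after one period, `exp (-I (2π)) = 1`. -/
theorem exists_whitneyIndex_eq_intCast {γ : ℝ → ℂ} (h : IsPlaneCurve γ) :
    ∃ n : ℤ, whitneyIndex γ = n := by
  have hc : Continuous fun s => deriv (deriv γ) s / deriv γ s :=
    ((contDiff_infty_iff_deriv.mp h.contDiff_deriv).2.continuous).div h.continuous_deriv h.immersed
  set I : ℝ → ℂ := fun x => ∫ s in (0 : ℝ)..x, deriv (deriv γ) s / deriv γ s with hI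
  have hd : ∀ x, HasDerivAt I (deriv (deriv γ) x / deriv γ x) x := fun x =>
    intervalIntegral.integral_hasDerivAt_right (hc.intervalIntegrable _ _)
      (hc.stronglyMeasurableAtFilter _ _) hc.continuousAt
  have hd2 : ∀ x, HasDerivAt (fun x => deriv γ x * Complex.exp (-I x)) 0 x := by
    intro x
    have h1 := ((h.contDiff_deriv.differentiable (by simp)) x).hasDerivAt
    refine (h1.fun_mul (hd x).fun_neg.cexp).congr_deriv ?_
    have := mul_div_cancel₀ (deriv (deriv γ) x) (h.immersed x)
    linear_combination -(Complex.exp (-I x)) * this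
  have hconst := is_const_of_deriv_eq_zero (fun x => (hd2 x).differentiableAt)
    (fun x => (hd2 x).deriv) (2 * Real.pi) 0
  have hI0 : I 0 = 0 := by simp [hI]
  have hp : deriv γ (2 * Real.pi) = deriv γ 0 := by simpa using h.periodic_deriv 0
  simp only [hI0, hp, neg_zero, Complex.exp_zero, mul_one] at hconst
  have hexp : Complex.exp (-I (2 * Real.pi)) = 1 :=
    mul_left_cancel₀ (h.immersed 0) (hconst.trans (mul_one _).symm)
  obtain ⟨n, hn⟩ := Complex.exp_eq_one_iff.mp hexp
  refine ⟨-n, ?_⟩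
  have him : (∫ s in (0 : ℝ)..(2 * Real.pi), (deriv (deriv γ) s / deriv γ s).im) =
      (I (2 * Real.pi)).im :=
    Complex.imCLM.intervalIntegral_comp_comm (hc.intervalIntegrable _ _)
  unfold whitneyIndex
  rw [him]
  have : I (2 * Real.pi) = -(n * (2 * Real.pi * Complex.I)) := by rw [← hn, neg_neg]
  rw [this]
  simp
  field_simp

theorem continuous_whitneyIndex {H : ℝ → ℝ → ℂ} (h : IsRegularHomotopy H) :
    Continuous fun t : Icc (-1 : ℝ) 1 => whitneyIndex (H t) := by
  have h1 := contDiff_deriv_snd h.smooth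
  have h2 := contDiff_deriv_snd (H := fun t => deriv (H t)) h1
  unfold whitneyIndex
  refine Continuous.div_const (intervalIntegral.continuous_parametric_intervalIntegral_of_continuous'
    (f := fun (t : Icc (-1 : ℝ) 1) s => (deriv (deriv (H t)) s / deriv (H t) s).im) ?_ _ _) _
  have hm : Continuous fun q : Icc (-1 : ℝ) 1 × ℝ => ((q.1 : ℝ), q.2) := by fun_prop
  have e1 : Continuous fun q : Icc (-1 : ℝ) 1 × ℝ => deriv (H q.1) q.2 := h1.continuous.comp hm
  have e2 : Continuous fun q : Icc (-1 : ℝ) 1 × ℝ => deriv (deriv (H q.1)) q.2 :=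
    h2.continuous.comp hm
  exact Complex.continuous_im.comp (e2.div e1 fun q => (h.curve q.1 q.1.2).immersed q.2)

/-- A continuous integer-valued function on an interval is constant. -/
theorem whitneyIndex_eq_of_homotopy {H : ℝ → ℝ → ℂ} (h : IsRegularHomotopy H) {t t' : ℝ}
    (ht : t ∈ Icc (-1 : ℝ) 1) (ht' : t' ∈ Icc (-1 : ℝ) 1) :
    whitneyIndex (H t) = whitneyIndex (H t') := by
  choose n hn using fun t : Icc (-1 : ℝ) 1 => exists_whitneyIndex_eq_intCast (h.curve t t.2)
  have hc : Continuous n := by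
    rw [Int.isClosedEmbedding_coe_real.isInducing.continuous_iff]
    convert continuous_whitneyIndex h using 2 with t
    exact (hn t).symm
  have := PreconnectedSpace.constant (isPreconnected_iff_preconnectedSpace.mp isPreconnected_Icc) hc
    (x := ⟨t, ht⟩) (y := ⟨t', ht'⟩)
  have e1 := hn ⟨t, ht⟩
  have e2 := hn ⟨t', ht'⟩
  rw [this] at e1
  exact e1.trans e2.symm

end PlaneCurves

namespace PlaneCurves

open Set Filter Topology

/-! ### The implicit function theorem in the plane -/

theorem isInvertible_of_cross_ne_zero {L : ℝ × ℝ →L[ℝ] ℂ}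
    (h : cross (L (1, 0)) (L (0, 1)) ≠ 0) : L.IsInvertible := by
  have hL : ∀ v : ℝ × ℝ, L v = v.1 • L (1, 0) + v.2 • L (0, 1) := by
    intro v
    rw [← map_smul, ← map_smul, ← map_add]; simp
  have hinj : Function.Injective (L : ℝ × ℝ →ₗ[ℝ] ℂ) := by
    rw [injective_iff_map_eq_zero]
    intro v hv
    have hv : L v = 0 := hv
    have h1 : cross (L v) (L (0, 1)) = v.1 * cross (L (1, 0)) (L (0, 1)) := by
      rw [hL v, cross_add_left, cross_smul_left, cross_smul_left, cross_self]; ring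
    have h2 : cross (L (1, 0)) (L v) = v.2 * cross (L (1, 0)) (L (0, 1)) := by
      rw [hL v, cross_add_right, cross_smul_right, cross_smul_right, cross_self]; ring
    rw [hv] at h1 h2
    have h3 : v.1 * cross (L (1, 0)) (L (0, 1)) = 0 := by rw [← h1]; simp [cross]
    have h4 : v.2 * cross (L (1, 0)) (L (0, 1)) = 0 := by rw [← h2]; simp [cross]
    exact Prod.ext ((mul_eq_zero.mp h3).resolve_right h) ((mul_eq_zero.mp h4).resolve_right h)
  refine ⟨(LinearEquiv.ofInjectiveOfFinrankEq (L : ℝ × ℝ →ₗ[ℝ] ℂ) hinj ?_).toContinuousLinearEquiv,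
    ?_⟩
  · simp
  · ext <;> rfl

/-- The implicit function theorem for a plane-valued function of three variables, solved with
respect to the last two. -/
theorem exists_implicit {f : ℝ × ℝ × ℝ → ℂ} (hf : ContDiff ℝ 1 f) {u : ℝ × ℝ × ℝ}
    (h : cross (fderiv ℝ f u (0, 1, 0)) (fderiv ℝ f u (0, 0, 1)) ≠ 0) :
    ∃ ψ : ℝ → ℝ × ℝ, (∀ᶠ v in 𝓝 u, f v = f u ↔ ψ v.1 = v.2) ∧ ψ u.1 = u.2 ∧
      ∀ᶠ x in 𝓝 u.1, f (x, ψ x) = f u ∧ DifferentiableAt ℝ ψ x := by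
  -- The implicit function is at first known to be differentiable only at its own base point. Hence
  -- `key` is stated for every base point: for `x` near `u.1`, local uniqueness identifies the germ
  -- of `ψ` at `x` with the implicit function based at `(x, ψ x)`.
  have key : ∀ v : ℝ × ℝ × ℝ, cross (fderiv ℝ f v (0, 1, 0)) (fderiv ℝ f v (0, 0, 1)) ≠ 0 →
      ∃ ψ : ℝ → ℝ × ℝ, (∀ᶠ w in 𝓝 v, f w = f v ↔ ψ w.1 = w.2) ∧ ψ v.1 = v.2 ∧
        DifferentiableAt ℝ ψ v.1 ∧ ∀ᶠ x in 𝓝 v.1, f (x, ψ x) = f v := by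
    intro v hv
    have hs : HasStrictFDerivAt f (fderiv ℝ f v) v :=
      hf.contDiffAt.hasStrictFDerivAt (by simp)
    have hi : (fderiv ℝ f v ∘L .inr ℝ ℝ (ℝ × ℝ)).IsInvertible :=
      isInvertible_of_cross_ne_zero (by simpa using hv)
    have he := hs.eventually_apply_eq_iff_implicitFunctionOfProdDomain hi
    exact ⟨hs.implicitFunctionOfProdDomain hi, he, he.self_of_nhds.mp rfl,
      (hs.hasStrictFDerivAt_implicitFunctionOfProdDomain hi).hasFDerivAt.differentiableAt,
      hs.eventually_apply_implicitFunctionOfProdDomain hi⟩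
  obtain ⟨ψ, h1, h2, h3, h4⟩ := key u h
  refine ⟨ψ, h1, h2, ?_⟩
  have hc : Tendsto (fun x => (x, ψ x)) (𝓝 u.1) (𝓝 u) := by
    have : ContinuousAt (fun x => (x, ψ x)) u.1 := continuousAt_id.prodMk h3.continuousAt
    rw [ContinuousAt, h2] at this
    exact this
  have hcross : ∀ᶠ v in 𝓝 u, cross (fderiv ℝ f v (0, 1, 0)) (fderiv ℝ f v (0, 0, 1)) ≠ 0 := by
    have hd := hf.continuous_fderiv (by simp)
    exact (continuous_cross (hd.clm_apply continuous_const)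
      (hd.clm_apply continuous_const)).continuousAt.eventually_ne h
  filter_upwards [h4, hc.eventually hcross, hc.eventually h1.eventually_nhds] with x e1 e2 e3
  refine ⟨e1, ?_⟩
  obtain ⟨ψ', k1, k2, k3, k4⟩ := key _ e2
  have hc' : Tendsto (fun y => (y, ψ' y)) (𝓝 x) (𝓝 (x, ψ x)) := by
    have : ContinuousAt (fun y => (y, ψ' y)) x := continuousAt_id.prodMk k3.continuousAt
    rw [ContinuousAt] at this
    dsimp only at k2
    rwa [k2] at this
  have : ψ =ᶠ[𝓝 x] ψ' := by
    filter_upwards [hc'.eventually e3, k4] with y l1 l2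
    exact l1.mp (l2.trans e1)
  exact k3.congr_of_eventuallyEq this

/-! ### Tracking transverse double points -/

section Track

variable {H : ℝ → ℝ → ℂ}

theorem contDiff_difference (hH : ContDiff ℝ ∞ (fun q : ℝ × ℝ => H q.1 q.2)) :
    ContDiff ℝ ∞ (fun v : ℝ × ℝ × ℝ => H v.1 v.2.1 - H v.1 v.2.2) := by
  have h1 : ContDiff ℝ ∞ (fun v : ℝ × ℝ × ℝ => (v.1, v.2.1)) := by fun_prop
  have h2 : ContDiff ℝ ∞ (fun v : ℝ × ℝ × ℝ => (v.1, v.2.2)) := by fun_prop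
  exact (hH.comp h1).sub (hH.comp h2)

theorem fderiv_difference (hH : ContDiff ℝ ∞ (fun q : ℝ × ℝ => H q.1 q.2)) (v w : ℝ × ℝ × ℝ) :
    fderiv ℝ (fun v : ℝ × ℝ × ℝ => H v.1 v.2.1 - H v.1 v.2.2) v w =
      w.1 • (deriv (fun t => H t v.2.1) v.1 - deriv (fun t => H t v.2.2) v.1) +
      w.2.1 • deriv (H v.1) v.2.1 - w.2.2 • deriv (H v.1) v.2.2 := by
  have hd := hH.differentiable (by simp)
  have h1 : HasFDerivAt (fun v : ℝ × ℝ × ℝ => (v.1, v.2.1)) ((ContinuousLinearMap.fst ℝ ℝ _).prod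
      ((ContinuousLinearMap.fst ℝ ℝ ℝ).comp (ContinuousLinearMap.snd ℝ ℝ _))) v :=
    hasFDerivAt_fst.prodMk (hasFDerivAt_fst.comp v hasFDerivAt_snd)
  have h2 : HasFDerivAt (fun v : ℝ × ℝ × ℝ => (v.1, v.2.2)) ((ContinuousLinearMap.fst ℝ ℝ _).prod
      ((ContinuousLinearMap.snd ℝ ℝ ℝ).comp (ContinuousLinearMap.snd ℝ ℝ _))) v :=
    hasFDerivAt_fst.prodMk (hasFDerivAt_snd.comp v hasFDerivAt_snd)
  have h3 := ((hd (v.1, v.2.1)).hasFDerivAt.comp v h1).sub ((hd (v.1, v.2.2)).hasFDerivAt.comp v h2)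
  have h4 : fderiv ℝ (fun v : ℝ × ℝ × ℝ => H v.1 v.2.1 - H v.1 v.2.2) v = _ := h3.fderiv
  rw [h4]
  simp only [sub_apply, ContinuousLinearMap.comp_apply,
    ContinuousLinearMap.prod_apply, ContinuousLinearMap.coe_fst', ContinuousLinearMap.coe_snd']
  rw [fderiv_family_apply hH, fderiv_family_apply hH]
  simp only [smul_sub]
  abel

/-- A transverse double point of a curve of a smooth family persists, and its parameters are
differentiable functions of the time. -/
theorem exists_track (hH : ContDiff ℝ ∞ (fun q : ℝ × ℝ => H q.1 q.2)) {t₀ : ℝ} {q : ℝ × ℝ}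
    (hq : H t₀ q.1 = H t₀ q.2) (htr : TransverseAt (H t₀) q) :
    ∃ ψ : ℝ → ℝ × ℝ, ψ t₀ = q ∧ DifferentiableAt ℝ ψ t₀ ∧
      (∀ᶠ t in 𝓝 t₀, H t (ψ t).1 = H t (ψ t).2) ∧
      (∀ᶠ v in 𝓝 (t₀, q), H v.1 v.2.1 = H v.1 v.2.2 → v.2 = ψ v.1) ∧
      deriv (fun t => H t q.1) t₀ + (deriv ψ t₀).1 • deriv (H t₀) q.1 =
        deriv (fun t => H t q.2) t₀ + (deriv ψ t₀).2 • deriv (H t₀) q.2 := by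
  have hF := contDiff_difference hH
  have hzero : H t₀ q.1 - H t₀ q.2 = 0 := sub_eq_zero.mpr hq
  obtain ⟨ψ, h1, h2, h3⟩ := exists_implicit (u := (t₀, q)) (hF.of_le (by simp)) (by
    rw [fderiv_difference hH, fderiv_difference hH]
    simp only [zero_smul, one_smul, zero_add, sub_zero, zero_sub, cross_neg_right, neg_ne_zero]
    exact htr)
  dsimp only at h1 h2 h3
  simp only [hzero, sub_eq_zero] at h1 h3
  refine ⟨ψ, h2, h3.self_of_nhds.2, h3.mono fun t h => h.1, h1.mono fun v h h' => (h.1 h').symm, ?_⟩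
  -- Differentiating the coincidence of the two passages in time gives the first-order relation that
  -- later identifies the speeds of the endpoints at a triple point.
  have hψ := h3.self_of_nhds.2.hasDerivAt
  have hpath : HasDerivAt (fun t => (t, ψ t)) ((1 : ℝ), deriv ψ t₀) t₀ :=
    (hasDerivAt_id t₀).prodMk hψ
  have hcomp := (hF.differentiable (by simp) (t₀, ψ t₀)).hasFDerivAt.comp_hasDerivAt t₀ hpath
  have hconst : HasDerivAt ((fun v : ℝ × ℝ × ℝ => H v.1 v.2.1 - H v.1 v.2.2) ∘ fun t => (t, ψ t))
      0 t₀ := by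
    refine (hasDerivAt_const t₀ (0 : ℂ)).congr_of_eventuallyEq ?_
    filter_upwards [h3] with t ht
    simpa [sub_eq_zero] using ht.1
  have := hcomp.unique hconst
  rw [fderiv_difference hH, h2] at this
  simp only [one_smul] at this
  rw [← sub_eq_zero, ← this]
  abel

/-! ### Double points of nearby curves -/

/-- The curves of a smooth family are uniformly locally injective where one is immersed. -/
theorem eventually_injective (hH : ContDiff ℝ ∞ (fun q : ℝ × ℝ => H q.1 q.2)) {t₀ s₀ : ℝ}
    (h : deriv (H t₀) s₀ ≠ 0) :
    ∀ᶠ v : ℝ × ℝ × ℝ in 𝓝 (t₀, s₀, s₀), H v.1 v.2.1 = H v.1 v.2.2 → v.2.1 = v.2.2 := by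
  -- The component of the curve along the fixed direction `d` has positive derivative near `(t₀,
  -- s₀)`; by Rolle two coinciding parameters there would contradict this.
  set d := deriv (H t₀) s₀
  have hpos : ∀ᶠ v : ℝ × ℝ in 𝓝 (t₀, s₀), 0 < inner ℝ d (deriv (H v.1) v.2) := by
    have hc : Continuous fun v : ℝ × ℝ => inner ℝ d (deriv (H v.1) v.2) :=
      continuous_const.inner (contDiff_deriv_snd hH).continuous
    refine hc.continuousAt.eventually (lt_mem_nhds ?_)
    exact real_inner_self_pos.mpr h
  obtain ⟨ε, hε, hball⟩ := Metric.eventually_nhds_iff.mp hpos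
  have hb : ∀ t s, dist t t₀ < ε → dist s s₀ < ε → 0 < inner ℝ d (deriv (H t) s) := by
    intro t s ht hs
    exact hball (y := (t, s)) (by rw [Prod.dist_eq]; exact max_lt ht hs)
  have key : ∀ t s u, dist t t₀ < ε → dist s s₀ < ε → dist u s₀ < ε → s < u →
      H t s ≠ H t u := by
    intro t s u ht hs hu hsu heq
    have hd : ∀ x, HasDerivAt (fun x => inner ℝ d (H t x)) (inner ℝ d (deriv (H t) x)) x := by
      intro x
      have := (hasDerivAt_const x d).inner ℝ (hasDerivAt_snd hH t x)
      rw [← (hasDerivAt_snd hH t x).deriv] at this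
      simpa using this
    obtain ⟨x, hx, hx0⟩ := exists_deriv_eq_zero hsu
      (fun x _ => (hd x).continuousAt.continuousWithinAt) (by rw [heq])
    rw [(hd x).deriv] at hx0
    refine (hb t x ht ?_).ne' hx0
    rw [Real.dist_eq, abs_lt] at *
    constructor <;> linarith [hx.1, hx.2]
  rw [Metric.eventually_nhds_iff]
  refine ⟨ε, hε, fun v hv heq => ?_⟩
  simp only [Prod.dist_eq, max_lt_iff] at hv
  rcases lt_trichotomy v.2.1 v.2.2 with hlt | he | hlt
  · exact absurd heq (key _ _ _ hv.1 hv.2.1 hv.2.2 hlt)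
  · exact he
  · exact absurd heq.symm (key _ _ _ hv.1 hv.2.2 hv.2.1 hlt)

/-- A property which holds for the double points of nearby curves near every double point of
`H t₀` holds for all double points of nearby curves, when the base point is not double. -/
theorem eventually_forall_doublePairs (hH : ContDiff ℝ ∞ (fun q : ℝ × ℝ => H q.1 q.2))
    {I : Set ℝ} {t₀ : ℝ} (ht₀ : t₀ ∈ I) (hI : ∀ t ∈ I, IsPlaneCurve (H t))
    (hbase : ∀ q ∈ doublePairs (H t₀), 0 < q.1) {P : ℝ → ℝ × ℝ → Prop}
    (hP : ∀ q ∈ doublePairs (H t₀), ∀ᶠ v in 𝓝 (t₀, q), H v.1 v.2.1 = H v.1 v.2.2 → P v.1 v.2) :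
    ∀ᶠ t in 𝓝[I] t₀, ∀ q ∈ doublePairs (H t), P t q := by
  have hpi := Real.pi_pos
  -- The set of admissible pairs is not compact. Its closure adds the diagonal, the corner `(0, 2π)`
  -- and the side `u = 2π`. Local injectivity excludes double points near the diagonal and, by
  -- periodicity, near the corner; a coincidence elsewhere on the side would make `0` a passage
  -- through a double point, against `hbase`.
  have hK : IsCompact {q : ℝ × ℝ | 0 ≤ q.1 ∧ q.1 ≤ q.2 ∧ q.2 ≤ 2 * Real.pi} := by
    refine (isCompact_Icc (a := ((0 : ℝ), (0 : ℝ))) (b := (2 * Real.pi, 2 * Real.pi))).of_isClosed_subset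
      ?_ ?_
    · have e1 : IsClosed {q : ℝ × ℝ | 0 ≤ q.1} := isClosed_le continuous_const continuous_fst
      have e2 : IsClosed {q : ℝ × ℝ | q.1 ≤ q.2} := isClosed_le continuous_fst continuous_snd
      have e3 : IsClosed {q : ℝ × ℝ | q.2 ≤ 2 * Real.pi} :=
        isClosed_le continuous_snd continuous_const
      exact e1.inter (e2.inter e3)
    · rintro q ⟨h1, h2, h3⟩
      exact ⟨⟨h1, h1.trans h2⟩, ⟨h2.trans h3, h3⟩⟩
  have key : ∀ᶠ t in 𝓝 t₀, ∀ q ∈ {q : ℝ × ℝ | 0 ≤ q.1 ∧ q.1 ≤ q.2 ∧ q.2 ≤ 2 * Real.pi},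
      t ∈ I → q ∈ doublePairs (H t) → P t q := by
    refine hK.eventually_forall_of_forall_eventually (x₀ := t₀)
      (P := fun t q => t ∈ I → q ∈ doublePairs (H t) → P t q) ?_
    rintro ⟨s, u⟩ ⟨h1, h2, h3⟩
    dsimp only at h1 h2 h3
    rcases h2.eq_or_lt with rfl | h2
    · filter_upwards [eventually_injective hH ((hI t₀ ht₀).immersed s)] with v hv _ hd
      exact absurd (hv hd.2.2.2) hd.2.1.ne
    by_cases hcor : s = 0 ∧ u = 2 * Real.pi
    · obtain ⟨rfl, rfl⟩ := hcor
      have hm : Tendsto (fun v : ℝ × ℝ × ℝ => (v.1, v.2.1, v.2.2 - 2 * Real.pi))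
          (𝓝 (t₀, 0, 2 * Real.pi)) (𝓝 (t₀, 0, 0)) := by
        have : Continuous (fun v : ℝ × ℝ × ℝ => (v.1, v.2.1, v.2.2 - 2 * Real.pi)) := by fun_prop
        have := this.tendsto (t₀, 0, 2 * Real.pi)
        simpa using this
      filter_upwards [hm.eventually (eventually_injective hH ((hI t₀ ht₀).immersed 0))]
        with v hv hvI hd
      have := hv (by rw [hd.2.2.2, (hI _ hvI).periodic.sub_eq])
      linarith [hd.1, hd.2.2.1]
    by_cases heq : H t₀ s = H t₀ u
    · have hu : u < 2 * Real.pi := by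
        refine lt_of_le_of_ne h3 fun hu => ?_
        subst hu
        have hs : 0 < s := lt_of_le_of_ne h1 fun h => hcor ⟨h.symm, rfl⟩
        have h0 : H t₀ 0 = H t₀ s := by
          have := (hI t₀ ht₀).periodic 0
          rw [zero_add] at this
          rw [heq, this]
        exact lt_irrefl _ (hbase (0, s) ⟨le_rfl, hs, h2, h0⟩)
      filter_upwards [hP (s, u) ⟨h1, h2, hu, heq⟩] with v hv _ hd
      exact hv hd.2.2.2
    · have hc : Continuous fun v : ℝ × ℝ × ℝ => H v.1 v.2.1 - H v.1 v.2.2 :=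
        (contDiff_difference hH).continuous
      have := hc.continuousAt.eventually_ne (x := (t₀, s, u)) (sub_ne_zero.mpr heq)
      filter_upwards [this] with v hv _ hd
      exact absurd (sub_eq_zero.mpr hd.2.2.2) hv
  rw [eventually_nhdsWithin_iff]
  filter_upwards [key] with t ht htI q hq
  exact ht q ⟨hq.1, hq.2.1.le, hq.2.2.1.le⟩ htI hq

theorem eventually_lt_iff {α : Type*} {l : Filter α} {f g : α → ℝ} {a b : ℝ} (hab : a ≠ b)
    (hf : Tendsto f l (𝓝 a)) (hg : Tendsto g l (𝓝 b)) : ∀ᶠ x in l, a < b ↔ f x < g x := by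
  rcases lt_or_gt_of_ne hab with h | h
  · filter_upwards [hf.eventually_lt hg h] with x hx
    exact iff_of_true h hx
  · filter_upwards [hg.eventually_lt hf h] with x hx
    exact iff_of_false h.not_gt hx.not_gt

/-- Chords without common endpoints keep their relative position under small perturbations. -/
theorem eventually_sameOrder {α : Type*} {l : Filter α} {f g : α → ℝ × ℝ} {c d : ℝ × ℝ}
    (hf : Tendsto f l (𝓝 c)) (hg : Tendsto g l (𝓝 d)) (h11 : c.1 ≠ d.1) (h12 : c.1 ≠ d.2)
    (h21 : c.2 ≠ d.1) (h22 : c.2 ≠ d.2) : ∀ᶠ x in l, SameOrder c d (f x) (g x) := by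
  have f1 := hf.fst_nhds
  have f2 := hf.snd_nhds
  have g1 := hg.fst_nhds
  have g2 := hg.snd_nhds
  filter_upwards [eventually_lt_iff h11 f1 g1, eventually_lt_iff h12 f1 g2,
    eventually_lt_iff h21 f2 g1, eventually_lt_iff h22 f2 g2, eventually_lt_iff h11.symm g1 f1,
    eventually_lt_iff h21.symm g1 f2, eventually_lt_iff h12.symm g2 f1,
    eventually_lt_iff h22.symm g2 f2] with x e1 e2 e3 e4 e5 e6 e7 e8
  exact ⟨e1, e2, e3, e4, e5, e6, e7, e8⟩

/-- Functions following the transverse double points of `H t₀` in the set `A`. -/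
structure IsTracking (H : ℝ → ℝ → ℂ) (t₀ : ℝ) (A : Set (ℝ × ℝ)) (ψ : ℝ × ℝ → ℝ → ℝ × ℝ) :
    Prop where
  apply_self : ∀ q ∈ A, ψ q t₀ = q
  differentiableAt : ∀ q ∈ A, DifferentiableAt ℝ (ψ q) t₀
  eventually_mem : ∀ q ∈ A, ∀ᶠ t in 𝓝 t₀, ψ q t ∈ doublePairs (H t)
  eventually_sign : ∀ q ∈ A, ∀ᶠ t in 𝓝 t₀, doubleSign (H t) (ψ q t) = doubleSign (H t₀) q
  eventually_unique : ∀ q ∈ A, ∀ᶠ v in 𝓝 (t₀, q), H v.1 v.2.1 = H v.1 v.2.2 → v.2 = ψ q v.1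
  deriv_eq : ∀ q ∈ A, deriv (fun t => H t q.1) t₀ + (deriv (ψ q) t₀).1 • deriv (H t₀) q.1 =
        deriv (fun t => H t q.2) t₀ + (deriv (ψ q) t₀).2 • deriv (H t₀) q.2

theorem IsTracking.tendsto {t₀ : ℝ} {A : Set (ℝ × ℝ)} {ψ : ℝ × ℝ → ℝ → ℝ × ℝ}
    (h : IsTracking H t₀ A ψ) {q : ℝ × ℝ} (hq : q ∈ A) : Tendsto (ψ q) (𝓝 t₀) (𝓝 q) := by
  have := (h.differentiableAt q hq).continuousAt.tendsto
  rwa [h.apply_self q hq] at this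

theorem eventually_sign_eq {X : Type*} {l : Filter X} {f : X → ℝ} {a : ℝ} (ha : a ≠ 0)
    (hf : Tendsto f l (𝓝 a)) : ∀ᶠ x in l, Real.sign (f x) = Real.sign a := by
  rcases lt_or_gt_of_ne ha with h | h
  · filter_upwards [hf.eventually_lt_const h] with x hx
    rw [Real.sign_of_neg h, Real.sign_of_neg hx]
  · filter_upwards [hf.eventually_const_lt h] with x hx
    rw [Real.sign_of_pos h, Real.sign_of_pos hx]

theorem exists_isTracking (hH : ContDiff ℝ ∞ (fun q : ℝ × ℝ => H q.1 q.2)) {t₀ : ℝ}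
    {A : Set (ℝ × ℝ)} (hA : A ⊆ doublePairs (H t₀)) (hbase : ∀ q ∈ A, 0 < q.1)
    (htr : ∀ q ∈ A, TransverseAt (H t₀) q) : ∃ ψ, IsTracking H t₀ A ψ := by
  choose! ψ h1 h2 h3 h4 h5 using fun q (hq : q ∈ A) => exists_track hH (hA hq).2.2.2 (htr q hq)
  have htend : ∀ q ∈ A, Tendsto (ψ q) (𝓝 t₀) (𝓝 q) := fun q hq => by
    have := (h2 q hq).continuousAt.tendsto
    rwa [h1 q hq] at this
  refine ⟨ψ, h1, h2, fun q hq => ?_, fun q hq => ?_, h4, h5⟩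
  -- Since the base point is not double, the first passage stays positive and the chord cannot leave
  -- the fundamental domain.
  · have f1 := (htend q hq).fst_nhds
    have f2 := (htend q hq).snd_nhds
    filter_upwards [h3 q hq, f1.eventually_const_lt (hbase q hq),
      f1.eventually_lt f2 (hA hq).2.1, f2.eventually_lt_const (hA hq).2.2.1] with t e1 e2 e3 e4
    exact ⟨e2.le, e3, e4, e1⟩
  · have hc := (contDiff_deriv_snd hH).continuous
    have m1 : Continuous fun v : ℝ × ℝ × ℝ => (v.1, v.2.1) := by fun_prop
    have m2 : Continuous fun v : ℝ × ℝ × ℝ => (v.1, v.2.2) := by fun_prop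
    have hcc : Continuous fun v : ℝ × ℝ × ℝ => cross (deriv (H v.1) v.2.1) (deriv (H v.1) v.2.2) :=
      continuous_cross (hc.comp m1) (hc.comp m2)
    have hp : Tendsto (fun t => (t, ψ q t)) (𝓝 t₀) (𝓝 (t₀, q)) :=
      tendsto_id.prodMk_nhds (htend q hq)
    have hlim := (hcc.tendsto (t₀, q)).comp hp
    simp only [Function.comp_def] at hlim
    exact eventually_sign_eq (f := fun t => cross (deriv (H t) (ψ q t).1) (deriv (H t) (ψ q t).2))
      (a := cross (deriv (H t₀) q.1) (deriv (H t₀) q.2)) (htr q hq) hlim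

theorem IsTracking.eventually_mapsTo {t₀ : ℝ} {A : Set (ℝ × ℝ)} {ψ : ℝ × ℝ → ℝ → ℝ × ℝ}
    (h : IsTracking H t₀ A ψ) (hA : A.Finite) :
    ∀ᶠ t in 𝓝 t₀, MapsTo (fun q => ψ q t) A (doublePairs (H t)) :=
  (eventually_all_finite hA).mpr h.eventually_mem

theorem IsTracking.eventually_injOn {t₀ : ℝ} {A : Set (ℝ × ℝ)} {ψ : ℝ × ℝ → ℝ → ℝ × ℝ}
    (h : IsTracking H t₀ A ψ) (hA : A.Finite) :
    ∀ᶠ t in 𝓝 t₀, InjOn (fun q => ψ q t) A := by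
  have : ∀ᶠ t in 𝓝 t₀, ∀ q ∈ A, ∀ q' ∈ A, ψ q t = ψ q' t → q = q' := by
    refine (eventually_all_finite hA).mpr fun q hq => (eventually_all_finite hA).mpr fun q' hq' => ?_
    by_cases hne : q = q'
    · exact Eventually.of_forall fun _ _ => hne
    · filter_upwards [((h.tendsto hq).prodMk_nhds (h.tendsto hq')).eventually
        ((isOpen_ne_fun continuous_fst continuous_snd).mem_nhds hne)] with t ht he
      exact absurd he ht
  filter_upwards [this] with t ht q hq q' hq' he using ht q hq q' hq' he

/-- Distinct limits keep the finitely many tracked chords distinct; surjectivity is the compactness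
argument of `eventually_forall_doublePairs`, with local uniqueness at each double point. -/
theorem IsTracking.eventually_bijOn {t₀ : ℝ} {ψ : ℝ × ℝ → ℝ → ℝ × ℝ}
    (h : IsTracking H t₀ (doublePairs (H t₀)) ψ)
    (hH : ContDiff ℝ ∞ (fun q : ℝ × ℝ => H q.1 q.2)) {I : Set ℝ} (ht₀ : t₀ ∈ I)
    (hI : ∀ t ∈ I, IsPlaneCurve (H t)) (hbase : ∀ q ∈ doublePairs (H t₀), 0 < q.1)
    (hfin : (doublePairs (H t₀)).Finite) :
    ∀ᶠ t in 𝓝[I] t₀, BijOn (fun q => ψ q t) (doublePairs (H t₀)) (doublePairs (H t)) := by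
  have hsurj := eventually_forall_doublePairs hH ht₀ hI hbase
    (P := fun t q => ∃ q' ∈ doublePairs (H t₀), ψ q' t = q) (fun q hq => by
      filter_upwards [h.eventually_unique q hq] with v hv he
      exact ⟨q, hq, (hv he).symm⟩)
  filter_upwards [hsurj, nhdsWithin_le_nhds (h.eventually_mapsTo hfin),
    nhdsWithin_le_nhds (h.eventually_injOn hfin)] with t h1 h2 h3
  exact ⟨h2, h3, h1⟩

end Track

end PlaneCurves

namespace PlaneCurves

open Set Filter Topology MeasureTheory

/-! ### Intersection numbers of closed arcs -/

/-- The intersection number of two closed arcs, counted with a mollifier, vanishes. -/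
theorem integral_mollified_cross_eq_zero {γ : ℝ → ℂ} (hγ : ContDiff ℝ ∞ γ) {a b c d : ℝ}
    (hab : a ≤ b) (hcd : c ≤ d) (h1 : γ a = γ b) (h2 : γ c = γ d) {φ₁ φ₂ : ℝ → ℝ}
    (hφ₁ : Continuous φ₁) (hφ₂ : ContDiff ℝ 1 φ₂) :
    ∫ p in Icc a b ×ˢ Icc c d, φ₁ (γ p.1 - γ p.2).re * φ₂ (γ p.1 - γ p.2).im *
      cross (deriv γ p.1) (deriv γ p.2) = 0 := by
  set G : ℝ → ℝ := fun x => ∫ y in (0 : ℝ)..x, φ₁ y with hG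
  have hGd : ∀ x, HasDerivAt G (φ₁ x) x := fun x =>
    intervalIntegral.integral_hasDerivAt_right (hφ₁.intervalIntegrable _ _)
      (hφ₁.stronglyMeasurableAtFilter _ _) hφ₁.continuousAt
  have hGc : Continuous G := continuous_iff_continuousAt.mpr fun x => (hGd x).continuousAt
  have hφd : ∀ x, HasDerivAt φ₂ (deriv φ₂ x) x := fun x =>
    (hφ₂.differentiable (by simp) x).hasDerivAt
  have hφc : Continuous (deriv φ₂) := hφ₂.continuous_deriv (by simp)
  have hφ₂c := hφ₂.continuous
  have hγc := hγ.continuous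
  have hγ'c : Continuous (deriv γ) := hγ.continuous_deriv (by simp)
  have hγd : ∀ s, HasDerivAt γ (deriv γ s) s := fun s =>
    (hγ.differentiable (by simp) s).hasDerivAt
  have hre : ∀ s, HasDerivAt (fun s => (γ s).re) (deriv γ s).re s := fun s =>
    Complex.reCLM.hasFDerivAt.comp_hasDerivAt s (hγd s)
  have him : ∀ s, HasDerivAt (fun s => (γ s).im) (deriv γ s).im s := fun s =>
    Complex.imCLM.hasFDerivAt.comp_hasDerivAt s (hγd s)
  have hK : IsCompact (Icc a b ×ˢ Icc c d) := isCompact_Icc.prod isCompact_Icc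
  -- The integrand is exact: with `G` a primitive of `φ₁`, `A` is the derivative in the first
  -- parameter of `(γ' u).im * G * φ₂`, and `B` is the derivative in the second one of `(γ' s).im *
  -- G * φ₂`. The terms with the derivative of `φ₂` cancel in `A + B`, and each part integrates to
  -- zero along its closed arc.
  let A : ℝ × ℝ → ℝ := fun p => (deriv γ p.2).im *
    (φ₁ ((γ p.1).re - (γ p.2).re) * (deriv γ p.1).re * φ₂ ((γ p.1).im - (γ p.2).im) +
      G ((γ p.1).re - (γ p.2).re) * (deriv φ₂ ((γ p.1).im - (γ p.2).im) * (deriv γ p.1).im))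
  let B : ℝ × ℝ → ℝ := fun p => (deriv γ p.1).im *
    (φ₁ ((γ p.1).re - (γ p.2).re) * -(deriv γ p.2).re * φ₂ ((γ p.1).im - (γ p.2).im) +
      G ((γ p.1).re - (γ p.2).re) * (deriv φ₂ ((γ p.1).im - (γ p.2).im) * -(deriv γ p.2).im))
  have hAc : Continuous A := by fun_prop
  have hBc : Continuous B := by fun_prop
  have hAi : IntegrableOn A (Icc a b ×ˢ Icc c d) (volume.prod volume) := by
    rw [← Measure.volume_eq_prod]; exact hAc.continuousOn.integrableOn_compact hK
  have hBi : IntegrableOn B (Icc a b ×ˢ Icc c d) (volume.prod volume) := by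
    rw [← Measure.volume_eq_prod]; exact hBc.continuousOn.integrableOn_compact hK
  have hAB : ∀ p : ℝ × ℝ, φ₁ (γ p.1 - γ p.2).re * φ₂ (γ p.1 - γ p.2).im *
      cross (deriv γ p.1) (deriv γ p.2) = A p + B p := by
    intro p
    simp only [A, B, cross, Complex.sub_re, Complex.sub_im]
    ring
  simp_rw [hAB]
  rw [Measure.volume_eq_prod, integral_add hAi hBi]
  have hA0 : ∫ p in Icc a b ×ˢ Icc c d, A p ∂(volume.prod volume) = 0 := by
    rw [IntegrableOn, ← Measure.prod_restrict] at hAi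
    rw [← Measure.prod_restrict, integral_prod_symm A hAi]
    refine integral_eq_zero_of_ae (Eventually.of_forall fun u => ?_)
    show ∫ s in Icc a b, A (s, u) = 0
    rw [integral_Icc_eq_integral_Ioc, ← intervalIntegral.integral_of_le hab]
    have hd : ∀ s, HasDerivAt (fun s => (deriv γ u).im *
        (G ((γ s).re - (γ u).re) * φ₂ ((γ s).im - (γ u).im))) (A (s, u)) s := fun s =>
      (((hGd _).comp s ((hre s).sub_const _)).mul
        ((hφd _).comp s ((him s).sub_const _))).const_mul _
    rw [intervalIntegral.integral_eq_sub_of_hasDerivAt (fun s _ => hd s)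
      ((hAc.comp (Continuous.prodMk_left u)).intervalIntegrable _ _), h1, sub_self]
  have hB0 : ∫ p in Icc a b ×ˢ Icc c d, B p ∂(volume.prod volume) = 0 := by
    rw [IntegrableOn, ← Measure.prod_restrict] at hBi
    rw [← Measure.prod_restrict, integral_prod B hBi]
    refine integral_eq_zero_of_ae (Eventually.of_forall fun s => ?_)
    show ∫ u in Icc c d, B (s, u) = 0
    rw [integral_Icc_eq_integral_Ioc, ← intervalIntegral.integral_of_le hcd]
    have hd : ∀ u, HasDerivAt (fun u => (deriv γ s).im *
        (G ((γ s).re - (γ u).re) * φ₂ ((γ s).im - (γ u).im))) (B (s, u)) u := fun u =>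
      (((hGd _).comp u ((hre u).const_sub _)).mul
        ((hφd _).comp u ((him u).const_sub _))).const_mul _
    rw [intervalIntegral.integral_eq_sub_of_hasDerivAt (fun u _ => hd u)
      ((hBc.comp (Continuous.prodMk_right s)).intervalIntegrable _ _), h2, sub_self]
  rw [hA0, hB0, add_zero]

theorem eventually_lt_of_deriv_pos {g : ℝ → ℝ} {g' x : ℝ} (hg : HasDerivAt g g' x) (h : 0 < g') :
    ∀ᶠ y in 𝓝 x, (x < y → g x < g y) ∧ (y < x → g y < g x) := by
  have := hg.tendsto_slope.eventually_const_lt h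
  rw [eventually_nhdsWithin_iff] at this
  filter_upwards [this] with y hy
  rcases eq_or_ne y x with rfl | hne
  · simp
  have hs := hy hne
  rw [slope_def_field] at hs
  constructor
  · intro hxy
    linarith [(div_pos_iff_of_pos_right (sub_pos.mpr hxy)).mp hs]
  · intro hxy
    have : y - x < 0 := sub_neg.mpr hxy
    rcases div_pos_iff.mp hs with h | h
    · linarith [h.2]
    · linarith [h.1]

theorem eventually_le_of_deriv_pos {g : ℝ → ℝ} {g' x : ℝ} (hg : HasDerivAt g g' x) (h : 0 < g') :
    ∀ᶠ y in 𝓝 x, (x ≤ y → g x ≤ g y) ∧ (y ≤ x → g y ≤ g x) := by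
  filter_upwards [eventually_lt_of_deriv_pos hg h] with y hy
  constructor
  · rintro h
    rcases h.eq_or_lt with rfl | h
    exacts [le_rfl, (hy.1 h).le]
  · rintro h
    rcases h.eq_or_lt with rfl | h
    exacts [le_rfl, (hy.2 h).le]

/-- The difference of two points of a plane curve, in coordinates. -/
def chordMap (γ : ℝ → ℂ) (p : ℝ × ℝ) : ℝ × ℝ := ((γ p.1 - γ p.2).re, (γ p.1 - γ p.2).im)

/-- The derivative of `chordMap`. -/
noncomputable def chordMapDeriv (γ : ℝ → ℂ) (p : ℝ × ℝ) : ℝ × ℝ →L[ℝ] ℝ × ℝ :=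
  LinearMap.toContinuousLinearMap (Matrix.toLin (.finTwoProd ℝ) (.finTwoProd ℝ)
    !![(deriv γ p.1).re, -(deriv γ p.2).re; (deriv γ p.1).im, -(deriv γ p.2).im])

theorem det_chordMapDeriv (γ : ℝ → ℂ) (p : ℝ × ℝ) :
    (chordMapDeriv γ p).det = -cross (deriv γ p.1) (deriv γ p.2) := by
  unfold chordMapDeriv cross
  simp only [LinearMap.det_toContinuousLinearMap, LinearMap.det_toLin, Matrix.det_fin_two_of]
  ring

theorem contDiff_chordMap {γ : ℝ → ℂ} (hγ : ContDiff ℝ ∞ γ) : ContDiff ℝ ∞ (chordMap γ) := by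
  have h : ContDiff ℝ ∞ fun p : ℝ × ℝ => γ p.1 - γ p.2 :=
    (hγ.comp contDiff_fst).sub (hγ.comp contDiff_snd)
  exact (Complex.reCLM.contDiff.comp h).prodMk (Complex.imCLM.contDiff.comp h)

theorem hasFDerivAt_chordMap {γ : ℝ → ℂ} (hγ : ContDiff ℝ ∞ γ) (p : ℝ × ℝ) :
    HasFDerivAt (chordMap γ) (chordMapDeriv γ p) p := by
  have hd := fun s => (hγ.differentiable (by simp) s).hasDerivAt
  have h1 : HasFDerivAt (fun p : ℝ × ℝ => γ p.1) _ p :=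
    (hd p.1).hasFDerivAt.comp p (hasFDerivAt_fst (𝕜 := ℝ) (E := ℝ) (F := ℝ))
  have h2 : HasFDerivAt (fun p : ℝ × ℝ => γ p.2) _ p :=
    (hd p.2).hasFDerivAt.comp p (hasFDerivAt_snd (𝕜 := ℝ) (E := ℝ) (F := ℝ))
  have h := h1.sub h2
  have h3 := (Complex.reCLM.hasFDerivAt.comp p h).prodMk (Complex.imCLM.hasFDerivAt.comp p h)
  unfold chordMapDeriv
  rw [Matrix.toLin_finTwoProd_toContinuousLinearMap]
  refine h3.congr_fderiv ?_
  ext <;> simp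

/-- Around a transverse double point there is a neighbourhood on which `chordMap` is injective
and covers a neighbourhood of the origin. -/
theorem exists_chordMap_nhd {γ : ℝ → ℂ} (hγ : ContDiff ℝ ∞ γ) {q : ℝ × ℝ} (hq : γ q.1 = γ q.2)
    (htr : TransverseAt γ q) {U : Set (ℝ × ℝ)} (hU : U ∈ 𝓝 q) :
    ∃ N ⊆ U, IsOpen N ∧ q ∈ N ∧ InjOn (chordMap γ) N ∧ chordMap γ '' N ∈ 𝓝 (0, 0) ∧
      ∀ p ∈ N, cross (deriv γ p.1) (deriv γ p.2) =
        doubleSign γ q * |cross (deriv γ p.1) (deriv γ p.2)| := by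
  have hdet : (chordMapDeriv γ q).det ≠ 0 := by
    rw [det_chordMapDeriv]; exact neg_ne_zero.mpr htr
  have hs : HasStrictFDerivAt (chordMap γ)
      ((chordMapDeriv γ q).toContinuousLinearEquivOfDetNeZero hdet : ℝ × ℝ →L[ℝ] ℝ × ℝ) q := by
    refine (contDiff_chordMap hγ).contDiffAt.hasStrictFDerivAt' (n := ∞) ?_ (by simp)
    exact hasFDerivAt_chordMap hγ q
  have hc : Continuous (deriv γ) := hγ.continuous_deriv (by simp)
  have hcc : Continuous fun p : ℝ × ℝ => cross (deriv γ p.1) (deriv γ p.2) :=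
    continuous_cross (hc.comp continuous_fst) (hc.comp continuous_snd)
  have hsign : ∀ᶠ p : ℝ × ℝ in 𝓝 q, Real.sign (cross (deriv γ p.1) (deriv γ p.2)) =
      doubleSign γ q := eventually_sign_eq
    (f := fun p : ℝ × ℝ => cross (deriv γ p.1) (deriv γ p.2))
    (a := cross (deriv γ q.1) (deriv γ q.2)) htr (hcc.tendsto q)
  have hmem : U ∩ {p | Real.sign (cross (deriv γ p.1) (deriv γ p.2)) = doubleSign γ q} ∩
      (hs.toOpenPartialHomeomorph (chordMap γ)).source ∈ 𝓝 q :=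
    inter_mem (inter_mem hU hsign) ((hs.toOpenPartialHomeomorph _).open_source.mem_nhds
      hs.mem_toOpenPartialHomeomorph_source)
  obtain ⟨N, hN, hNo, hqN⟩ := mem_nhds_iff.mp hmem
  refine ⟨N, fun p hp => (hN hp).1.1, hNo, hqN, ?_, ?_, ?_⟩
  · exact (hs.toOpenPartialHomeomorph (chordMap γ)).injOn.mono fun p hp => (hN hp).2
  · have := hs.map_nhds_eq_of_equiv
    have h0 : chordMap γ q = (0, 0) := by simp [chordMap, hq]
    rw [h0] at this
    rw [← this]
    exact image_mem_map (hNo.mem_nhds hqN)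
  · intro p hp
    have hsg : Real.sign (cross (deriv γ p.1) (deriv γ p.2)) = doubleSign γ q := (hN hp).1.2
    rw [← hsg]
    rcases lt_trichotomy (cross (deriv γ p.1) (deriv γ p.2)) 0 with h | h | h
    · rw [Real.sign_of_neg h, abs_of_neg h]; ring
    · rw [h]; simp
    · rw [Real.sign_of_pos h, abs_of_pos h]; ring

/-- A mollifier with a small support near a given point. -/
theorem exists_mollifier {V : Set (ℝ × ℝ)} (hV : IsOpen V) {w : ℝ × ℝ} (hw : w ∈ V) :
    ∃ φ₁ φ₂ : ℝ → ℝ, Continuous φ₁ ∧ ContDiff ℝ 1 φ₂ ∧ (∫ x, φ₁ x = 1) ∧ (∫ x, φ₂ x = 1) ∧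
      ∀ z : ℝ × ℝ, z ∉ V → φ₁ z.1 * φ₂ z.2 = 0 := by
  obtain ⟨r, hr, hball⟩ := Metric.isOpen_iff.mp hV w hw
  let f₁ : ContDiffBump w.1 := ⟨r / 2, r, by positivity, by linarith⟩
  let f₂ : ContDiffBump w.2 := ⟨r / 2, r, by positivity, by linarith⟩
  refine ⟨f₁.normed volume, f₂.normed volume, f₁.continuous_normed,
    f₂.contDiff_normed (n := 1), f₁.integral_normed, f₂.integral_normed, fun z hz => ?_⟩
  by_contra hne
  have h1 : z.1 ∈ Function.support (f₁.normed volume) := fun h => hne (by rw [h, zero_mul])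
  have h2 : z.2 ∈ Function.support (f₂.normed volume) := fun h => hne (by rw [h, mul_zero])
  rw [ContDiffBump.support_normed_eq, Metric.mem_ball] at h1 h2
  refine hz (hball ?_)
  rw [Metric.mem_ball, Prod.dist_eq]
  exact max_lt h1 h2

/-- Of the two arcs into which a double point at the base point divides a generic curve, the
intersection number at the other double points is zero. -/
theorem sum_doubleSign_eq_zero {γ : ℝ → ℂ} (hγ : IsGenericCurve γ) {b : ℝ}
    (hb : (0, b) ∈ doublePairs γ) {Z : Finset (ℝ × ℝ)}
    (hZ : ∀ q, q ∈ Z ↔ q ∈ doublePairs γ ∧ 0 < q.1 ∧ q.1 < b ∧ b < q.2) :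
    ∑ q ∈ Z, doubleSign γ q = 0 := by
  obtain ⟨-, hb0, hb2, hbγ⟩ := id hb
  dsimp only at hb0 hb2 hbγ
  have hper : γ (2 * Real.pi) = γ 0 := by simpa using hγ.periodic 0
  have hper' : deriv γ (2 * Real.pi) = deriv γ 0 := by
    simpa using hγ.toIsPlaneCurve.periodic_deriv 0
  set R : Set (ℝ × ℝ) := Icc 0 b ×ˢ Icc b (2 * Real.pi) with hR
  have hRK : IsCompact R := isCompact_Icc.prod isCompact_Icc
  -- disjoint neighbourhoods of the double points
  obtain ⟨U, hU, hUd⟩ := Z.finite_toSet.t2_separation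
  have hint : ∀ q ∈ Z, Ioo 0 b ×ˢ Ioo b (2 * Real.pi) ∈ 𝓝 q := fun q hq => by
    have := (hZ q).mp hq
    exact (isOpen_Ioo.prod isOpen_Ioo).mem_nhds ⟨⟨this.2.1, this.2.2.1⟩, this.2.2.2, this.1.2.2.1⟩
  choose! N hNU hNo hqN hNinj hNim hNsign using fun q (hq : q ∈ Z) =>
    exists_chordMap_nhd hγ.smooth ((hZ q).mp hq).1.2.2.2 (hγ.transverse q ((hZ q).mp hq).1)
      (inter_mem ((hU q).2.mem_nhds (hU q).1) (hint q hq))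
  -- a linear form separating the two branches
  set u := deriv γ 0 with hu
  set v := deriv γ b with hv
  have hk : cross u v ≠ 0 := hγ.transverse _ hb
  have hk2 : 0 < cross u v * cross u v := mul_self_pos.mpr hk
  set ℓ : ℝ × ℝ → ℝ := fun z => cross u v * (z.1 * (u + v).im - z.2 * (u + v).re) with hℓ
  have hℓc : Continuous ℓ := by fun_prop
  set g : ℝ → ℝ := fun s => cross u v * cross (γ s) (u + v) with hg
  have hgd : ∀ s, HasDerivAt g (cross u v * cross (deriv γ s) (u + v)) s := by
    intro s
    have hd := (hγ.toIsPlaneCurve.differentiable s).hasDerivAt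
    have hre : HasDerivAt (fun s => (γ s).re) (deriv γ s).re s :=
      Complex.reCLM.hasFDerivAt.comp_hasDerivAt s hd
    have him : HasDerivAt (fun s => (γ s).im) (deriv γ s).im s :=
      Complex.imCLM.hasFDerivAt.comp_hasDerivAt s hd
    exact ((hre.mul_const _).sub (him.mul_const _)).const_mul _
  have hgℓ : ∀ p, ℓ (chordMap γ p) = g p.1 - g p.2 := by
    intro p
    simp only [hℓ, hg, chordMap, cross, Complex.sub_re, Complex.sub_im]
    ring
  have hgu : cross u v * cross u (u + v) = cross u v * cross u v := by
    rw [cross_add_right, cross_self, zero_add]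
  have hgv : cross u v * cross v (u + v) = -(cross u v * cross u v) := by
    rw [cross_add_right, cross_self, add_zero, cross_swap]; ring
  -- The first loop leaves the corner with velocity `u` and returns with `v`, the second leaves with
  -- `v` and returns with `u`. Since `g` grows along `u` and decreases along `v`, near the corner `g
  -- ≥ g b` on the first loop and `g ≤ g b` on the second: they lie on opposite sides of a line, and
  -- `ℓ` of their difference is nonnegative.
  have g0 := eventually_le_of_deriv_pos (hgd 0) (by rw [← hu, hgu]; exact hk2)
  have g2 := eventually_le_of_deriv_pos (hgd (2 * Real.pi)) (by rw [hper', hgu]; exact hk2)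
  have gb := eventually_le_of_deriv_pos (hgd b).neg (by rw [← hv, hgv, neg_neg]; exact hk2)
  have e0 : g 0 = g b := by simp only [hg, hbγ]
  have e2 : g (2 * Real.pi) = g b := by simp only [hg, hper, hbγ]
  -- near the origin, solutions with negative `ℓ` are near the double points
  have hloc : ∀ᶠ w in 𝓝 ((0 : ℝ), (0 : ℝ)), ∀ p ∈ R, chordMap γ p = w → ℓ w < 0 →
      p ∈ ⋃ q ∈ Z, N q := by
    suffices ∀ᶠ w in 𝓝 ((0 : ℝ), (0 : ℝ)), ∀ p ∈ R, p ∈ R → chordMap γ p = w → ℓ w < 0 →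
        p ∈ ⋃ q ∈ Z, N q from this.mono fun w h p hp => h p hp hp
    refine hRK.eventually_forall_of_forall_eventually
      (P := fun w p => p ∈ R → chordMap γ p = w → ℓ w < 0 → p ∈ ⋃ q ∈ Z, N q) ?_
    rintro ⟨s, t⟩ ⟨⟨hs0, hsb⟩, htb, ht2⟩
    by_cases heq : γ s = γ t
    swap
    · have hne : chordMap γ (s, t) - (0, 0) ≠ 0 := by
        intro h
        simp only [chordMap, sub_zero, Prod.mk_zero_zero, Prod.mk_eq_zero] at h
        exact heq (sub_eq_zero.mp (Complex.ext h.1 h.2))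
      have hc : Continuous fun z : (ℝ × ℝ) × ℝ × ℝ => chordMap γ z.2 - z.1 :=
        ((contDiff_chordMap hγ.smooth).continuous.comp continuous_snd).sub continuous_fst
      filter_upwards [hc.continuousAt.eventually_ne (x := ((0, 0), (s, t))) hne] with z hz _ he
      exact absurd (sub_eq_zero.mpr he) hz
    by_cases hcor : (s = 0 ∨ s = b) ∧ (t = b ∨ t = 2 * Real.pi)
    · have hs : ∀ᶠ s' in 𝓝 s, s' ∈ Icc 0 b → g b ≤ g s' := by
        rcases hcor.1 with rfl | rfl
        · filter_upwards [g0] with s' h h'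
          exact e0 ▸ h.1 h'.1
        · filter_upwards [gb] with s' h h'
          simpa using h.2 h'.2
      have ht : ∀ᶠ t' in 𝓝 t, t' ∈ Icc b (2 * Real.pi) → g t' ≤ g b := by
        rcases hcor.2 with rfl | rfl
        · filter_upwards [gb] with t' h h'
          simpa using h.1 h'.1
        · filter_upwards [g2] with t' h h'
          exact e2 ▸ h.2 h'.2
      have m1 : Continuous fun z : (ℝ × ℝ) × ℝ × ℝ => z.2.1 := by fun_prop
      have m2 : Continuous fun z : (ℝ × ℝ) × ℝ × ℝ => z.2.2 := by fun_prop
      have hs' := (m1.tendsto ((0, 0), (s, t))).eventually hs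
      have ht' := (m2.tendsto ((0, 0), (s, t))).eventually ht
      filter_upwards [hs', ht'] with z h1 h2 hzR he hneg
      rw [← he, hgℓ] at hneg
      linarith [h1 hzR.1, h2 hzR.2]
    -- A coincidence that is not one of the four corner pairs `{0, b} × {b, 2π}` cannot share a
    -- passage with `(0, b)`, for lack of triple points; it is therefore one of the double points in
    -- `Z`.
    · have hmem : (s, t) ∈ Z := by
        have hdisj := hγ.no_triple
        have ht2' : t < 2 * Real.pi := by
          refine lt_of_le_of_ne ht2 fun ht => hcor ⟨?_, Or.inr ht⟩
          subst ht
          rcases hs0.eq_or_lt with hs0 | hs0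
          · exact Or.inl hs0.symm
          · right
            have hm : (0, s) ∈ doublePairs γ :=
              ⟨le_rfl, hs0, hsb.trans_lt hb2, (heq.trans hper).symm⟩
            exact congrArg Prod.snd (doublePairs_fst_injOn hdisj hm hb rfl)
        have hst : s < t := by
          refine lt_of_le_of_ne (hsb.trans htb) fun hst => hcor ?_
          have h1 : s = b := le_antisymm hsb (hst ▸ htb)
          exact ⟨Or.inr h1, Or.inl (hst ▸ h1)⟩
        have hm : (s, t) ∈ doublePairs γ := ⟨hs0, hst, ht2', heq⟩
        have hs0' : s ≠ 0 := fun h => hcor ⟨Or.inl h, Or.inl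
          (congrArg Prod.snd (doublePairs_fst_injOn hdisj hm hb h))⟩
        have hsb' : s ≠ b := fun h => doublePairs_fst_ne_snd hdisj hm hb h
        have htb' : b ≠ t := fun h => hs0'
          (congrArg Prod.fst (doublePairs_snd_injOn hdisj hm hb h.symm))
        exact (hZ _).mpr ⟨hm, lt_of_le_of_ne hs0 hs0'.symm, lt_of_le_of_ne hsb hsb',
          lt_of_le_of_ne htb htb'⟩
      have m : Continuous fun z : (ℝ × ℝ) × ℝ × ℝ => z.2 := continuous_snd
      filter_upwards [(m.tendsto ((0, 0), (s, t))).eventually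
        ((hNo _ hmem).mem_nhds (hqN _ hmem))] with z hz _ _ _
      exact mem_biUnion hmem hz
  have hcov : ∀ᶠ w in 𝓝 ((0 : ℝ), (0 : ℝ)), ∀ q ∈ Z, w ∈ chordMap γ '' N q :=
    (eventually_all_finite Z.finite_toSet).mpr fun q hq => hNim q hq
  obtain ⟨V, hV, hVo, hV0⟩ := mem_nhds_iff.mp (hloc.and hcov)
  have hVo' : IsOpen (V ∩ {w | ℓ w < 0}) := hVo.inter (isOpen_lt hℓc continuous_const)
  -- Translating one loop by the small vector `κ v`, for which `ℓ = -κ (cross u v) ^ 2 < 0`,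
  -- separates the loops at the corner and leaves only the transverse intersections in `Z`.
  obtain ⟨κ, hκV, hκ⟩ : ∃ κ : ℝ, (κ * v.re, κ * v.im) ∈ V ∧ 0 < κ := by
    have hc : Continuous fun κ : ℝ => (κ * v.re, κ * v.im) := by fun_prop
    have h1 : ∀ᶠ κ in 𝓝[>] (0 : ℝ), (κ * v.re, κ * v.im) ∈ V := by
      refine nhdsWithin_le_nhds ((hc.tendsto 0).eventually (hVo.mem_nhds ?_))
      simpa using hV0
    exact (h1.and self_mem_nhdsWithin).exists
  obtain ⟨φ₁, φ₂, hφ₁, hφ₂, hi₁, hi₂, hφ⟩ := exists_mollifier hVo' (w := (κ * v.re, κ * v.im))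
    ⟨hκV, by
      have : ℓ (κ * v.re, κ * v.im) = κ * (cross u v * cross v (u + v)) := by
        simp only [hℓ, cross]; ring
      show ℓ (κ * v.re, κ * v.im) < 0
      rw [this, hgv]
      nlinarith⟩
  set h : ℝ × ℝ → ℝ := fun p => φ₁ (γ p.1 - γ p.2).re * φ₂ (γ p.1 - γ p.2).im *
      cross (deriv γ p.1) (deriv γ p.2) with hh
  have hzero : ∫ p in R, h p = 0 := integral_mollified_cross_eq_zero hγ.smooth hb0.le hb2.le hbγ
    (hbγ.symm.trans hper.symm) hφ₁ hφ₂
  have hhc : Continuous h := by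
    have h1 := hγ.smooth.continuous
    have h2 := hφ₂.continuous
    have h3 := hγ.toIsPlaneCurve.continuous_deriv
    have h4 : Continuous fun p : ℝ × ℝ => cross (deriv γ p.1) (deriv γ p.2) :=
      continuous_cross (by fun_prop) (by fun_prop)
    fun_prop
  have hsub : (⋃ q ∈ Z, N q) ⊆ R := by
    intro p hp
    obtain ⟨q, hq, hp⟩ := mem_iUnion₂.mp hp
    have := (hNU q hq hp).2
    exact ⟨Ioo_subset_Icc_self this.1, Ioo_subset_Icc_self this.2⟩
  -- The mollifier lives where `w ∈ V` and `ℓ w < 0`, and there every solution lies in one of the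
  -- chosen neighbourhoods.
  have hcut : ∫ p in R, h p = ∫ p in ⋃ q ∈ Z, N q, h p := by
    refine setIntegral_eq_of_subset_of_forall_sdiff_eq_zero hRK.measurableSet hsub fun p hp => ?_
    have : chordMap γ p ∉ V ∩ {w | ℓ w < 0} := fun hmem =>
      hp.2 ((hV hmem.1).1 p hp.1 rfl hmem.2)
    simp only [hh]
    rw [show φ₁ (γ p.1 - γ p.2).re * φ₂ (γ p.1 - γ p.2).im = 0 from hφ _ this, zero_mul]
  have hNR : ∀ q ∈ Z, N q ⊆ R := fun q hq => (subset_biUnion_of_mem (u := N) hq).trans hsub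
  rw [hcut, integral_biUnion_finset Z (fun q hq => (hNo q hq).measurableSet)
    (fun q hq q' hq' hne => (hUd hq hq' hne).mono (fun p hp => (hNU q hq hp).1)
      (fun p hp => (hNU q' hq' hp).1))
    (fun q hq => (hhc.continuousOn.integrableOn_compact hRK).mono_set (hNR q hq))] at hzero
  rw [← hzero]
  refine Finset.sum_congr rfl fun q hq => ?_
  -- By change of variables each neighbourhood contributes the total mass `1` of the mollifier times
  -- the sign of its double point, so that the vanishing integral is the sum of the signs.
  have hchange := integral_image_eq_integral_abs_det_fderiv_smul volume (hNo q hq).measurableSet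
    (fun p _ => (hasFDerivAt_chordMap hγ.smooth p).hasFDerivWithinAt) (hNinj q hq)
    (fun z => φ₁ z.1 * φ₂ z.2)
  have htot : ∫ z in chordMap γ '' N q, φ₁ z.1 * φ₂ z.2 = 1 := by
    rw [setIntegral_eq_integral_of_forall_compl_eq_zero, Measure.volume_eq_prod,
      integral_prod_mul, hi₁, hi₂, one_mul]
    intro z hz
    exact hφ z fun hmem => hz ((hV hmem.1).2 q hq)
  rw [htot] at hchange
  have : ∫ p in N q, h p = ∫ p in N q, doubleSign γ q *
      (|(chordMapDeriv γ p).det| • (φ₁ (chordMap γ p).1 * φ₂ (chordMap γ p).2)) := by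
    refine setIntegral_congr_fun (hNo q hq).measurableSet fun p hp => ?_
    simp only [hh, chordMap, det_chordMapDeriv, abs_neg, smul_eq_mul]
    have hs := hNsign q hq p hp
    generalize |cross (deriv γ p.1) (deriv γ p.2)| = x at hs ⊢
    rw [hs]
    ring
  rw [this, integral_const_mul, ← hchange, mul_one]

end PlaneCurves

namespace PlaneCurves

open Set Filter Topology

/-! ### Changes of the base point -/

theorem map_toIcoMod {γ : ℝ → ℂ} (h : Function.Periodic γ (2 * Real.pi)) (x : ℝ) :
    γ (toIcoMod Real.two_pi_pos 0 x) = γ x := by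
  rw [toIcoMod]
  exact h.sub_zsmul_eq _

theorem toIcoMod_two_pi_mem (x : ℝ) : toIcoMod Real.two_pi_pos 0 x ∈ Ico 0 (2 * Real.pi) := by
  simpa using toIcoMod_mem_Ico Real.two_pi_pos 0 x

/-- A parameter which is congruent to `x` and lies in the fundamental interval. -/
theorem toIcoMod_eq_of_mem {x : ℝ} (hx : x ∈ Ico 0 (2 * Real.pi)) :
    toIcoMod Real.two_pi_pos 0 x = x :=
  (toIcoMod_eq_self _).mpr (by simpa using hx)

theorem exists_toIcoMod_eq (x : ℝ) :
    ∃ k : ℤ, toIcoMod Real.two_pi_pos 0 x = x - k * (2 * Real.pi) :=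
  ⟨toIcoDiv Real.two_pi_pos 0 x, by rw [toIcoMod, zsmul_eq_mul]⟩

theorem eq_of_mem_Ico_of_sub_eq {x y : ℝ} (hx : x ∈ Ico 0 (2 * Real.pi))
    (hy : y ∈ Ico 0 (2 * Real.pi)) {k : ℤ} (h : x = y + k * (2 * Real.pi)) : x = y := by
  rw [← toIcoMod_eq_of_mem hx, ← toIcoMod_eq_of_mem hy, h, ← zsmul_eq_mul, toIcoMod_add_zsmul]

theorem not_three_of_no_triple {γ : ℝ → ℂ} (h : ∀ s t u, ¬ IsTriplePassage γ s t u) {a b c : ℝ}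
    (ha : a ∈ Ico 0 (2 * Real.pi)) (hb : b ∈ Ico 0 (2 * Real.pi)) (hc : c ∈ Ico 0 (2 * Real.pi))
    (hab : a ≠ b) (hbc : b ≠ c) (hac : a ≠ c) (h1 : γ a = γ b) (h2 : γ b = γ c) : False := by
  have key : ∀ {x y z : ℝ}, 0 ≤ x → x < y → y < z → z < 2 * Real.pi → γ x = γ y → γ y = γ z →
      False := fun hx hxy hyz hz e1 e2 =>
    h _ _ _ ⟨⟨hx, hxy, hyz.trans hz, e1⟩, ⟨hx.trans hxy.le, hyz, hz, e2⟩⟩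
  rcases lt_or_gt_of_ne hab with i | i <;> rcases lt_or_gt_of_ne hbc with j | j <;>
    rcases lt_or_gt_of_ne hac with k | k
  · exact key ha.1 i j hc.2 h1 h2
  · linarith
  · exact key ha.1 k j hb.2 (h1.trans h2) h2.symm
  · exact key hc.1 k i hb.2 (h1.trans h2).symm h1
  · exact key hb.1 i k hc.2 h1.symm (h1.trans h2)
  · exact key hb.1 j k ha.2 h2 (h1.trans h2).symm
  · linarith
  · exact key hc.1 j i ha.2 h2.symm h1.symm

/-- The double points of a reparametrized curve. -/
theorem mem_doublePairs_of_comp {γ : ℝ → ℂ} (hγ : Function.Periodic γ (2 * Real.pi)) {g : ℝ → ℝ}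
    (hg : ∀ x ∈ Ico 0 (2 * Real.pi), ∀ y ∈ Ico 0 (2 * Real.pi),
      toIcoMod Real.two_pi_pos 0 (g x) = toIcoMod Real.two_pi_pos 0 (g y) → x = y)
    {p : ℝ × ℝ} (hp : p ∈ doublePairs (fun s => γ (g s))) :
    (toIcoMod Real.two_pi_pos 0 (g p.1), toIcoMod Real.two_pi_pos 0 (g p.2)) ∈ doublePairs γ ∨
    (toIcoMod Real.two_pi_pos 0 (g p.2), toIcoMod Real.two_pi_pos 0 (g p.1)) ∈ doublePairs γ := by
  obtain ⟨h1, h2, h3, h4⟩ := hp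
  have m1 := toIcoMod_two_pi_mem (g p.1)
  have m2 := toIcoMod_two_pi_mem (g p.2)
  have e1 := map_toIcoMod hγ (g p.1)
  have e2 := map_toIcoMod hγ (g p.2)
  have hne : toIcoMod Real.two_pi_pos 0 (g p.1) ≠ toIcoMod Real.two_pi_pos 0 (g p.2) :=
    fun h => h2.ne (hg _ ⟨h1, h2.trans h3⟩ _ ⟨h1.trans h2.le, h3⟩ h)
  rcases lt_or_gt_of_ne hne with h | h
  · exact Or.inl ⟨m1.1, h, m2.2, e1.trans (h4.trans e2.symm)⟩
  · exact Or.inr ⟨m2.1, h, m1.2, e2.trans (h4.symm.trans e1.symm)⟩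

/-- One argument serves for shifts (`σ = 1`) and reversal (`σ = -1`): injectivity of `g` modulo `2π`
carries double points of the new curve to double points of the old one, possibly with the two
passages exchanged. -/
theorem IsGenericCurve.comp {γ : ℝ → ℂ} (hγ : IsGenericCurve γ) {g : ℝ → ℝ} {σ : ℝ} (hσ : σ ≠ 0)
    (hg : ∀ x ∈ Ico 0 (2 * Real.pi), ∀ y ∈ Ico 0 (2 * Real.pi),
      toIcoMod Real.two_pi_pos 0 (g x) = toIcoMod Real.two_pi_pos 0 (g y) → x = y)
    (hc : IsPlaneCurve (fun s => γ (g s)))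
    (hd : ∀ s, deriv (fun s => γ (g s)) s = σ • deriv γ (g s)) :
    IsGenericCurve (fun s => γ (g s)) where
  toIsPlaneCurve := hc
  finite := by
    refine Finite.of_finite_image (f := fun p : ℝ × ℝ =>
      (toIcoMod Real.two_pi_pos 0 (g p.1), toIcoMod Real.two_pi_pos 0 (g p.2))) ?_ ?_
    · refine (hγ.finite.union (hγ.finite.image Prod.swap)).subset ?_
      rintro _ ⟨p, hp, rfl⟩
      rcases mem_doublePairs_of_comp hγ.periodic hg hp with h | h
      · exact Or.inl h
      · exact Or.inr ⟨_, h, rfl⟩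
    · intro p hp q hq he
      simp only [Prod.mk.injEq] at he
      exact Prod.ext (hg _ ⟨hp.1, hp.2.1.trans hp.2.2.1⟩ _ ⟨hq.1, hq.2.1.trans hq.2.2.1⟩ he.1)
        (hg _ ⟨hp.1.trans hp.2.1.le, hp.2.2.1⟩ _ ⟨hq.1.trans hq.2.1.le, hq.2.2.1⟩ he.2)
  transverse := by
    intro p hp
    unfold TransverseAt
    rw [hd, hd, cross_smul_left, cross_smul_right]
    refine mul_ne_zero hσ (mul_ne_zero hσ ?_)
    have hp' := hγ.toIsPlaneCurve.periodic_deriv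
    rw [← map_toIcoMod hp' (g p.1), ← map_toIcoMod hp' (g p.2)]
    rcases mem_doublePairs_of_comp hγ.periodic hg hp with h | h
    · exact hγ.transverse _ h
    · rw [cross_swap]
      exact neg_ne_zero.mpr (hγ.transverse _ h)
  no_triple := by
    rintro s t u ⟨⟨h1, h2, h3, h4⟩, ⟨k1, k2, k3, k4⟩⟩
    dsimp only at h1 h2 h3 h4 k1 k2 k3 k4
    have ms : s ∈ Ico 0 (2 * Real.pi) := ⟨h1, h2.trans h3⟩
    have mt : t ∈ Ico 0 (2 * Real.pi) := ⟨k1, h3⟩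
    have mu : u ∈ Ico 0 (2 * Real.pi) := ⟨k1.trans k2.le, k3⟩
    exact not_three_of_no_triple hγ.no_triple (toIcoMod_two_pi_mem (g s))
      (toIcoMod_two_pi_mem (g t)) (toIcoMod_two_pi_mem (g u)) (fun h => h2.ne (hg _ ms _ mt h))
      (fun h => k2.ne (hg _ mt _ mu h)) (fun h => (h2.trans k2).ne (hg _ ms _ mu h))
      (by rw [map_toIcoMod hγ.periodic, map_toIcoMod hγ.periodic]; exact h4)
      (by rw [map_toIcoMod hγ.periodic, map_toIcoMod hγ.periodic]; exact k4)

theorem toIcoMod_add_const_injOn (c : ℝ) : ∀ x ∈ Ico 0 (2 * Real.pi), ∀ y ∈ Ico 0 (2 * Real.pi),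
    toIcoMod Real.two_pi_pos 0 (x + c) = toIcoMod Real.two_pi_pos 0 (y + c) → x = y := by
  intro x hx y hy h
  obtain ⟨k, hk⟩ := exists_toIcoMod_eq (x + c)
  obtain ⟨l, hl⟩ := exists_toIcoMod_eq (y + c)
  refine eq_of_mem_Ico_of_sub_eq hx hy (k := k - l) ?_
  push_cast
  linarith

theorem toIcoMod_neg_injOn : ∀ x ∈ Ico 0 (2 * Real.pi), ∀ y ∈ Ico 0 (2 * Real.pi),
    toIcoMod Real.two_pi_pos 0 (-x) = toIcoMod Real.two_pi_pos 0 (-y) → x = y := by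
  intro x hx y hy h
  obtain ⟨k, hk⟩ := exists_toIcoMod_eq (-x)
  obtain ⟨l, hl⟩ := exists_toIcoMod_eq (-y)
  refine eq_of_mem_Ico_of_sub_eq hx hy (k := l - k) ?_
  push_cast
  linarith

theorem IsGenericCurve.comp_add {γ : ℝ → ℂ} (hγ : IsGenericCurve γ) (c : ℝ) :
    IsGenericCurve (fun s => γ (s + c)) :=
  hγ.comp one_ne_zero (toIcoMod_add_const_injOn c) (hγ.toIsPlaneCurve.comp_add c)
    fun s => by rw [one_smul, deriv_comp_add_const]

theorem IsGenericCurve.comp_neg {γ : ℝ → ℂ} (hγ : IsGenericCurve γ) :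
    IsGenericCurve (fun s => γ (-s)) :=
  hγ.comp (neg_ne_zero.mpr one_ne_zero) toIcoMod_neg_injOn hγ.toIsPlaneCurve.comp_neg
    fun s => by rw [neg_one_smul, deriv_comp_neg]

theorem doubleSign_comp_add (γ : ℝ → ℂ) (c : ℝ) (p : ℝ × ℝ) :
    doubleSign (fun s => γ (s + c)) p = doubleSign γ (p.1 + c, p.2 + c) := by
  unfold doubleSign
  rw [deriv_comp_add_const, deriv_comp_add_const]

/-- A shift of the base point along an arc without double points. -/
theorem bijOn_translate {γ : ℝ → ℂ} (hγ : Function.Periodic γ (2 * Real.pi)) {c : ℝ}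
    (h1 : ∀ q ∈ doublePairs γ, c ≤ q.1) (h2 : ∀ q ∈ doublePairs γ, q.2 < 2 * Real.pi + c) :
    BijOn (fun q : ℝ × ℝ => (q.1 - c, q.2 - c)) (doublePairs γ)
      (doublePairs (fun s => γ (s + c))) := by
  refine ⟨?_, ?_, ?_⟩
  · intro q hq
    have := h1 q hq
    have := h2 q hq
    refine ⟨?_, ?_, ?_, ?_⟩ <;> dsimp only
    · linarith
    · linarith [hq.2.1]
    · linarith
    · simpa using hq.2.2.2
  · intro q _ q' _ he
    simp only [Prod.mk.injEq, sub_left_inj] at he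
    exact Prod.ext he.1 he.2
  · intro p hp
    have hk : ∀ x ∈ Ico 0 (2 * Real.pi), toIcoMod Real.two_pi_pos 0 (x + c) - c ∈
        Ico 0 (2 * Real.pi) → toIcoMod Real.two_pi_pos 0 (x + c) = x + c := by
      intro x hx hy
      obtain ⟨k, hk⟩ := exists_toIcoMod_eq (x + c)
      have := eq_of_mem_Ico_of_sub_eq hy hx (k := -k) (by rw [hk]; push_cast; ring)
      linarith
    have p1 : p.1 ∈ Ico 0 (2 * Real.pi) := ⟨hp.1, hp.2.1.trans hp.2.2.1⟩
    have p2 : p.2 ∈ Ico 0 (2 * Real.pi) := ⟨hp.1.trans hp.2.1.le, hp.2.2.1⟩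
    have hend : ∀ q ∈ doublePairs γ, q.1 - c ∈ Ico 0 (2 * Real.pi) ∧
        q.2 - c ∈ Ico 0 (2 * Real.pi) := by
      intro q hq
      have := h1 q hq
      have := h2 q hq
      have := hq.2.1
      exact ⟨⟨by linarith, by linarith⟩, ⟨by linarith, by linarith⟩⟩
    rcases mem_doublePairs_of_comp hγ (toIcoMod_add_const_injOn c) hp with h | h
    · have e1 := hk _ p1 (hend _ h).1
      have e2 := hk _ p2 (hend _ h).2
      rw [e1, e2] at h
      exact ⟨_, h, by simp⟩
    · have e1 := hk _ p2 (hend _ h).1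
      have e2 := hk _ p1 (hend _ h).2
      rw [e1, e2] at h
      have : p.2 + c < p.1 + c := h.2.1
      linarith [hp.2.1]

theorem SameOrder.translate (c : ℝ) (p q : ℝ × ℝ) :
    SameOrder p q (p.1 - c, p.2 - c) (q.1 - c, q.2 - c) := by
  simp [SameOrder]

theorem arnold_translate {γ : ℝ → ℂ} (hγ : IsGenericCurve γ) {c : ℝ}
    (h1 : ∀ q ∈ doublePairs γ, c ≤ q.1) (h2 : ∀ q ∈ doublePairs γ, q.2 < 2 * Real.pi + c) :
    arnold (fun s => γ (s + c)) = arnold γ := by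
  have hC : BijOn id (hγ.finite.toFinset : Set (ℝ × ℝ)) (doublePairs γ) := by
    rw [hγ.finite.coe_toFinset]; exact bijOn_id _
  have hC' := bijOn_translate hγ.periodic h1 h2
  rw [← hγ.finite.coe_toFinset] at hC'
  refine (arnold_eq_of_sameOrder hC hC' (fun q _ => ?_) (fun p _ q _ => SameOrder.translate c p q)
    ?_).symm
  · rw [doubleSign_comp_add]; simp
  · rw [whitneyIndex_comp_add hγ.toIsPlaneCurve]

/-- A shift of the base point through a double point. -/
theorem arnold_shift_through {γ : ℝ → ℂ} (hγ : IsGenericCurve γ) {b e : ℝ}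
    (hb : (0, b) ∈ doublePairs γ) (he : 0 < e) (heb : e < b)
    (hsmall : ∀ q ∈ doublePairs γ, q ≠ (0, b) → e < q.1) :
    arnold (fun s => γ (s + e)) = arnold γ := by
  classical
  set p : ℝ × ℝ := (0, b) with hp
  have hb2 : b < 2 * Real.pi := hb.2.2.1
  set C : Finset (ℝ × ℝ) := hγ.finite.toFinset.erase p with hC
  have hmem : ∀ q ∈ C, q ∈ doublePairs γ ∧ q ≠ p := fun q hq => by
    rw [hC, Finset.mem_erase, Finite.mem_toFinset] at hq
    exact hq.symm
  have hpC : p ∉ C := Finset.notMem_erase _ _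
  have hins : (insert p C : Finset (ℝ × ℝ)) = hγ.finite.toFinset :=
    Finset.insert_erase (by rwa [Finite.mem_toFinset])
  have hB : BijOn id ((insert p C : Finset (ℝ × ℝ)) : Set (ℝ × ℝ)) (doublePairs γ) := by
    rw [hins, hγ.finite.coe_toFinset]; exact bijOn_id _
  -- The passage at the parameter `0` is pushed to `2π - e`, the end of the period; the two passages
  -- through `p` thereby change roles.
  set f : ℝ × ℝ → ℝ × ℝ := fun q => if q = p then (b - e, 2 * Real.pi - e) else
    (q.1 - e, q.2 - e) with hf
  have hfp : f p = (b - e, 2 * Real.pi - e) := if_pos rfl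
  have hfq : ∀ q, q ≠ p → f q = (q.1 - e, q.2 - e) := fun q hq => if_neg hq
  have hper0 : γ (2 * Real.pi) = γ 0 := by simpa using hγ.periodic 0
  have hper' : deriv γ (2 * Real.pi) = deriv γ 0 := by
    simpa using hγ.toIsPlaneCurve.periodic_deriv 0
  have hB' : BijOn f ((insert p C : Finset (ℝ × ℝ)) : Set (ℝ × ℝ))
      (doublePairs (fun s => γ (s + e))) := by
    rw [hins, hγ.finite.coe_toFinset]
    refine ⟨?_, ?_, ?_⟩
    · intro q hq
      by_cases hqp : q = p
      · rw [hqp, hfp]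
        refine ⟨?_, ?_, ?_, ?_⟩ <;> dsimp only
        · linarith
        · linarith
        · linarith
        · simp only [sub_add_cancel]
          rw [hper0]; exact hb.2.2.2.symm
      · rw [hfq q hqp]
        have := hsmall q hq hqp
        refine ⟨?_, ?_, ?_, ?_⟩ <;> dsimp only
        · linarith
        · linarith [hq.2.1]
        · linarith [hq.2.2.1]
        · simpa using hq.2.2.2
    · intro q hq q' hq' hqq
      by_cases h1 : q = p <;> by_cases h2 : q' = p
      · rw [h1, h2]
      · rw [h1, hfp, hfq q' h2] at hqq
        have := congrArg Prod.snd hqq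
        dsimp only at this
        linarith [hq'.2.2.1]
      · rw [h2, hfp, hfq q h1] at hqq
        have := congrArg Prod.snd hqq
        dsimp only at this
        linarith [hq.2.2.1]
      · rw [hfq q h1, hfq q' h2] at hqq
        simp only [Prod.mk.injEq, sub_left_inj] at hqq
        exact Prod.ext hqq.1 hqq.2
    · intro r hr
      have hk : ∀ x ∈ Ico 0 (2 * Real.pi), e < toIcoMod Real.two_pi_pos 0 (x + e) →
          toIcoMod Real.two_pi_pos 0 (x + e) = x + e := by
        intro x hx hy
        obtain ⟨k, hk⟩ := exists_toIcoMod_eq (x + e)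
        have hm := toIcoMod_two_pi_mem (x + e)
        have : toIcoMod Real.two_pi_pos 0 (x + e) - e ∈ Ico 0 (2 * Real.pi) :=
          ⟨by linarith, by linarith [hm.2]⟩
        have := eq_of_mem_Ico_of_sub_eq this hx (k := -k) (by rw [hk]; push_cast; ring)
        linarith
      have hk0 : ∀ x ∈ Ico 0 (2 * Real.pi), toIcoMod Real.two_pi_pos 0 (x + e) = 0 →
          x = 2 * Real.pi - e := by
        intro x hx hy
        obtain ⟨k, hk⟩ := exists_toIcoMod_eq (x + e)
        refine eq_of_mem_Ico_of_sub_eq hx ⟨by linarith, by linarith⟩ (k := k - 1) ?_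
        push_cast
        linarith
      have r1 : r.1 ∈ Ico 0 (2 * Real.pi) := ⟨hr.1, hr.2.1.trans hr.2.2.1⟩
      have r2 : r.2 ∈ Ico 0 (2 * Real.pi) := ⟨hr.1.trans hr.2.1.le, hr.2.2.1⟩
      rcases mem_doublePairs_of_comp hγ.periodic (toIcoMod_add_const_injOn e) hr with h | h
      · by_cases hq : (toIcoMod Real.two_pi_pos 0 (r.1 + e), toIcoMod Real.two_pi_pos 0 (r.2 + e)) = p
        · have e1 := hk0 _ r1 (congrArg Prod.fst hq)
          have e2 := hk _ r2 (heb.trans_eq (congrArg Prod.snd hq).symm)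
          have e3 : r.2 + e = b := e2.symm.trans (congrArg Prod.snd hq)
          linarith [hr.2.1]
        · have h1 := hsmall _ h hq
          have e1 := hk _ r1 h1
          have e2 := hk _ r2 (h1.trans h.2.1)
          rw [e1, e2] at h hq
          exact ⟨_, h, by rw [hfq _ hq]; simp⟩
      · by_cases hq : (toIcoMod Real.two_pi_pos 0 (r.2 + e), toIcoMod Real.two_pi_pos 0 (r.1 + e)) = p
        · have e1 := hk0 _ r2 (congrArg Prod.fst hq)
          have e2 := hk _ r1 (heb.trans_eq (congrArg Prod.snd hq).symm)
          have e3 : r.1 + e = b := e2.symm.trans (congrArg Prod.snd hq)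
          refine ⟨p, hb, ?_⟩
          rw [hfp]
          exact Prod.ext (by dsimp only; linarith) e1.symm
        · have h1 := hsmall _ h hq
          have e1 := hk _ r2 h1
          have e2 := hk _ r1 (h1.trans h.2.1)
          have h3 := h.2.1
          dsimp only at h3
          rw [e1, e2] at h3
          linarith [hr.2.1]
  have hεp : doubleSign (fun s => γ (s + e)) (f p) = -doubleSign γ p := by
    rw [hfp, doubleSign_comp_add]
    unfold doubleSign
    simp only [sub_add_cancel, hper']
    rw [cross_swap, Real.sign_neg]
  have hεq : ∀ q ∈ C, doubleSign (fun s => γ (s + e)) (f q) = doubleSign γ q := by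
    intro q hq
    rw [hfq q (hmem q hq).2, doubleSign_comp_add]
    simp
  have hpos : ∀ q ∈ C, 0 < q.1 ∧ q.1 < q.2 ∧ q.2 < 2 * Real.pi ∧ q.1 ≠ b ∧ q.2 ≠ b := by
    intro q hq
    obtain ⟨h1, h2⟩ := hmem q hq
    refine ⟨he.trans (hsmall q h1 h2), h1.2.1, h1.2.2.1, ?_, ?_⟩
    · exact doublePairs_fst_ne_snd hγ.no_triple h1 hb
    · exact fun h => h2 (doublePairs_snd_injOn hγ.no_triple h1 hb h)
  have hsame : ∀ q ∈ C, ∀ r ∈ C, SameOrder q r (f q) (f r) := fun q hq r hr => by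
    rw [hfq q (hmem q hq).2, hfq r (hmem r hr).2]; exact SameOrder.translate e q r
  have hsum : ∀ R : ℝ × ℝ → ℝ × ℝ → Prop, ¬ R p p →
      pairSum γ (doubleSign γ) R = chordSum C (doubleSign γ) R + ∑ d ∈ C,
        ((if R p d then doubleSign γ p * doubleSign γ d else 0) +
          (if R d p then doubleSign γ p * doubleSign γ d else 0)) := by
    intro R hR
    rw [pairSum_eq_chordSum hB, chordSum_insert hpC _ (R := fun c d => R (id c) (id d)) hR]
    rfl
  have hsum' : ∀ R : ℝ × ℝ → ℝ × ℝ → Prop, ¬ R (f p) (f p) →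
      (∀ q ∈ C, ∀ r ∈ C, R (f q) (f r) ↔ R q r) →
      pairSum (fun s => γ (s + e)) (doubleSign (fun s => γ (s + e))) R =
        chordSum C (doubleSign γ) R + ∑ d ∈ C,
        ((if R (f p) (f d) then -(doubleSign γ p * doubleSign γ d) else 0) +
          (if R (f d) (f p) then -(doubleSign γ p * doubleSign γ d) else 0)) := by
    intro R hR hRR
    rw [pairSum_eq_chordSum hB', chordSum_insert hpC _ (R := fun c d => R (f c) (f d)) hR, chordSum_congr hεq hRR]
    congr 1
    refine Finset.sum_congr rfl fun d hd => ?_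
    rw [hεp, hεq d hd, neg_mul]
  -- The chords interleaved with `p` are the intersections of the two loops cut off at `p`.
  have hT : ∑ d ∈ C with d.1 < b ∧ b < d.2, doubleSign γ d = 0 := by
    refine sum_doubleSign_eq_zero hγ hb fun q => ?_
    rw [Finset.mem_filter]
    constructor
    · rintro ⟨h1, h2⟩
      exact ⟨(hmem q h1).1, (hpos q h1).1, h2⟩
    · rintro ⟨h1, h2, h3⟩
      refine ⟨?_, h3⟩
      rw [hC, Finset.mem_erase, Finite.mem_toFinset]
      exact ⟨fun h => h2.ne' (congrArg Prod.fst h), h1⟩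
  -- A chord beyond `b` passes from separated to nested and one below `b` from nested to separated.
  -- As the sign of `p` is reversed, its contribution to `S₁ - S₂` does not change.
  have key : ∀ d ∈ C, (Separated p d ↔ b < d.1) ∧ ¬ Separated d p ∧ (Nested p d ↔ d.2 < b) ∧
      ¬ Nested d p ∧ (Interleaved p d ↔ d.1 < b ∧ b < d.2) ∧ ¬ Interleaved d p ∧
      ¬ Separated (f p) (f d) ∧ (Separated (f d) (f p) ↔ d.2 < b) ∧ (Nested (f p) (f d) ↔ b < d.1) ∧
      ¬ Nested (f d) (f p) ∧ ¬ Interleaved (f p) (f d) ∧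
      (Interleaved (f d) (f p) ↔ d.1 < b ∧ b < d.2) := by
    intro d hd
    obtain ⟨h1, h2, h3, -, -⟩ := hpos d hd
    rw [hfp, hfq d (hmem d hd).2]
    simp only [Separated, Nested, Interleaved, hp, sub_lt_sub_iff_right, h1, h3, true_and, and_true,
      iff_self, h1.not_gt, h3.not_gt, false_and, and_false, not_false_eq_true,
      (h1.trans h2).not_gt, (h2.trans h3).not_gt]
  have hne : ¬ Separated p p ∧ ¬ Nested p p ∧ ¬ Interleaved p p := by
    simp [Separated, Nested, Interleaved, hp, (he.trans heb).le]
  have hne' : ¬ Separated (f p) (f p) ∧ ¬ Nested (f p) (f p) ∧ ¬ Interleaved (f p) (f p) := by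
    rw [hfp]
    simp [Separated, Nested, Interleaved, hb2.le]
  refine arnold_congr ?_ ?_ ?_ ?_
  · unfold sepSubNest
    rw [hsum _ hne.1, hsum _ hne.2.1,
      hsum' _ hne'.1 fun q hq r hr => (hsame q hq r hr).separated.symm,
      hsum' _ hne'.2.1 fun q hq r hr => (hsame q hq r hr).nested.symm]
    rw [add_sub_add_comm, add_sub_add_comm, ← Finset.sum_sub_distrib, ← Finset.sum_sub_distrib]
    congr 1
    refine Finset.sum_congr rfl fun d hd => ?_
    obtain ⟨k1, k2, k3, k4, k5, k6, k7, k8, k9, k10, k11, k12⟩ := key d hd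
    simp only [k1, k2, k3, k4, k7, k8, k9, k10, if_false]
    split_ifs <;> ring
  · unfold interSum
    rw [hsum _ hne.2.2, hsum' _ hne'.2.2 fun q hq r hr => (hsame q hq r hr).interleaved.symm]
    congr 1
    have hz : ∑ d ∈ C, (if d.1 < b ∧ b < d.2 then doubleSign γ p * doubleSign γ d else 0) = 0 := by
      rw [← Finset.sum_filter, ← Finset.mul_sum, hT, mul_zero]
    trans 0
    · refine neg_eq_zero.mp (Eq.trans ?_ hz)
      rw [← Finset.sum_neg_distrib]
      refine Finset.sum_congr rfl fun d hd => ?_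
      obtain ⟨k1, k2, k3, k4, k5, k6, k7, k8, k9, k10, k11, k12⟩ := key d hd
      simp only [k11, k12, if_false]
      split_ifs <;> ring
    · refine (Eq.trans ?_ hz).symm
      refine Finset.sum_congr rfl fun d hd => ?_
      obtain ⟨k1, k2, k3, k4, k5, k6, k7, k8, k9, k10, k11, k12⟩ := key d hd
      simp only [k5, k6, if_false, add_zero]
  · rw [doubleCount_eq_card hB, doubleCount_eq_card hB']
  · rw [whitneyIndex_comp_add hγ.toIsPlaneCurve]

theorem exists_pos_lt_of_finite {ι : Type*} {D : Set ι} (hD : D.Finite) {f : ι → ℝ}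
    (hf : ∀ q ∈ D, 0 < f q) : ∀ᶠ e in 𝓝[>] (0 : ℝ), ∀ q ∈ D, e < f q :=
  (eventually_all_finite hD).mpr fun q hq => nhdsWithin_le_nhds (gt_mem_nhds (hf q hq))

/-- The invariants do not depend on the base point. -/
theorem arnold_comp_add {γ : ℝ → ℂ} (hγ : IsGenericCurve γ) (c : ℝ) :
    arnold (fun s => γ (s + c)) = arnold γ := by
  -- Small shifts suffice, by connectedness of the line. Small negative shifts merely translate all
  -- chords, even when `0` is a passage; a small positive shift does so unless it pushes a double
  -- point at `0` through the base point.
  have key : ∀ δ : ℝ → ℂ, IsGenericCurve δ → ∀ᶠ e in 𝓝 (0 : ℝ),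
      arnold (fun s => δ (s + e)) = arnold δ := by
    intro δ hδ
    have hneg : ∀ᶠ e in 𝓝[<] (0 : ℝ), arnold (fun s => δ (s + e)) = arnold δ := by
      have h : ∀ᶠ e in 𝓝 (0 : ℝ), ∀ q ∈ doublePairs δ, q.2 < 2 * Real.pi + e :=
        (eventually_all_finite hδ.finite).mpr fun q hq => by
          have hc : Continuous fun e : ℝ => 2 * Real.pi + e := by fun_prop
          exact (hc.tendsto 0).eventually (lt_mem_nhds (by simpa using hq.2.2.1))
      filter_upwards [nhdsWithin_le_nhds h, self_mem_nhdsWithin] with e he he0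
      exact arnold_translate hδ (fun q hq => (le_of_lt he0).trans hq.1) he
    have hpos : ∀ᶠ e in 𝓝[>] (0 : ℝ), arnold (fun s => δ (s + e)) = arnold δ := by
      by_cases hb : ∃ b, (0, b) ∈ doublePairs δ
      · obtain ⟨b, hb⟩ := hb
        have h : ∀ᶠ e in 𝓝[>] (0 : ℝ), ∀ q ∈ doublePairs δ \ {(0, b)}, e < q.1 := by
          refine exists_pos_lt_of_finite hδ.finite.sdiff fun q hq => ?_
          refine lt_of_le_of_ne hq.1.1 fun h => hq.2 ?_
          exact doublePairs_fst_injOn hδ.no_triple hq.1 hb h.symm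
        filter_upwards [h, self_mem_nhdsWithin, nhdsWithin_le_nhds (gt_mem_nhds hb.2.1)]
          with e h1 h2 h3
        exact arnold_shift_through hδ hb h2 h3 fun q hq hqb => h1 q ⟨hq, hqb⟩
      · have h : ∀ᶠ e in 𝓝[>] (0 : ℝ), ∀ q ∈ doublePairs δ, e < q.1 := by
          refine exists_pos_lt_of_finite hδ.finite fun q hq => ?_
          exact lt_of_le_of_ne hq.1 fun h => hb ⟨q.2, by rw [h]; exact hq⟩
        filter_upwards [h, self_mem_nhdsWithin] with e h1 h2
        have h2 : 0 < e := h2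
        exact arnold_translate hδ (fun q hq => (h1 q hq).le) fun q hq => by
          linarith [hq.2.2.1]
    rw [← nhdsNE_sup_pure, ← nhdsLT_sup_nhdsGT, eventually_sup, eventually_sup]
    exact ⟨⟨hneg, hpos⟩, by simp⟩
  have hloc : IsLocallyConstant fun c => arnold (fun s => γ (s + c)) := by
    rw [IsLocallyConstant.iff_eventually_eq]
    intro c₀
    have h := key _ (hγ.comp_add c₀)
    have ht : Tendsto (fun c => c - c₀) (𝓝 c₀) (𝓝 0) := by
      have : Continuous fun c : ℝ => c - c₀ := by fun_prop
      simpa using this.tendsto c₀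
    filter_upwards [ht.eventually h] with c hc
    rw [← hc]
    congr 1
    ext s
    congr 1
    ring
  have := hloc.apply_eq_of_preconnectedSpace c 0
  simpa using this

/-- The base point can be moved off the double points by a small shift. -/
theorem exists_base_shift {γ : ℝ → ℂ} (hγ : Function.Periodic γ (2 * Real.pi))
    (hfin : (doublePairs γ).Finite) : ∃ η > 0,
      BijOn (fun q : ℝ × ℝ => (q.1 + η, q.2 + η)) (doublePairs γ)
        (doublePairs (fun s => γ (s - η))) := by
  have h : ∀ᶠ e in 𝓝[>] (0 : ℝ), ∀ q ∈ doublePairs γ, e < 2 * Real.pi - q.2 :=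
    exists_pos_lt_of_finite hfin fun q hq => sub_pos.mpr hq.2.2.1
  obtain ⟨η, h1, h2⟩ := (h.and self_mem_nhdsWithin).exists
  have h2 : 0 < η := h2
  refine ⟨η, h2, ?_⟩
  have := bijOn_translate hγ (c := -η) (fun q hq => by linarith [hq.1])
    (fun q hq => by linarith [h1 q hq])
  simpa only [sub_neg_eq_add, ← sub_eq_add_neg] using this

/-! ### Reversal of the orientation -/

theorem chordSum_swap {ι : Type*} (C : Finset ι) (e : ι → ℝ) (R : ι → ι → Prop) :
    chordSum C e (fun c d => R d c) = chordSum C e R := by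
  unfold chordSum
  rw [Finset.sum_comm]
  exact Finset.sum_congr rfl fun c _ => Finset.sum_congr rfl fun d _ => by rw [mul_comm]

theorem chordSum_neg {ι : Type*} (C : Finset ι) (e : ι → ℝ) (R : ι → ι → Prop) :
    chordSum C (fun c => -e c) R = chordSum C e R := by
  unfold chordSum
  simp only [neg_mul_neg]

/-- Reversal sends the chord `(s, t)` to `(2π - t, 2π - s)`. Both velocities are negated and their
order is swapped, so every sign is reversed and the products persist; separated and interleaved
pairs are read in the opposite order, and the index changes sign. A preliminary shift of the base
point avoids a passage at `0`, which would be sent to `2π`. -/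
theorem arnold_comp_neg {γ : ℝ → ℂ} (hγ : IsGenericCurve γ) :
    arnold (fun s => γ (-s)) = arnold γ := by
  have main : ∀ δ : ℝ → ℂ, IsGenericCurve δ → (∀ q ∈ doublePairs δ, 0 < q.1) →
      arnold (fun s => δ (-s)) = arnold δ := by
    intro δ hδ hpos
    set C := hδ.finite.toFinset
    have hC : BijOn id (C : Set (ℝ × ℝ)) (doublePairs δ) := by
      rw [hδ.finite.coe_toFinset]; exact bijOn_id _
    set f : ℝ × ℝ → ℝ × ℝ := fun q => (2 * Real.pi - q.2, 2 * Real.pi - q.1) with hf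
    have hper : ∀ x, δ (-(2 * Real.pi - x)) = δ x := fun x => by
      rw [neg_sub]; exact hδ.periodic.sub_eq x
    have hper' : ∀ x, deriv δ (-(2 * Real.pi - x)) = deriv δ x := fun x => by
      rw [neg_sub]; exact hδ.toIsPlaneCurve.periodic_deriv.sub_eq x
    have hmaps : ∀ q ∈ doublePairs δ, f q ∈ doublePairs (fun s => δ (-s)) := by
      intro q hq
      refine ⟨?_, ?_, ?_, ?_⟩ <;> simp only [hf]
      · linarith [hq.2.2.1]
      · linarith [hq.2.1]
      · linarith [hpos q hq]
      · rw [hper, hper]; exact hq.2.2.2.symm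
    have hC' : BijOn f (C : Set (ℝ × ℝ)) (doublePairs (fun s => δ (-s))) := by
      rw [hδ.finite.coe_toFinset]
      refine ⟨hmaps, ?_, ?_⟩
      · intro q _ q' _ he
        simp only [hf, Prod.mk.injEq, sub_right_inj] at he
        exact Prod.ext he.2 he.1
      · intro p hp
        have hp0 : 0 < p.1 := by
          refine lt_of_le_of_ne hp.1 fun h0 => ?_
          have hm : (0, 2 * Real.pi - p.2) ∈ doublePairs δ := by
            refine ⟨le_rfl, by simpa using hp.2.2.1, ?_, ?_⟩
            · dsimp only; linarith [hp.2.1, hp.1]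
            · have h1 := hp.2.2.2
              have h2 := hper (2 * Real.pi - p.2)
              rw [sub_sub_cancel] at h2
              dsimp only at h1 ⊢
              rw [← h2, ← h1, ← h0, neg_zero]
          exact lt_irrefl _ (hpos _ hm)
        refine ⟨(2 * Real.pi - p.2, 2 * Real.pi - p.1), ⟨?_, ?_, ?_, ?_⟩, ?_⟩
        · dsimp only; linarith [hp.2.2.1]
        · dsimp only; linarith [hp.2.1]
        · dsimp only; linarith
        · have h1 := hp.2.2.2
          have h2 := hper (2 * Real.pi - p.2)
          have h3 := hper (2 * Real.pi - p.1)
          rw [sub_sub_cancel] at h2 h3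
          dsimp only at h1 ⊢
          rw [← h2, ← h3, h1]
        · simp [hf]
    have hε : ∀ q ∈ C, doubleSign (fun s => δ (-s)) (f q) = -doubleSign δ q := by
      intro q _
      unfold doubleSign
      rw [deriv_comp_neg, deriv_comp_neg, hper', hper', cross_neg_neg, cross_swap, Real.sign_neg]
    have hsw : ∀ q r, Separated (f q) (f r) ↔ Separated r q := fun q r => by
      simp [Separated, hf]
    have hnw : ∀ q r, Nested (f q) (f r) ↔ Nested q r := fun q r => by
      simp [Nested, hf, and_comm]
    have hiw : ∀ q r, Interleaved (f q) (f r) ↔ Interleaved r q := fun q r => by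
      simp only [Interleaved, hf, sub_lt_sub_iff_left]
      tauto
    refine arnold_congr ?_ ?_ ?_ ?_
    · unfold sepSubNest
      simp only [pairSum_eq_chordSum hC, pairSum_eq_chordSum hC', hsw, hnw]
      rw [chordSum_congr hε fun _ _ _ _ => Iff.rfl, chordSum_congr hε fun _ _ _ _ => Iff.rfl,
        chordSum_neg, chordSum_neg, chordSum_swap C _ Separated]
      rfl
    · unfold interSum
      simp only [pairSum_eq_chordSum hC, pairSum_eq_chordSum hC', hiw]
      rw [chordSum_congr hε fun _ _ _ _ => Iff.rfl, chordSum_neg, chordSum_swap C _ Interleaved]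
      rfl
    · rw [doubleCount_eq_card hC, doubleCount_eq_card hC']
    · rw [whitneyIndex_comp_neg hδ.toIsPlaneCurve, neg_sq]
  obtain ⟨η, hη, hbij⟩ := exists_base_shift hγ.periodic hγ.finite
  have hgen : IsGenericCurve (fun s => γ (s - η)) := by
    simpa only [sub_eq_add_neg] using hγ.comp_add (-η)
  have h1 := main _ hgen fun q hq => by
    obtain ⟨q', hq', rfl⟩ := hbij.surjOn hq
    exact add_pos_of_nonneg_of_pos hq'.1 hη
  have h2 : arnold (fun s => γ (s - η)) = arnold γ := by
    simpa only [sub_eq_add_neg] using arnold_comp_add hγ (-η)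
  have h3 := arnold_comp_add hγ.comp_neg η
  rw [← h3, ← h2, ← h1]
  congr 1
  ext s
  congr 1
  ring

end PlaneCurves

namespace PlaneCurves

open Set Filter Topology

/-! ### Shifts of the parameter in a homotopy -/

/-- The homotopy whose curves have their base points shifted by `η`. -/
def shiftBase (H : ℝ → ℝ → ℂ) (η : ℝ) : ℝ → ℝ → ℂ := fun t s => H t (s - η)

section Shift

variable {H : ℝ → ℝ → ℂ}

theorem shiftBase_eq (H : ℝ → ℝ → ℂ) (η t : ℝ) : shiftBase H η t = fun s => H t (s + -η) := by
  ext s; rw [shiftBase, sub_eq_add_neg]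

theorem deriv_shiftBase (H : ℝ → ℝ → ℂ) (η t : ℝ) :
    deriv (shiftBase H η t) = fun s => deriv (H t) (s - η) := by
  ext s; exact deriv_comp_sub_const _ _ _

theorem deriv_deriv_shiftBase (H : ℝ → ℝ → ℂ) (η t : ℝ) :
    deriv (deriv (shiftBase H η t)) = fun s => deriv (deriv (H t)) (s - η) := by
  rw [deriv_shiftBase]
  ext s; exact deriv_comp_sub_const _ _ _

theorem motion_shiftBase (H : ℝ → ℝ → ℂ) (η s : ℝ) :
    motion (shiftBase H η) s = motion H (s - η) := rfl

theorem passage_shiftBase (H : ℝ → ℝ → ℂ) (η s s' : ℝ) :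
    passage (shiftBase H η) s s' = passage H (s - η) (s' - η) := by
  unfold passage
  rw [deriv_shiftBase, motion_shiftBase, motion_shiftBase]

theorem IsRegularHomotopy.shiftBase (h : IsRegularHomotopy H) (η : ℝ) :
    IsRegularHomotopy (shiftBase H η) where
  smooth := by
    have : ContDiff ℝ ∞ fun q : ℝ × ℝ => (q.1, q.2 - η) := by fun_prop
    exact h.smooth.comp this
  curve t ht := by rw [shiftBase_eq]; exact (h.curve t ht).comp_add _

theorem arnold_shiftBase {t : ℝ} (h : IsGenericCurve (H t)) (η : ℝ) :
    arnold (shiftBase H η t) = arnold (H t) := by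
  rw [shiftBase_eq]; exact arnold_comp_add h _

theorem mem_doublePairs_shiftBase {η t : ℝ}
    (hb : BijOn (fun q : ℝ × ℝ => (q.1 + η, q.2 + η)) (doublePairs (H t))
      (doublePairs (shiftBase H η t))) {p : ℝ × ℝ} (hp : p ∈ doublePairs (shiftBase H η t)) :
    (p.1 - η, p.2 - η) ∈ doublePairs (H t) := by
  obtain ⟨q, hq, rfl⟩ := hb.surjOn hp
  simpa using hq

theorem IsSelfTangency.shiftBase {p : ℝ × ℝ} (h : IsSelfTangency H p) {η : ℝ}
    (hb : BijOn (fun q : ℝ × ℝ => (q.1 + η, q.2 + η)) (doublePairs (H 0))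
      (doublePairs (shiftBase H η 0))) :
    IsSelfTangency (shiftBase H η) (p.1 + η, p.2 + η) where
  toIsRegularHomotopy := h.toIsRegularHomotopy.shiftBase η
  generic t ht h0 := by rw [shiftBase_eq]; exact (h.generic t ht h0).comp_add _
  finite := by rw [← hb.image_eq]; exact h.finite.image _
  no_triple s t u hstu := h.no_triple (s - η) (t - η) (u - η)
    ⟨mem_doublePairs_shiftBase hb hstu.1, mem_doublePairs_shiftBase hb hstu.2⟩
  transverse q hq hqp := by
    have := h.transverse _ (mem_doublePairs_shiftBase hb hq) (by
      rintro rfl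
      exact hqp (by simp))
    unfold TransverseAt at this ⊢
    rwa [deriv_shiftBase]
  mem := hb.mapsTo h.mem
  tangent := by rw [deriv_shiftBase]; simpa using h.tangent
  curvature := by rw [deriv_deriv_shiftBase, deriv_shiftBase]; simpa using h.curvature
  speed := by
    rw [deriv_shiftBase, motion_shiftBase, motion_shiftBase]; simpa using h.speed

theorem IsTriplePoint.shiftBase {s₁ s₂ s₃ : ℝ} (h : IsTriplePoint H s₁ s₂ s₃) {η : ℝ}
    (hb : BijOn (fun q : ℝ × ℝ => (q.1 + η, q.2 + η)) (doublePairs (H 0))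
      (doublePairs (shiftBase H η 0))) :
    IsTriplePoint (shiftBase H η) (s₁ + η) (s₂ + η) (s₃ + η) where
  toIsRegularHomotopy := h.toIsRegularHomotopy.shiftBase η
  generic t ht h0 := by rw [shiftBase_eq]; exact (h.generic t ht h0).comp_add _
  finite := by rw [← hb.image_eq]; exact h.finite.image _
  transverse q hq := by
    have := h.transverse _ (mem_doublePairs_shiftBase hb hq)
    unfold TransverseAt at this ⊢
    rwa [deriv_shiftBase]
  triple := ⟨hb.mapsTo h.triple.1, hb.mapsTo h.triple.2⟩
  unique s t u hstu := by
    obtain ⟨h1, h2, h3⟩ := h.unique _ _ _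
      ⟨mem_doublePairs_shiftBase hb hstu.1, mem_doublePairs_shiftBase hb hstu.2⟩
    exact ⟨by linarith, by linarith, by linarith⟩
  speed := by rw [passage_shiftBase, passage_shiftBase]; simpa using h.speed

theorem tripleSign_shiftBase (H : ℝ → ℝ → ℂ) (η s₁ s₂ s₃ : ℝ) :
    tripleSign (shiftBase H η) (s₁ + η) (s₂ + η) (s₃ + η) = tripleSign H s₁ s₂ s₃ := by
  unfold tripleSign triangleMatches
  simp only [passage_shiftBase, add_sub_cancel_right]

/-! ### Invariance under isotopy -/

/-- The invariants are locally constant along a regular homotopy at a generic moment. -/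
theorem eventually_arnold_eq (h : IsRegularHomotopy H) {t₀ : ℝ} (ht₀ : t₀ ∈ Icc (-1 : ℝ) 1)
    (hgen : IsGenericCurve (H t₀)) :
    ∀ᶠ t in 𝓝[Icc (-1) 1] t₀, IsGenericCurve (H t) → arnold (H t) = arnold (H t₀) := by
  obtain ⟨η, hη, hb⟩ := exists_base_shift hgen.periodic hgen.finite
  have hK := h.shiftBase η
  set K := shiftBase H η with hKdef
  have hKgen : IsGenericCurve (K t₀) := by
    rw [hKdef, shiftBase_eq]; exact hgen.comp_add _
  have hbase : ∀ q ∈ doublePairs (K t₀), 0 < q.1 := by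
    intro q hq
    obtain ⟨q', hq', rfl⟩ := hb.surjOn hq
    exact add_pos_of_nonneg_of_pos hq'.1 hη
  obtain ⟨ψ, hψ⟩ := exists_isTracking hK.smooth subset_rfl hbase hKgen.transverse
  have hC : BijOn id (hKgen.finite.toFinset : Set (ℝ × ℝ)) (doublePairs (K t₀)) := by
    rw [hKgen.finite.coe_toFinset]; exact bijOn_id _
  have hsame : ∀ᶠ t in 𝓝 t₀, ∀ c ∈ doublePairs (K t₀), ∀ d ∈ doublePairs (K t₀),
      SameOrder c d (ψ c t) (ψ d t) := by
    refine (eventually_all_finite hKgen.finite).mpr fun c hc =>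
      (eventually_all_finite hKgen.finite).mpr fun d hd => ?_
    by_cases hcd : c = d
    · subst hcd
      filter_upwards [hψ.eventually_mem c hc] with t ht
      have h1 := hc.2.1
      have h2 := ht.2.1
      simp [SameOrder, h1, h2, h1.not_gt, h2.not_gt]
    · have hn := hKgen.no_triple
      exact eventually_sameOrder (hψ.tendsto hc) (hψ.tendsto hd)
        (fun e => hcd (doublePairs_fst_injOn hn hc hd e)) (doublePairs_fst_ne_snd hn hc hd)
        (doublePairs_fst_ne_snd hn hd hc).symm
        (fun e => hcd (doublePairs_snd_injOn hn hc hd e))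
  have hsign : ∀ᶠ t in 𝓝 t₀, ∀ c ∈ doublePairs (K t₀),
      doubleSign (K t) (ψ c t) = doubleSign (K t₀) c :=
    (eventually_all_finite hKgen.finite).mpr hψ.eventually_sign
  filter_upwards [hψ.eventually_bijOn hK.smooth ht₀ hK.curve hbase hKgen.finite,
    nhdsWithin_le_nhds hsame, nhdsWithin_le_nhds hsign, self_mem_nhdsWithin] with t e1 e2 e3 e4 hgt
  rw [← arnold_shiftBase hgt η, ← arnold_shiftBase hgen η]
  rw [← hKgen.finite.coe_toFinset] at e1
  refine (arnold_eq_of_sameOrder hC e1 (fun c hc => (e3 c ?_).symm) (fun c hc d hd => e2 c ?_ d ?_)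
    (by rw [whitneyIndex_eq_of_homotopy hK ht₀ e4])).symm
  all_goals exact hKgen.finite.mem_toFinset.mp ‹_›

theorem arnold_eq_of_isPreconnected (h : IsRegularHomotopy H) {J : Set ℝ}
    (hJ : J ⊆ Icc (-1 : ℝ) 1) (hJc : IsPreconnected J) (hgen : ∀ t ∈ J, IsGenericCurve (H t))
    {a b : ℝ} (ha : a ∈ J) (hb : b ∈ J) : arnold (H a) = arnold (H b) := by
  have hloc : IsLocallyConstant fun t : J => arnold (H t) := by
    rw [IsLocallyConstant.iff_eventually_eq]
    rintro ⟨t₀, ht₀⟩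
    rw [eventually_nhds_subtype_iff J ⟨t₀, ht₀⟩ (fun t => arnold (H t) = arnold (H t₀))]
    filter_upwards [nhdsWithin_mono _ hJ (eventually_arnold_eq h (hJ ht₀) (hgen t₀ ht₀)),
      self_mem_nhdsWithin] with t ht htJ
    exact ht (hgen t htJ)
  have := isPreconnected_iff_preconnectedSpace.mp hJc
  exact hloc.apply_eq_of_preconnectedSpace ⟨a, ha⟩ ⟨b, hb⟩

theorem arnold_eq_of_isotopy (h : IsRegularHomotopy H)
    (hgen : ∀ t ∈ Icc (-1 : ℝ) 1, IsGenericCurve (H t)) : arnold (H 1) = arnold (H (-1)) :=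
  arnold_eq_of_isPreconnected h subset_rfl isPreconnected_Icc hgen (by simp) (by simp)

/-- The change of the invariants under a perestroika at time `0` may be computed from curves at
times close to `0` and after a shift of the base point. -/
theorem exists_arnold_eq_near (h : IsRegularHomotopy H)
    (hgen : ∀ t ∈ Icc (-1 : ℝ) 1, t ≠ 0 → IsGenericCurve (H t)) (η : ℝ) {P : ℝ → Prop}
    (hP : ∀ᶠ t in 𝓝[>] (0 : ℝ), P t) : ∃ t ∈ Ioc (0 : ℝ) 1, P t ∧
      arnold (H 1) = arnold (shiftBase H η t) ∧
      arnold (H (-1)) = arnold (shiftBase H η (-t)) := by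
  obtain ⟨t, h1, h2⟩ := (hP.and (Ioc_mem_nhdsGT zero_lt_one)).exists
  refine ⟨t, h2, h1, ?_, ?_⟩
  · rw [arnold_shiftBase (hgen t ⟨by linarith [h2.1], h2.2⟩ h2.1.ne')]
    refine arnold_eq_of_isPreconnected h (J := Ioc 0 1) (fun x hx => ⟨by linarith [hx.1], hx.2⟩)
      isPreconnected_Ioc (fun x hx => hgen x ⟨by linarith [hx.1], hx.2⟩ hx.1.ne') ?_ h2
    simp
  · rw [arnold_shiftBase (hgen (-t) ⟨by linarith [h2.2], by linarith [h2.1]⟩ (by linarith [h2.1]))]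
    refine arnold_eq_of_isPreconnected h (J := Ico (-1) 0) (fun x hx => ⟨hx.1, by linarith [hx.2]⟩)
      isPreconnected_Ico (fun x hx => hgen x ⟨hx.1, by linarith [hx.2]⟩ hx.2.ne) ?_ ?_
    · simp
    · exact ⟨by linarith [h2.2], by linarith [h2.1]⟩

end Shift

end PlaneCurves

namespace PlaneCurves

open Set Filter Topology

/-! ### The normal form of a self-tangency -/

/-- Inverts one monotone half of a fold `g` at its critical point `x₀`; the mirror version follows
for the other half. The two inverses parametrize by time the two double points born at a
self-tangency. -/
theorem exists_right_inverse {g : ℝ → ℝ} {x₀ δ : ℝ} (hδ : 0 < δ) (h0 : g x₀ = 0)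
    (hc : ContinuousOn g (Icc x₀ (x₀ + δ))) (hm : StrictMonoOn g (Icc x₀ (x₀ + δ))) :
    ∃ i : ℝ → ℝ, Tendsto i (𝓝[>] 0) (𝓝[>] x₀) ∧ (∀ᶠ t in 𝓝[>] (0 : ℝ), g (i t) = t) ∧
      ∀ x ∈ Icc x₀ (x₀ + δ), i (g x) = x := by
  set i := Function.invFunOn g (Icc x₀ (x₀ + δ)) with hi
  have hx0 : x₀ ∈ Icc x₀ (x₀ + δ) := ⟨le_rfl, by linarith⟩
  have hx1 : x₀ + δ ∈ Icc x₀ (x₀ + δ) := ⟨by linarith, le_rfl⟩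
  have hg1 : 0 < g (x₀ + δ) := h0 ▸ hm hx0 hx1 (by linarith)
  have hsol : ∀ t, 0 < t → t < g (x₀ + δ) → i t ∈ Icc x₀ (x₀ + δ) ∧ g (i t) = t := by
    intro t ht ht'
    have : t ∈ g '' Icc x₀ (x₀ + δ) :=
      intermediate_value_Icc (by linarith) hc ⟨by rw [h0]; exact ht.le, ht'.le⟩
    exact ⟨Function.invFunOn_mem this, Function.invFunOn_eq this⟩
  refine ⟨i, ?_, ?_, fun x hx => hm.injOn.leftInvOn_invFunOn hx⟩
  · rw [(nhdsGT_basis x₀).tendsto_right_iff]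
    intro x hx
    have hmin : min x (x₀ + δ) ∈ Icc x₀ (x₀ + δ) := ⟨le_min hx.le (by linarith), min_le_right _ _⟩
    have hpos : 0 < g (min x (x₀ + δ)) := h0 ▸ hm hx0 hmin (lt_min hx (by linarith))
    filter_upwards [Ioo_mem_nhdsGT hpos, Ioo_mem_nhdsGT hg1] with t ht ht'
    obtain ⟨h1, h2⟩ := hsol t ht'.1 ht'.2
    constructor
    · refine lt_of_le_of_ne h1.1 fun h => ht.1.ne ?_
      rw [← h2, ← h, h0]
    · refine lt_of_lt_of_le ?_ (min_le_left x (x₀ + δ))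
      by_contra hcon
      have := hm.monotoneOn hmin h1 (not_lt.mp hcon)
      rw [h2] at this
      exact this.not_gt ht.2
  · filter_upwards [Ioo_mem_nhdsGT hg1] with t ht
    exact (hsol t ht.1 ht.2).2

theorem exists_left_inverse {g : ℝ → ℝ} {x₀ δ : ℝ} (hδ : 0 < δ) (h0 : g x₀ = 0)
    (hc : ContinuousOn g (Icc (x₀ - δ) x₀)) (hm : StrictAntiOn g (Icc (x₀ - δ) x₀)) :
    ∃ i : ℝ → ℝ, Tendsto i (𝓝[>] 0) (𝓝[<] x₀) ∧ (∀ᶠ t in 𝓝[>] (0 : ℝ), g (i t) = t) ∧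
      ∀ x ∈ Icc (x₀ - δ) x₀, i (g x) = x := by
  have hmaps : MapsTo (fun x => -x) (Icc (-x₀) (-x₀ + δ)) (Icc (x₀ - δ) x₀) := fun x hx =>
    ⟨by linarith [hx.2], by linarith [hx.1]⟩
  obtain ⟨i, h1, h2, h3⟩ := exists_right_inverse (g := fun x => g (-x)) (x₀ := -x₀) hδ
    (by simpa using h0) (hc.comp continuous_neg.continuousOn hmaps)
    (fun x hx y hy hxy => hm (hmaps hy) (hmaps hx) (neg_lt_neg hxy))
  refine ⟨fun t => -i t, ?_, h2, fun x hx => ?_⟩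
  · have := tendsto_neg_nhdsGT (a := -x₀)
    rw [neg_neg] at this
    exact this.comp h1
  · have := h3 (-x) ⟨by linarith [hx.2], by linarith [hx.1]⟩
    simp only [neg_neg] at this
    show -i (g x) = x
    rw [this, neg_neg]

section Tangency

variable {H : ℝ → ℝ → ℂ}

/-- Along the curve of double points near a self-tangency, parametrized by the second passage. -/
structure IsTangencyCurve (H : ℝ → ℝ → ℂ) (p : ℝ × ℝ) (τ σ : ℝ → ℝ) : Prop where
  tau_apply : τ p.2 = 0
  sigma_apply : σ p.2 = p.1
  eventually_iff : ∀ᶠ v : ℝ × ℝ × ℝ in 𝓝 (0, p),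
    H v.1 v.2.1 = H v.1 v.2.2 ↔ v.1 = τ v.2.2 ∧ v.2.1 = σ v.2.2
  eventually_eq : ∀ᶠ u in 𝓝 p.2, H (τ u) (σ u) = H (τ u) u
  differentiable : ∀ᶠ u in 𝓝 p.2, DifferentiableAt ℝ τ u ∧ DifferentiableAt ℝ σ u
  deriv_eq : ∀ᶠ u in 𝓝 p.2, deriv τ u •
    (deriv (fun t => H t (σ u)) (τ u) - deriv (fun t => H t u) (τ u)) +
      deriv σ u • deriv (H (τ u)) (σ u) = deriv (H (τ u)) u

/-- At a tangency the double point equation cannot be solved for the two passages. The condition on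
the speed makes it solvable for the time and the first passage as functions of the second one. -/
theorem exists_isTangencyCurve (hH : ContDiff ℝ ∞ (fun q : ℝ × ℝ => H q.1 q.2)) {p : ℝ × ℝ}
    (hp : H 0 p.1 = H 0 p.2)
    (hspeed : cross (deriv (H 0) p.1) (motion H p.2 - motion H p.1) ≠ 0) :
    ∃ τ σ, IsTangencyCurve H p τ σ := by
  set F : ℝ × ℝ × ℝ → ℂ := fun v => H v.1 v.2.1 - H v.1 v.2.2 with hF
  have hFs : ContDiff ℝ ∞ F := contDiff_difference hH
  -- A permutation of the variables: `(u, t, s)` goes to `(t, s, u)`, so that `exists_implicit`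
  -- solves for `(t, s)`.
  set L : ℝ × ℝ × ℝ →L[ℝ] ℝ × ℝ × ℝ :=
    ((ContinuousLinearMap.fst ℝ ℝ ℝ).comp (ContinuousLinearMap.snd ℝ ℝ (ℝ × ℝ))).prod
      (((ContinuousLinearMap.snd ℝ ℝ ℝ).comp (ContinuousLinearMap.snd ℝ ℝ (ℝ × ℝ))).prod
        (ContinuousLinearMap.fst ℝ ℝ (ℝ × ℝ))) with hL
  have hLa : ∀ x y z, L (x, y, z) = (y, z, x) := fun x y z => rfl
  have hfd : ∀ v w, fderiv ℝ (F ∘ L) v w = fderiv ℝ F (L v) (L w) := by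
    intro v w
    rw [fderiv_comp v (hFs.differentiable (by simp) _) L.differentiableAt, L.fderiv]
    rfl
  have hs : ContDiff ℝ ∞ (F ∘ L) := hFs.comp L.contDiff
  obtain ⟨ψ, h1, h2, h3⟩ := exists_implicit (u := (p.2, 0, p.1)) (hs.of_le (by simp)) (by
    rw [hfd, hfd, hLa, hLa, hLa, fderiv_difference hH, fderiv_difference hH]
    simp only [zero_smul, one_smul, zero_add, sub_zero, add_zero]
    intro h0
    have e : cross (deriv (H 0) p.1) (motion H p.2 - motion H p.1) =
        cross (motion H p.1 - motion H p.2) (deriv (H 0) p.1) := by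
      rw [cross_swap, ← cross_neg_left, neg_sub]
    exact hspeed (e.trans h0))
  have hz : (F ∘ L) (p.2, 0, p.1) = 0 := sub_eq_zero.mpr hp
  rw [hz] at h1 h3
  dsimp only at h2 h3
  have hd1 : ∀ᶠ u in 𝓝 p.2, DifferentiableAt ℝ (fun u => (ψ u).1) u ∧
      DifferentiableAt ℝ (fun u => (ψ u).2) u := h3.mono fun u hu => ⟨hu.2.fst, hu.2.snd⟩
  refine ⟨fun u => (ψ u).1, fun u => (ψ u).2, by rw [h2], by rw [h2], ?_, ?_, hd1, ?_⟩
  · have hcont : Continuous fun v : ℝ × ℝ × ℝ => (v.2.2, v.1, v.2.1) := by fun_prop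
    filter_upwards [(hcont.tendsto (0, p)).eventually h1] with v hv
    have hv' : H v.1 v.2.1 - H v.1 v.2.2 = 0 ↔ ψ v.2.2 = (v.1, v.2.1) := hv
    rw [← sub_eq_zero, hv']
    constructor
    · intro h; rw [h]; exact ⟨rfl, rfl⟩
    · rintro ⟨e1, e2⟩; exact Prod.ext e1.symm e2.symm
  · filter_upwards [h3] with u hu
    exact sub_eq_zero.mp hu.1
  · filter_upwards [h3, hd1, h3.eventually_nhds] with u hu hdu hnear
    have hpath : HasDerivAt (fun u => ((ψ u).1, (ψ u).2, u))
        (deriv (fun u => (ψ u).1) u, deriv (fun u => (ψ u).2) u, 1) u :=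
      hdu.1.hasDerivAt.prodMk (hdu.2.hasDerivAt.prodMk (hasDerivAt_id u))
    have hcomp := (hFs.differentiable (by simp)
      ((ψ u).1, (ψ u).2, u)).hasFDerivAt.comp_hasDerivAt u hpath
    have hconst : HasDerivAt (F ∘ fun u => ((ψ u).1, (ψ u).2, u)) 0 u := by
      refine (hasDerivAt_const u (0 : ℂ)).congr_of_eventuallyEq ?_
      filter_upwards [hnear] with x hx using hx.1
    have := hcomp.unique hconst
    rw [fderiv_difference hH] at this
    simp only [one_smul] at this
    exact sub_eq_zero.mp this

/-- The cross product of the two branches along the curve of double points. -/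
noncomputable def tangencyCross (H : ℝ → ℝ → ℂ) (τ σ : ℝ → ℝ) (u : ℝ) : ℝ :=
  cross (deriv (H (τ u)) (σ u)) (deriv (H (τ u)) u)

/-- The derivative of `tangencyCross` at a self-tangency. -/
noncomputable def tangencySlope (H : ℝ → ℝ → ℂ) (p : ℝ × ℝ) (l : ℝ) : ℝ :=
  cross (deriv (H 0) p.1) (deriv (deriv (H 0)) p.2) -
    l ^ 2 * cross (deriv (H 0) p.1) (deriv (deriv (H 0)) p.1)

theorem exists_smul_of_cross_eq_zero {u v : ℂ} (hu : u ≠ 0) (h : cross u v = 0) :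
    ∃ l : ℝ, v = l • u := by
  refine ⟨(u.re * v.re + u.im * v.im) / (u.re ^ 2 + u.im ^ 2), ?_⟩
  have hpos : u.re ^ 2 + u.im ^ 2 ≠ 0 := by
    intro h0
    refine hu (Complex.ext ?_ ?_) <;> simp <;> nlinarith [sq_nonneg u.re, sq_nonneg u.im]
  unfold cross at h
  apply Complex.ext
  · rw [Complex.smul_re, smul_eq_mul]
    field_simp
    linear_combination (-u.im) * h
  · rw [Complex.smul_im, smul_eq_mul]
    field_simp
    linear_combination u.re * h

/-- Taking the cross product of `deriv_eq` with the common tangent direction kills all but the `τ'`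
term, so the time is stationary and `σ' = l`. To first order only the accelerations then turn the
two tangents, which produces `tangencySlope`. -/
theorem IsTangencyCurve.hasDerivAt_cross {p : ℝ × ℝ} {τ σ : ℝ → ℝ}
    (h : IsTangencyCurve H p τ σ) (hH : ContDiff ℝ ∞ (fun q : ℝ × ℝ => H q.1 q.2))
    (hspeed : cross (deriv (H 0) p.1) (motion H p.2 - motion H p.1) ≠ 0)
    (hd : deriv (H 0) p.1 ≠ 0) {l : ℝ}
    (hl : deriv (H 0) p.2 = l • deriv (H 0) p.1) :
    deriv σ p.2 = l ∧ HasDerivAt (tangencyCross H τ σ) (tangencySlope H p l) p.2 := by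
  have hde := h.deriv_eq.self_of_nhds
  have hdiff := h.differentiable.self_of_nhds
  rw [h.tau_apply, h.sigma_apply] at hde
  have hτ : deriv τ p.2 = 0 := by
    have hc := congrArg (cross (deriv (H 0) p.1)) hde
    rw [hl, cross_add_right, cross_smul_right, cross_smul_right, cross_smul_right, cross_self,
      mul_zero, mul_zero, add_zero] at hc
    refine (mul_eq_zero.mp hc).resolve_right fun h0 => hspeed ?_
    rw [← neg_sub, cross_neg_right]
    exact neg_eq_zero.mpr h0
  have hσ : deriv σ p.2 = l := by
    rw [hτ, zero_smul, zero_add, hl] at hde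
    exact smul_left_injective ℝ hd hde
  refine ⟨hσ, ?_⟩
  have hG : ContDiff ℝ ∞ (fun q : ℝ × ℝ => (fun t => deriv (H t)) q.1 q.2) := contDiff_deriv_snd hH
  have hτd := hdiff.1.hasDerivAt
  have hσd := hdiff.2.hasDerivAt
  rw [hτ] at hτd
  rw [hσ] at hσd
  have hGd := fun q : ℝ × ℝ => (hG.differentiable (by simp) q).hasFDerivAt
  have k1 : HasDerivAt (fun u => deriv (H (τ u)) (σ u)) (l • deriv (deriv (H 0)) p.1) p.2 := by
    have := (hGd (τ p.2, σ p.2)).comp_hasDerivAt p.2 (hτd.prodMk hσd)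
    rw [fderiv_family_apply (H := fun t => deriv (H t)) hG, zero_smul, zero_add, h.tau_apply, h.sigma_apply] at this
    exact this
  have k2 : HasDerivAt (fun u => deriv (H (τ u)) u) (deriv (deriv (H 0)) p.2) p.2 := by
    have hpath : HasDerivAt (fun u => (τ u, u)) (0, 1) p.2 := hτd.prodMk (hasDerivAt_id p.2)
    have := HasFDerivAt.comp_hasDerivAt (f := fun u => (τ u, u)) p.2 (hGd (τ p.2, p.2)) hpath
    rw [fderiv_family_apply (H := fun t => deriv (H t)) hG, zero_smul, zero_add, h.tau_apply, one_smul] at this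
    exact this
  have re : ∀ {f : ℝ → ℂ} {f' : ℂ} {x : ℝ}, HasDerivAt f f' x →
      HasDerivAt (fun u => (f u).re) f'.re x := fun hf =>
    Complex.reCLM.hasFDerivAt.comp_hasDerivAt _ hf
  have im : ∀ {f : ℝ → ℂ} {f' : ℂ} {x : ℝ}, HasDerivAt f f' x →
      HasDerivAt (fun u => (f u).im) f'.im x := fun hf =>
    Complex.imCLM.hasFDerivAt.comp_hasDerivAt _ hf
  have := ((re k1).fun_mul (im k2)).fun_sub ((im k1).fun_mul (re k2))
  refine this.congr_deriv ?_
  simp only [h.tau_apply, h.sigma_apply, hl, tangencySlope, cross, Complex.real_smul,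
    Complex.mul_re, Complex.mul_im, Complex.ofReal_re, Complex.ofReal_im]
  ring

/-- The normal form of a self-tangency: two double points `a` and `b` at the times `κ t`, `0 < t`,
and none at the other times. -/
theorem exists_tangency_branches (hH : ContDiff ℝ ∞ (fun q : ℝ × ℝ => H q.1 q.2)) {p : ℝ × ℝ}
    (hp : H 0 p.1 = H 0 p.2)
    (hspeed : cross (deriv (H 0) p.1) (motion H p.2 - motion H p.1) ≠ 0)
    (hd : deriv (H 0) p.1 ≠ 0) {l : ℝ} (hl0 : l ≠ 0)
    (hl : deriv (H 0) p.2 = l • deriv (H 0) p.1) (hslope : tangencySlope H p l ≠ 0) :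
    ∃ (κ : ℝ) (a b : ℝ → ℝ × ℝ), (κ = 1 ∨ κ = -1) ∧
      Tendsto a (𝓝[>] 0) (𝓝 p) ∧ Tendsto b (𝓝[>] 0) (𝓝 p) ∧
      (∀ᶠ t in 𝓝[>] (0 : ℝ), H (κ * t) (a t).1 = H (κ * t) (a t).2 ∧
        H (κ * t) (b t).1 = H (κ * t) (b t).2 ∧ (a t).2 < (b t).2 ∧
        (0 < l → (a t).1 < (b t).1) ∧ (l < 0 → (b t).1 < (a t).1) ∧
        doubleSign (H (κ * t)) (a t) * doubleSign (H (κ * t)) (b t) = -1) ∧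
      ∀ᶠ v : ℝ × ℝ × ℝ in 𝓝 (0, p), H v.1 v.2.1 = H v.1 v.2.2 → v.1 ≠ 0 →
        0 < κ * v.1 ∧ (v.2 = a (κ * v.1) ∨ v.2 = b (κ * v.1)) := by
  obtain ⟨τ, σ, h⟩ := exists_isTangencyCurve hH hp hspeed
  obtain ⟨hσ, hC⟩ := h.hasDerivAt_cross hH hspeed hd hl
  have hC0 : tangencyCross H τ σ p.2 = 0 := by
    rw [tangencyCross, h.tau_apply, h.sigma_apply, hl, cross_smul_right, cross_self, mul_zero]
  set c' := tangencySlope H p l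
  set C := tangencyCross H τ σ with hCdef
  -- Taking the cross product of `deriv_eq` with the first velocity gives `τ' * W = C`. Here `W`
  -- does not vanish at `p.2` and `C` has a simple zero there, so `τ'` changes sign: time has a
  -- fold.
  set W : ℝ → ℝ := fun u => cross (deriv (H (τ u)) (σ u))
    (deriv (fun t => H t (σ u)) (τ u) - deriv (fun t => H t u) (τ u)) with hW
  have hdiff := h.differentiable.self_of_nhds
  have hw0 : W p.2 ≠ 0 := by
    intro h0
    apply hspeed
    simp only [hW, h.tau_apply, h.sigma_apply] at h0
    rw [← neg_sub, cross_neg_right]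
    exact neg_eq_zero.mpr h0
  have hWc : ContinuousAt W p.2 := by
    have e1 := (contDiff_deriv_snd hH).continuous
    have e2 := (contDiff_deriv_fst hH).continuous
    have m1 : ContinuousAt (fun u => (τ u, σ u)) p.2 := hdiff.1.continuousAt.prodMk hdiff.2.continuousAt
    have m2 : ContinuousAt (fun u => (τ u, u)) p.2 := hdiff.1.continuousAt.prodMk continuousAt_id
    exact continuousAt_cross (e1.continuousAt.comp m1) ((e2.continuousAt.comp m1).sub
      (e2.continuousAt.comp m2))
  -- `κ` is the direction of time in which the double points exist, that is, for which `κ * τ` has a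
  -- minimum at the fold.
  obtain ⟨κ, hκ, hκpos⟩ : ∃ κ : ℝ, (κ = 1 ∨ κ = -1) ∧ 0 < κ * c' * W p.2 := by
    rcases lt_or_gt_of_ne (mul_ne_zero hslope hw0) with h | h
    · exact ⟨-1, Or.inr rfl, by linarith⟩
    · exact ⟨1, Or.inl rfl, by linarith⟩
  have hκκ : κ * κ = 1 := by rcases hκ with rfl | rfl <;> norm_num
  -- the sign of the derivative of `τ`
  have hCs : ∀ᶠ u in 𝓝 p.2, (p.2 < u → 0 < c' * C u) ∧ (u < p.2 → c' * C u < 0) := by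
    have := eventually_lt_of_deriv_pos (hC.const_mul c') (mul_self_pos.mpr hslope)
    simpa only [hC0, mul_zero] using this
  have hWs : ∀ᶠ u in 𝓝 p.2, 0 < κ * c' * W u :=
    (hWc.const_mul (κ * c')).eventually (lt_mem_nhds hκpos)
  have hτ' : ∀ᶠ u in 𝓝 p.2, deriv τ u * W u = C u := by
    filter_upwards [h.deriv_eq] with u hu
    rw [hCdef, tangencyCross, ← hu, cross_add_right, cross_smul_right, cross_smul_right, cross_self]
    ring
  have hmono : ∀ᶠ u in 𝓝 p.2, (p.2 < u → 0 < κ * deriv τ u) ∧ (u < p.2 → κ * deriv τ u < 0) := by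
    filter_upwards [hCs, hWs, hτ'] with u h1 h2 h3
    have h4 : (κ * deriv τ u) * (κ * c' * W u) = c' * C u := by
      rw [← h3]; linear_combination (c' * deriv τ u * W u) * hκκ
    constructor
    · intro hu
      exact (mul_pos_iff_of_pos_right h2).mp (h4 ▸ h1.1 hu)
    · intro hu
      have := h1.2 hu
      rw [← h4] at this
      exact neg_of_mul_neg_left this h2.le
  have hσs : ∀ᶠ u in 𝓝 p.2, (p.2 < u → 0 < l * (σ u - p.1)) ∧ (u < p.2 → l * (σ u - p.1) < 0) := by
    have hσd : HasDerivAt (fun u => l * (σ u - p.1)) (l * l) p.2 :=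
      (hσ ▸ hdiff.2.hasDerivAt.sub_const _).const_mul l
    have := eventually_lt_of_deriv_pos hσd (mul_self_pos.mpr hl0)
    simpa only [h.sigma_apply, sub_self, mul_zero] using this
  obtain ⟨ε, hε, hball⟩ := Metric.eventually_nhds_iff.mp (hmono.and h.differentiable)
  set δ := ε / 2 with hδdef
  have hδ : 0 < δ := by positivity
  have hin : ∀ u, p.2 - δ ≤ u → u ≤ p.2 + δ → dist u p.2 < ε := fun u h1 h2 => by
    rw [Real.dist_eq, abs_lt]; constructor <;> linarith
  set g : ℝ → ℝ := fun u => κ * τ u with hg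
  have hg0 : g p.2 = 0 := by simp only [hg, h.tau_apply, mul_zero]
  have hgd : ∀ u, dist u p.2 < ε → HasDerivAt g (κ * deriv τ u) u := fun u hu =>
    (hball hu).2.1.hasDerivAt.const_mul κ
  have hgcR : ContinuousOn g (Icc p.2 (p.2 + δ)) := fun u hu =>
    (hgd u (hin u (by linarith [hu.1]) hu.2)).continuousAt.continuousWithinAt
  have hgcL : ContinuousOn g (Icc (p.2 - δ) p.2) := fun u hu =>
    (hgd u (hin u hu.1 (by linarith [hu.2]))).continuousAt.continuousWithinAt
  have hgR : StrictMonoOn g (Icc p.2 (p.2 + δ)) := by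
    refine strictMonoOn_of_deriv_pos (convex_Icc _ _) hgcR fun u hu => ?_
    rw [interior_Icc] at hu
    have hu' := hin u (by linarith [hu.1]) hu.2.le
    rw [(hgd u hu').deriv]
    exact (hball hu').1.1 hu.1
  have hgL : StrictAntiOn g (Icc (p.2 - δ) p.2) := by
    refine strictAntiOn_of_deriv_neg (convex_Icc _ _) hgcL fun u hu => ?_
    rw [interior_Icc] at hu
    have hu' := hin u hu.1.le (by linarith [hu.2])
    rw [(hgd u hu').deriv]
    exact (hball hu').1.2 hu.2
  obtain ⟨i, i1, i2, i3⟩ := exists_right_inverse hδ hg0 hgcR hgR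
  obtain ⟨j, j1, j2, j3⟩ := exists_left_inverse hδ hg0 hgcL hgL
  have i1' : Tendsto i (𝓝[>] 0) (𝓝 p.2) := i1.mono_right nhdsWithin_le_nhds
  have j1' : Tendsto j (𝓝[>] 0) (𝓝 p.2) := j1.mono_right nhdsWithin_le_nhds
  have hσc : Tendsto σ (𝓝 p.2) (𝓝 p.1) := by
    have := hdiff.2.continuousAt.tendsto
    rwa [h.sigma_apply] at this
  refine ⟨κ, fun t => (σ (j t), j t), fun t => (σ (i t), i t), hκ,
    (hσc.comp j1').prodMk_nhds j1', (hσc.comp i1').prodMk_nhds i1', ?_, ?_⟩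
  · filter_upwards [i2, j2, i1'.eventually h.eventually_eq, j1'.eventually h.eventually_eq,
      i1.eventually self_mem_nhdsWithin, j1.eventually self_mem_nhdsWithin,
      i1'.eventually hσs, j1'.eventually hσs, i1'.eventually hCs, j1'.eventually hCs]
      with t ei ej qi qj (ri : p.2 < i t) (rj : j t < p.2) si sj ci cj
    have ti : τ (i t) = κ * t := by
      have e : κ * τ (i t) = t := ei
      linear_combination κ * e - τ (i t) * hκκ
    have tj : τ (j t) = κ * t := by
      have e : κ * τ (j t) = t := ej
      linear_combination κ * e - τ (j t) * hκκ
    have si := si.1 ri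
    have sj := sj.2 rj
    have ci := ci.1 ri
    have cj := cj.2 rj
    rw [ti] at qi
    rw [tj] at qj
    refine ⟨qj, qi, rj.trans ri, fun hl => ?_, fun hl => ?_, ?_⟩
    · nlinarith
    · nlinarith
    · have e1 : doubleSign (H (κ * t)) (σ (j t), j t) = Real.sign (C (j t)) := by
        rw [hCdef, tangencyCross, tj]; rfl
      have e2 : doubleSign (H (κ * t)) (σ (i t), i t) = Real.sign (C (i t)) := by
        rw [hCdef, tangencyCross, ti]; rfl
      rw [e1, e2]
      rcases lt_or_gt_of_ne hslope with hc | hc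
      · rw [Real.sign_of_pos (by nlinarith), Real.sign_of_neg (by nlinarith)]; norm_num
      · rw [Real.sign_of_neg (by nlinarith), Real.sign_of_pos (by nlinarith)]; norm_num
  · have hnear : ∀ᶠ v : ℝ × ℝ × ℝ in 𝓝 (0, p), v.2.2 ∈ Ioo (p.2 - δ) (p.2 + δ) := by
      have hc : Continuous fun v : ℝ × ℝ × ℝ => v.2.2 := by fun_prop
      exact (hc.tendsto (0, p)).eventually (Ioo_mem_nhds (by simpa using hδ) (by simpa using hδ))
    filter_upwards [h.eventually_iff, hnear] with v hv hvn heq hv0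
    obtain ⟨e1, e2⟩ := hv.mp heq
    have hκv : κ * v.1 = g v.2.2 := by rw [e1]
    rw [hκv]
    rcases lt_trichotomy v.2.2 p.2 with hlt | he | hgt
    · have hm : v.2.2 ∈ Icc (p.2 - δ) p.2 := ⟨hvn.1.le, hlt.le⟩
      refine ⟨hg0 ▸ hgL hm ⟨by linarith, le_rfl⟩ hlt, Or.inl ?_⟩
      rw [j3 _ hm]
      exact Prod.ext e2 rfl
    · exact absurd (by rw [e1, he, h.tau_apply]) hv0
    · have hm : v.2.2 ∈ Icc p.2 (p.2 + δ) := ⟨hgt.le, hvn.2.le⟩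
      refine ⟨hg0 ▸ hgR ⟨le_rfl, by linarith⟩ hm hgt, Or.inr ?_⟩
      rw [i3 _ hm]
      exact Prod.ext e2 rfl

/-! ### Pair sums across a self-tangency -/

theorem chordSum_image {ι κ : Type*} [DecidableEq κ] {C : Finset ι} {f : ι → κ}
    (hf : InjOn f C) (e : κ → ℝ) (R : κ → κ → Prop) :
    chordSum (C.image f) e R = chordSum C (fun c => e (f c)) (fun c d => R (f c) (f d)) := by
  unfold chordSum
  rw [Finset.sum_image hf]
  exact Finset.sum_congr rfl fun c _ => Finset.sum_image hf

open Classical in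
/-- The sums over pairs after the creation of two chords which have opposite signs and are
equally situated with respect to all other chords. -/
theorem chordSum_insert_pair {ι : Type*} [DecidableEq ι] {C : Finset ι} {a b : ι} (ha : a ∉ C)
    (hb : b ∉ C) (hab : a ≠ b) {e : ι → ℝ} (he : e a = -e b) (he' : e a * e b = -1)
    {R : ι → ι → Prop} (hRa : ¬ R a a) (hRb : ¬ R b b)
    (hR : ∀ d ∈ C, (R a d ↔ R b d) ∧ (R d a ↔ R d b)) :
    chordSum (insert a (insert b C)) e R = chordSum C e R -
      ((if R a b then 1 else 0) + (if R b a then 1 else 0)) := by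
  rw [chordSum_insert (by simp [ha, hab]) _ hRa, chordSum_insert hb _ hRb, Finset.sum_insert hb,
    he']
  have : ∑ d ∈ C, ((if R a d then e a * e d else 0) + (if R d a then e a * e d else 0)) =
      -∑ d ∈ C, ((if R b d then e b * e d else 0) + (if R d b then e b * e d else 0)) := by
    rw [← Finset.sum_neg_distrib]
    refine Finset.sum_congr rfl fun d hd => ?_
    simp only [(hR d hd).1, (hR d hd).2, he]
    split_ifs <;> ring
  rw [this]
  split_ifs <;> ring

theorem SameOrder.symm {c d c' d' : ℝ × ℝ} (h : SameOrder c d c' d') : SameOrder d c d' c' := by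
  obtain ⟨h1, h2, h3, h4, h5, h6, h7, h8⟩ := h
  exact ⟨h5, h6, h7, h8, h1, h2, h3, h4⟩

theorem IsTracking.eventually_sameOrder {t₀ : ℝ} {A : Set (ℝ × ℝ)} {ψ : ℝ × ℝ → ℝ → ℝ × ℝ}
    (hψ : IsTracking H t₀ A ψ) (hfin : A.Finite) (hA : A ⊆ doublePairs (H t₀))
    (hn : ∀ s t u, ¬ IsTriplePassage (H t₀) s t u) :
    ∀ᶠ t in 𝓝 t₀, ∀ c ∈ A, ∀ d ∈ A, SameOrder c d (ψ c t) (ψ d t) := by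
  refine (eventually_all_finite hfin).mpr fun c hc =>
    (eventually_all_finite hfin).mpr fun d hd => ?_
  by_cases hcd : c = d
  · subst hcd
    filter_upwards [hψ.eventually_mem c hc] with t ht
    have h1 := (hA hc).2.1
    have h2 := ht.2.1
    simp [SameOrder, h1, h2, h1.not_gt, h2.not_gt]
  · exact PlaneCurves.eventually_sameOrder (hψ.tendsto hc) (hψ.tendsto hd)
      (fun e => hcd (doublePairs_fst_injOn hn (hA hc) (hA hd) e))
      (doublePairs_fst_ne_snd hn (hA hc) (hA hd)) (doublePairs_fst_ne_snd hn (hA hd) (hA hc)).symm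
      (fun e => hcd (doublePairs_snd_injOn hn (hA hc) (hA hd) e))

/-- The effect of a self-tangency on the sums over pairs of double points, when the base point is
not a double point at time `0`. -/
theorem IsSelfTangency.exists_change {p : ℝ × ℝ} (h : IsSelfTangency H p)
    (hbase : ∀ q ∈ doublePairs (H 0), 0 < q.1) :
    ∃ κ : ℝ, (κ = 1 ∨ κ = -1) ∧ ∀ᶠ t in 𝓝[>] (0 : ℝ),
      doubleCount (H (κ * t)) = doubleCount (H (-(κ * t))) + 2 ∧
      (IsDirect H p → sepSubNest (H (κ * t)) = sepSubNest (H (-(κ * t))) ∧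
        interSum (H (κ * t)) = interSum (H (-(κ * t))) - 1) ∧
      (IsInverse H p → sepSubNest (H (κ * t)) = sepSubNest (H (-(κ * t))) + 1 ∧
        interSum (H (κ * t)) = interSum (H (-(κ * t)))) := by
  classical
  have hH := h.smooth
  have h0I : (0 : ℝ) ∈ Icc (-1 : ℝ) 1 := by simp
  have hd : deriv (H 0) p.1 ≠ 0 := (h.curve 0 h0I).immersed _
  have hd2 : deriv (H 0) p.2 ≠ 0 := (h.curve 0 h0I).immersed _
  obtain ⟨l, hl⟩ := exists_smul_of_cross_eq_zero hd h.tangent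
  have hl0 : l ≠ 0 := by rintro rfl; exact hd2 (by rw [hl, zero_smul])
  have hnorm : 0 < ‖deriv (H 0) p.1‖ := norm_pos_iff.mpr hd
  -- The two squared speeds differ by the factor `l ^ 2`; the assumption that the curvatures differ
  -- is exactly that the slope is nonzero.
  have hslope : tangencySlope H p l ≠ 0 := by
    intro h0
    apply h.curvature
    rw [hl, norm_smul, mul_pow, Real.norm_eq_abs, sq_abs]
    unfold tangencySlope at h0
    field_simp
    linarith
  obtain ⟨κ, a, b, hκ, ha, hb, hab, hloc⟩ :=
    exists_tangency_branches hH h.mem.2.2.2 h.speed hd hl0 hl hslope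
  refine ⟨κ, hκ, ?_⟩
  set A := doublePairs (H 0) \ {p} with hA
  have hAsub : A ⊆ doublePairs (H 0) := sdiff_subset
  have hAfin : A.Finite := h.finite.subset hAsub
  obtain ⟨ψ, hψ⟩ := exists_isTracking hH hAsub (fun q hq => hbase q (hAsub hq))
    (fun q hq => h.transverse q hq.1 hq.2)
  set C := hAfin.toFinset with hC
  have hCA : ∀ q, q ∈ C ↔ q ∈ A := fun q => hAfin.mem_toFinset
  -- At nonzero times near `0` every double point is either a tracked transverse one or one of the
  -- two branches of the fold, the latter only on the side of time given by `κ`.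
  have hcov : ∀ᶠ t in 𝓝 (0 : ℝ), ∀ q ∈ doublePairs (H t), t ≠ 0 →
      q ∈ (fun q => ψ q t) '' A ∨ 0 < κ * t ∧ (q = a (κ * t) ∨ q = b (κ * t)) := by
    have := eventually_forall_doublePairs hH h0I h.curve hbase (P := fun t q => t ≠ 0 →
      q ∈ (fun q => ψ q t) '' A ∨ 0 < κ * t ∧ (q = a (κ * t) ∨ q = b (κ * t))) (fun q hq => by
        by_cases hqp : q = p
        · subst hqp
          filter_upwards [hloc] with v hv heq hv0
          exact Or.inr (hv heq hv0)
        · filter_upwards [hψ.eventually_unique q ⟨hq, hqp⟩] with v hv heq _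
          exact Or.inl ⟨q, ⟨hq, hqp⟩, (hv heq).symm⟩)
    rwa [nhdsWithin_eq_nhds.mpr (Icc_mem_nhds (by norm_num) (by norm_num))] at this
  have hsame := hψ.eventually_sameOrder hAfin hAsub h.no_triple
  have hmaps := hψ.eventually_mapsTo hAfin
  have hinj := hψ.eventually_injOn hAfin
  have hsign : ∀ᶠ t in 𝓝 (0 : ℝ), ∀ c ∈ A, doubleSign (H t) (ψ c t) = doubleSign (H 0) c :=
    (eventually_all_finite hAfin).mpr hψ.eventually_sign
  have hκ0 : κ ≠ 0 := by rcases hκ with rfl | rfl <;> norm_num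
  have hκκ : κ * κ = 1 := by rcases hκ with rfl | rfl <;> norm_num
  have hlim : Tendsto (fun t => κ * t) (𝓝[>] 0) (𝓝 0) := by
    have : Continuous fun t : ℝ => κ * t := by fun_prop
    have := this.tendsto 0
    rw [mul_zero] at this
    exact this.mono_left nhdsWithin_le_nhds
  have hlim' : Tendsto (fun t => -(κ * t)) (𝓝[>] 0) (𝓝 0) := by simpa using hlim.neg
  -- chords near `p` are situated with respect to the other chords as `p`
  have hord : ∀ x : ℝ → ℝ × ℝ, Tendsto x (𝓝[>] 0) (𝓝 p) → ∀ᶠ t in 𝓝[>] (0 : ℝ), ∀ d ∈ A,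
      SameOrder p d (x t) (ψ d (κ * t)) ∧ x t ≠ ψ d (κ * t) := by
    intro x hx
    refine (eventually_all_finite hAfin).mpr fun d hd => ?_
    have hψd := (hψ.tendsto hd).comp hlim
    have hn := h.no_triple
    refine (eventually_sameOrder hx hψd
      (fun e => hd.2 (doublePairs_fst_injOn hn h.mem hd.1 e).symm)
      (doublePairs_fst_ne_snd hn h.mem hd.1) (doublePairs_fst_ne_snd hn hd.1 h.mem).symm
      (fun e => hd.2 (doublePairs_snd_injOn hn h.mem hd.1 e).symm)).and ?_
    exact (hx.prodMk_nhds hψd).eventually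
      ((isOpen_ne_fun continuous_fst continuous_snd).mem_nhds (Ne.symm hd.2))
  have hpos : ∀ x : ℝ → ℝ × ℝ, Tendsto x (𝓝[>] 0) (𝓝 p) → ∀ᶠ t in 𝓝[>] (0 : ℝ),
      0 ≤ (x t).1 ∧ (x t).1 < (x t).2 ∧ (x t).2 < 2 * Real.pi := by
    intro x hx
    filter_upwards [hx.fst_nhds.eventually_const_lt (hbase p h.mem),
      hx.fst_nhds.eventually_lt hx.snd_nhds h.mem.2.1,
      hx.snd_nhds.eventually_lt_const h.mem.2.2.1] with t e1 e2 e3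
    exact ⟨e1.le, e2, e3⟩
  have hcl : ∀ᶠ t in 𝓝[>] (0 : ℝ), (b t).1 < (a t).2 :=
    hb.fst_nhds.eventually_lt ha.snd_nhds h.mem.2.1
  have hfixed : ∀ θ, InjOn (fun q => ψ q θ) A → (∀ c ∈ A, ∀ d ∈ A, SameOrder c d (ψ c θ) (ψ d θ)) →
      (∀ c ∈ A, doubleSign (H θ) (ψ c θ) = doubleSign (H 0) c) →
      ∀ R : ℝ × ℝ → ℝ × ℝ → Prop, (∀ c d c' d', SameOrder c d c' d' → (R c d ↔ R c' d')) →
      chordSum (C.image fun q => ψ q θ) (doubleSign (H θ)) R = chordSum C (doubleSign (H 0)) R := by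
    intro θ k1 k2 k3 R hR
    rw [chordSum_image (by simpa only [hC, hAfin.coe_toFinset] using k1)]
    exact chordSum_congr (fun c hc => k3 c ((hCA c).mp hc)) fun c hc d hd =>
      (hR _ _ _ _ (k2 c ((hCA c).mp hc) d ((hCA d).mp hd))).symm
  have hRS : ∀ c d c' d', SameOrder c d c' d' → (Separated c d ↔ Separated c' d') :=
    fun _ _ _ _ h => h.separated
  have hRN : ∀ c d c' d', SameOrder c d c' d' → (Nested c d ↔ Nested c' d') :=
    fun _ _ _ _ h => h.nested
  have hRI : ∀ c d c' d', SameOrder c d c' d' → (Interleaved c d ↔ Interleaved c' d') :=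
    fun _ _ _ _ h => h.interleaved
  filter_upwards [hlim.eventually hcov, hlim'.eventually hcov, hlim.eventually hsame,
    hlim'.eventually hsame, hlim.eventually hmaps, hlim'.eventually hmaps, hlim.eventually hinj,
    hlim'.eventually hinj, hlim.eventually hsign, hlim'.eventually hsign, hord a ha, hord b hb,
    hpos a ha, hpos b hb, hab, hcl, self_mem_nhdsWithin]
    with t c1 c2 s1 s2 m1 m2 i1 i2 g1 g2 oa ob pa pb hab hcl (ht : 0 < t)
  obtain ⟨qa, qb, hab2, hdir, hinv, hsgn⟩ := hab
  have hθ : κ * t ≠ 0 := mul_ne_zero hκ0 ht.ne'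
  have e1 : κ * (κ * t) = t := by rw [← mul_assoc, hκκ, one_mul]
  have e2 : κ * -(κ * t) = -t := by rw [mul_neg, e1]
  rw [e1] at c1
  rw [e2] at c2
  have ma : a t ∈ doublePairs (H (κ * t)) := ⟨pa.1, pa.2.1, pa.2.2, qa⟩
  have mb : b t ∈ doublePairs (H (κ * t)) := ⟨pb.1, pb.2.1, pb.2.2, qb⟩
  set D := C.image fun q => ψ q (κ * t) with hD
  set D' := C.image fun q => ψ q (-(κ * t)) with hD'
  have naD : a t ∉ D := by
    rw [hD, Finset.mem_image]
    rintro ⟨d, hd, he⟩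
    exact (oa d ((hCA d).mp hd)).2 he.symm
  have nbD : b t ∉ D := by
    rw [hD, Finset.mem_image]
    rintro ⟨d, hd, he⟩
    exact (ob d ((hCA d).mp hd)).2 he.symm
  have nab : a t ≠ b t := fun he => hab2.ne (by rw [he])
  have hset : BijOn id ((insert (a t) (insert (b t) D) : Finset (ℝ × ℝ)) : Set (ℝ × ℝ))
      (doublePairs (H (κ * t))) := by
    convert bijOn_id _
    ext q
    simp only [Finset.coe_insert, mem_insert_iff, Finset.mem_coe]
    constructor
    · intro hq
      rcases c1 q hq hθ with ⟨q', hq', rfl⟩ | ⟨-, hq' | hq'⟩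
      · exact Or.inr (Or.inr (Finset.mem_image_of_mem _ ((hCA q').mpr hq')))
      · exact Or.inl hq'
      · exact Or.inr (Or.inl hq')
    · rintro (rfl | rfl | hq)
      · exact ma
      · exact mb
      · obtain ⟨q', hq', rfl⟩ := Finset.mem_image.mp hq
        exact m1 ((hCA q').mp hq')
  have hset' : BijOn id (D' : Set (ℝ × ℝ)) (doublePairs (H (-(κ * t)))) := by
    convert bijOn_id _
    ext q
    simp only [Finset.mem_coe]
    constructor
    · intro hq
      rcases c2 q hq (neg_ne_zero.mpr hθ) with ⟨q', hq', rfl⟩ | ⟨hneg, -⟩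
      · exact Finset.mem_image_of_mem _ ((hCA q').mpr hq')
      · linarith
    · intro hq
      obtain ⟨q', hq', rfl⟩ := Finset.mem_image.mp hq
      exact m2 ((hCA q').mp hq')
  have hcard : D.card = C.card := Finset.card_image_of_injOn (by
    simpa only [hC, hAfin.coe_toFinset] using i1)
  have hcard' : D'.card = C.card := Finset.card_image_of_injOn (by
    simpa only [hC, hAfin.coe_toFinset] using i2)
  -- Two values of `Real.sign` whose product is `-1` are opposite.
  have hεab : doubleSign (H (κ * t)) (a t) = -doubleSign (H (κ * t)) (b t) := by
    have hx := Real.sign_apply_eq (cross (deriv (H (κ * t)) (a t).1) (deriv (H (κ * t)) (a t).2))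
    have hy := Real.sign_apply_eq (cross (deriv (H (κ * t)) (b t).1) (deriv (H (κ * t)) (b t).2))
    unfold doubleSign at hsgn ⊢
    rcases hx with hx | hx | hx <;> rcases hy with hy | hy | hy <;> rw [hx, hy] at hsgn ⊢ <;>
      first | (exfalso; norm_num at hsgn; done) | norm_num
  have hsum : ∀ R : ℝ × ℝ → ℝ × ℝ → Prop,
      (∀ c d c' d', SameOrder c d c' d' → (R c d ↔ R c' d')) → ¬ R (a t) (a t) → ¬ R (b t) (b t) →
      pairSum (H (κ * t)) (doubleSign (H (κ * t))) R = chordSum C (doubleSign (H 0)) R -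
        ((if R (a t) (b t) then 1 else 0) + (if R (b t) (a t) then 1 else 0)) := by
    intro R hR ka kb
    rw [pairSum_eq_chordSum hset]
    simp only [id]
    rw [chordSum_insert_pair naD nbD nab hεab hsgn ka kb, hfixed _ i1 s1 g1 R hR]
    intro d hd
    obtain ⟨d', hd', rfl⟩ := Finset.mem_image.mp hd
    have k1 := (oa d' ((hCA d').mp hd')).1
    have k2 := (ob d' ((hCA d').mp hd')).1
    exact ⟨(hR _ _ _ _ k1).symm.trans (hR _ _ _ _ k2),
      (hR _ _ _ _ k1.symm).symm.trans (hR _ _ _ _ k2.symm)⟩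
  have hsum' : ∀ R : ℝ × ℝ → ℝ × ℝ → Prop,
      (∀ c d c' d', SameOrder c d c' d' → (R c d ↔ R c' d')) →
      pairSum (H (-(κ * t))) (doubleSign (H (-(κ * t)))) R = chordSum C (doubleSign (H 0)) R := by
    intro R hR
    rw [pairSum_eq_chordSum hset']
    simp only [id]
    exact hfixed _ i2 s2 g2 R hR
  have nS : ∀ c d : ℝ × ℝ, d.1 < c.2 → ¬ Separated c d := fun c d h h' => h'.not_gt h
  have nN : ∀ c : ℝ × ℝ, ¬ Nested c c := fun c h => lt_irrefl _ h.1
  have nI : ∀ c : ℝ × ℝ, ¬ Interleaved c c := fun c h => lt_irrefl _ h.1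
  have haa := nS _ _ pa.2.1
  have hbb := nS _ _ pb.2.1
  have hsab := nS (a t) (b t) hcl
  have hsba := nS (b t) (a t) (pa.2.1.trans hab2)
  have hnab : ¬ Nested (a t) (b t) := fun h => h.2.not_gt hab2
  have hiba : ¬ Interleaved (b t) (a t) := fun h => h.2.2.not_gt hab2
  refine ⟨?_, fun hD => ?_, fun hI => ?_⟩
  · rw [doubleCount_eq_card hset, doubleCount_eq_card hset', Finset.card_insert_of_notMem
      (by simp [nab, naD]), Finset.card_insert_of_notMem nbD, hcard, hcard']
  -- In the direct case both passages move in the same order along the fold, so the new endpoints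
  -- occur as `a b a b`; the product `-1` of the signs enters `S₃`.
  · have hlpos : 0 < l := by
      unfold IsDirect at hD
      rw [hl, real_inner_smul_right] at hD
      exact (mul_pos_iff_of_pos_right (real_inner_self_pos.mpr hd)).mp hD
    have h1 := hdir hlpos
    have k1 : ¬ Nested (b t) (a t) := fun h => h.1.not_gt h1
    have k2 : Interleaved (a t) (b t) := ⟨h1, hcl, hab2⟩
    unfold sepSubNest interSum
    rw [hsum _ hRS haa hbb, hsum _ hRN (nN _) (nN _), hsum _ hRI (nI _) (nI _), hsum' _ hRS,
      hsum' _ hRN, hsum' _ hRI]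
    simp [hsab, hsba, hnab, hiba, k1, k2]
  -- In the inverse case the first passages occur in the opposite order, `b a a b`; the product `-1`
  -- enters `S₂`, so `S₁ - S₂` grows by `1`.
  · have hlneg : l < 0 := by
      unfold IsInverse at hI
      rw [hl, real_inner_smul_right] at hI
      exact neg_of_mul_neg_left hI (real_inner_self_pos.mpr hd).le
    have h1 := hinv hlneg
    have k1 : Nested (b t) (a t) := ⟨h1, hab2⟩
    have k2 : ¬ Interleaved (a t) (b t) := fun h => h.1.not_gt h1
    unfold sepSubNest interSum
    rw [hsum _ hRS haa hbb, hsum _ hRN (nN _) (nN _), hsum _ hRI (nI _) (nI _), hsum' _ hRS,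
      hsum' _ hRN, hsum' _ hRI]
    simp [hsab, hsba, hnab, hiba, k1, k2]
    ring

end Tangency

end PlaneCurves

namespace PlaneCurves

open Set Filter Topology

/-! ### Jumps of the invariants at a self-tangency -/

section SelfTangency

variable {H : ℝ → ℝ → ℂ}

/-- Reduces the jump from time `-1` to time `1` to curves close to the tangency whose base point is
not double. -/
theorem IsSelfTangency.exists_near {p : ℝ × ℝ} (h : IsSelfTangency H p) (hc : CreatesBigon H) :
    ∃ γ γ' : ℝ → ℂ, arnold (H 1) = arnold γ ∧ arnold (H (-1)) = arnold γ' ∧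
      doubleCount γ = doubleCount γ' + 2 ∧ whitneyIndex γ = whitneyIndex γ' ∧
      (IsDirect H p → sepSubNest γ = sepSubNest γ' ∧ interSum γ = interSum γ' - 1) ∧
      (IsInverse H p → sepSubNest γ = sepSubNest γ' + 1 ∧ interSum γ = interSum γ') := by
  have hper : Function.Periodic (H 0) (2 * Real.pi) := (h.curve 0 (by simp)).periodic
  obtain ⟨η, hη, hb⟩ := exists_base_shift hper h.finite
  have hS := h.shiftBase hb
  obtain ⟨κ, hκ, hev⟩ := hS.exists_change (fun q hq => by
    obtain ⟨q', hq', rfl⟩ := hb.surjOn hq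
    exact add_pos_of_nonneg_of_pos hq'.1 hη)
  have hD : IsDirect (PlaneCurves.shiftBase H η) (p.1 + η, p.2 + η) ↔ IsDirect H p := by
    unfold IsDirect
    rw [deriv_shiftBase]
    simp only [add_sub_cancel_right]
  have hI : IsInverse (PlaneCurves.shiftBase H η) (p.1 + η, p.2 + η) ↔ IsInverse H p := by
    unfold IsInverse
    rw [deriv_shiftBase]
    simp only [add_sub_cancel_right]
  obtain ⟨t, ht, ⟨c1, c2, c3⟩, e1, e2⟩ := exists_arnold_eq_near h.toIsRegularHomotopy h.generic η hev
  have d1 := doubleCount_eq_of_arnold_eq e1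
  have d2 := doubleCount_eq_of_arnold_eq e2
  unfold CreatesBigon at hc
  rcases hκ with rfl | rfl
  · rw [one_mul] at c1 c2 c3
    refine ⟨_, _, e1, e2, c1, whitneyIndex_eq_of_homotopy hS.toIsRegularHomotopy ?_ ?_,
      fun k => c2 (hD.mpr k), fun k => c3 (hI.mpr k)⟩
    · exact ⟨by linarith [ht.1], ht.2⟩
    · exact ⟨by linarith [ht.2], by linarith [ht.1]⟩
  -- With `κ = -1` the bigon would exist at negative times, against the growth of the number of
  -- double points from time `-1` to `1`.
  · rw [neg_one_mul, neg_neg] at c1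
    omega

/-- `J⁺` changes by `-3 * (-1) - 2 / 2 = 2`, hence `J⁻` by `2 - 2 = 0` and `St` by `-1 + 1 = 0`. -/
theorem arnold_direct {p : ℝ × ℝ} (h : IsSelfTangency H p) (hD : IsDirect H p)
    (hc : CreatesBigon H) : Jplus (H 1) = Jplus (H (-1)) + 2 ∧ Jminus (H 1) = Jminus (H (-1)) ∧
      St (H 1) = St (H (-1)) := by
  obtain ⟨γ, γ', e1, e2, hd, hw, hdir, -⟩ := h.exists_near hc
  obtain ⟨a1, a2, a3⟩ := arnold_eq_iff.mp e1
  obtain ⟨b1, b2, b3⟩ := arnold_eq_iff.mp e2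
  obtain ⟨k1, k2⟩ := hdir hD
  have hJ : Jplus γ = Jplus γ' + 2 := by
    rw [Jplus_eq, Jplus_eq, hd, hw, k1, k2]; push_cast; ring
  refine ⟨by rw [a1, b1, hJ], ?_, ?_⟩
  · rw [a2, b2, Jminus_eq, Jminus_eq, hJ, hd]; push_cast; ring
  · rw [a3, b3, St_eq, St_eq, hJ, k2]; ring

/-- `J⁺` changes by `1 - 2 / 2 = 0`, hence `J⁻` by `-2`; `S₃`, and with it `St`, is unchanged. -/
theorem arnold_inverse {p : ℝ × ℝ} (h : IsSelfTangency H p) (hI : IsInverse H p)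
    (hc : CreatesBigon H) : Jplus (H 1) = Jplus (H (-1)) ∧ Jminus (H 1) = Jminus (H (-1)) - 2 ∧
      St (H 1) = St (H (-1)) := by
  obtain ⟨γ, γ', e1, e2, hd, hw, -, hinv⟩ := h.exists_near hc
  obtain ⟨a1, a2, a3⟩ := arnold_eq_iff.mp e1
  obtain ⟨b1, b2, b3⟩ := arnold_eq_iff.mp e2
  obtain ⟨k1, k2⟩ := hinv hI
  have hJ : Jplus γ = Jplus γ' := by
    rw [Jplus_eq, Jplus_eq, hd, hw, k1, k2]; push_cast; ring
  refine ⟨by rw [a1, b1, hJ], ?_, ?_⟩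
  · rw [a2, b2, Jminus_eq, Jminus_eq, hJ, hd]; push_cast; ring
  · rw [a3, b3, St_eq, St_eq, hJ, k2]

end SelfTangency

/-! ### Jumps of the invariants at a triple point -/

section TriplePoint

variable {H : ℝ → ℝ → ℂ}

/-- The cross product of the differentiated coincidence with the velocity of one branch eliminates
the unknown speed along that branch. This is the reason for the formula defining `passage`. -/
theorem IsTracking.hasDerivAt_passage {A : Set (ℝ × ℝ)} {ψ : ℝ × ℝ → ℝ → ℝ × ℝ}
    (h : IsTracking H 0 A ψ) {q : ℝ × ℝ} (hq : q ∈ A) (htr : TransverseAt (H 0) q) :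
    HasDerivAt (fun t => (ψ q t).1) (passage H q.1 q.2) 0 ∧
      HasDerivAt (fun t => (ψ q t).2) (passage H q.2 q.1) 0 := by
  have hd := (h.differentiableAt q hq).hasDerivAt
  have he := h.deriv_eq q hq
  unfold TransverseAt at htr
  constructor
  · refine ((hasFDerivAt_fst (𝕜 := ℝ)).comp_hasDerivAt (0 : ℝ) hd).congr_deriv ?_
    have := congrArg (fun z => cross z (deriv (H 0) q.2)) he
    simp only [cross_add_left, cross_smul_left, cross_self, mul_zero, add_zero] at this
    unfold passage motion
    rw [eq_div_iff htr, cross_sub_left]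
    simp only [ContinuousLinearMap.coe_fst']
    linarith
  · refine ((hasFDerivAt_snd (𝕜 := ℝ)).comp_hasDerivAt (0 : ℝ) hd).congr_deriv ?_
    have := congrArg (fun z => cross z (deriv (H 0) q.1)) he
    simp only [cross_add_left, cross_smul_left, cross_self, mul_zero, add_zero] at this
    unfold passage motion
    rw [eq_div_iff (by rw [cross_swap]; exact neg_ne_zero.mpr htr), cross_sub_left]
    simp only [ContinuousLinearMap.coe_snd']
    linarith

/-- Endpoints that coincide at time `0` are ordered by their speeds afterwards and in the opposite
way before. -/
theorem eventually_lt_iff_of_hasDerivAt {f g : ℝ → ℝ} {f' g' : ℝ} (hf : HasDerivAt f f' 0)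
    (hg : HasDerivAt g g' 0) (h0 : f 0 = g 0) (hne : f' ≠ g') : ∀ᶠ t in 𝓝[>] (0 : ℝ),
      (f t < g t ↔ f' < g') ∧ (g t < f t ↔ g' < f') ∧
      (f (-t) < g (-t) ↔ g' < f') ∧ (g (-t) < f (-t) ↔ f' < g') := by
  have hneg : Tendsto (fun t : ℝ => -t) (𝓝[>] 0) (𝓝 0) := by
    have : Tendsto (fun t : ℝ => -t) (𝓝 0) (𝓝 (-0)) := tendsto_id.neg
    rw [neg_zero] at this
    exact this.mono_left nhdsWithin_le_nhds
  rcases lt_or_gt_of_ne hne with hlt | hlt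
  · have := eventually_lt_of_deriv_pos (hg.sub hf) (sub_pos.mpr hlt)
    filter_upwards [hneg.eventually this, nhdsWithin_le_nhds this, self_mem_nhdsWithin]
      with t h1 h2 (ht : 0 < t)
    have k2 := h2.1 ht
    have k1 := h1.2 (neg_lt_zero.mpr ht)
    simp only [Pi.sub_apply, h0, sub_self, sub_pos, sub_neg] at k1 k2
    simp [k1, k2, k1.not_gt, k2.not_gt, hlt, hlt.not_gt]
  · have := eventually_lt_of_deriv_pos (hf.sub hg) (sub_pos.mpr hlt)
    filter_upwards [hneg.eventually this, nhdsWithin_le_nhds this, self_mem_nhdsWithin]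
      with t h1 h2 (ht : 0 < t)
    have k2 := h2.1 ht
    have k1 := h1.2 (neg_lt_zero.mpr ht)
    simp only [Pi.sub_apply, h0, sub_self, sub_pos, sub_neg] at k1 k2
    simp [k1, k2, k1.not_gt, k2.not_gt, hlt, hlt.not_gt]

/-- The pair sums over the three chords of a triangle, in terms of the order of the endpoints. -/
theorem chordSum_triangle {ι : Type*} [DecidableEq ι] {A B C : ι} (hAB : A ≠ B) (hAC : A ≠ C)
    (hBC : B ≠ C) (e : ι → ℝ) (f : ι → ℝ × ℝ) (h1 : max (f A).1 (f B).1 < min (f A).2 (f C).1)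
    (h2 : max (f A).2 (f C).1 < min (f B).2 (f C).2) :
    chordSum {A, B, C} e (fun c d => Separated (f c) (f d)) -
        chordSum {A, B, C} e (fun c d => Nested (f c) (f d)) =
      (if (f A).2 < (f C).1 then e A * e C else 0) - (if (f B).1 < (f A).1 then e A * e B else 0)
        - (if (f C).2 < (f B).2 then e B * e C else 0) ∧
    chordSum {A, B, C} e (fun c d => Interleaved (f c) (f d)) =
      (if (f A).1 < (f B).1 then e A * e B else 0) + (if (f C).1 < (f A).2 then e A * e C else 0)
        + (if (f B).2 < (f C).2 then e B * e C else 0) := by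
  simp only [max_lt_iff, lt_min_iff] at h1 h2
  obtain ⟨⟨a1, a2⟩, a3, a4⟩ := h1
  obtain ⟨⟨b1, b2⟩, b3, b4⟩ := h2
  have l1 := a1.trans b1
  have l2 := a2.trans b1
  have l3 := a1.trans b3
  have l4 := a2.trans b3
  have m1 : A ∉ ({B, C} : Finset ι) := by simp [hAB, hAC]
  have m2 : B ∉ ({C} : Finset ι) := by simp [hBC]
  unfold chordSum
  simp only [Finset.sum_insert m1, Finset.sum_insert m2, Finset.sum_singleton, Separated, Nested,
    Interleaved, a1, a2, a3, a4, b1, b2, b3, b4, l1, l2, l3, l4, a1.not_gt, a2.not_gt, a3.not_gt,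
    a4.not_gt, b1.not_gt, b2.not_gt, b3.not_gt, b4.not_gt, l1.not_gt, l2.not_gt, l3.not_gt,
    l4.not_gt, lt_irrefl, and_true, true_and, and_false, false_and, if_false]
  constructor
  · by_cases q1 : (f A).2 < (f C).1 <;> by_cases q2 : (f B).1 < (f A).1 <;>
      by_cases q3 : (f C).2 < (f B).2 <;> simp only [q1, q2, q3, if_true, if_false] <;> ring
  · by_cases q1 : (f A).1 < (f B).1 <;> by_cases q2 : (f C).1 < (f A).2 <;>
      by_cases q3 : (f B).2 < (f C).2 <;> simp only [q1, q2, q3, if_true, if_false] <;> ring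

/-- Pairs which are not both in `T` cancel in the difference, so a triple point is seen only by the
pairs among its three chords. -/
theorem chordSum_sub_eq {ι : Type*} {P T : Finset ι} (hT : T ⊆ P) (e : ι → ℝ)
    {R R' : ι → ι → Prop} (hR : ∀ c ∈ P, ∀ d ∈ P, ¬ (c ∈ T ∧ d ∈ T) → (R c d ↔ R' c d)) :
    chordSum P e R - chordSum P e R' = chordSum T e R - chordSum T e R' := by
  classical
  have key : ∀ R : ι → ι → Prop, chordSum P e R = chordSum T e R +
      ∑ c ∈ P, ∑ d ∈ P, if R c d ∧ ¬ (c ∈ T ∧ d ∈ T) then e c * e d else 0 := by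
    intro R
    have : chordSum T e R =
        ∑ c ∈ P, ∑ d ∈ P, if R c d ∧ c ∈ T ∧ d ∈ T then e c * e d else 0 := by
      unfold chordSum
      rw [← Finset.sum_subset hT]
      · refine Finset.sum_congr rfl fun c hc => ?_
        rw [← Finset.sum_subset hT]
        · refine Finset.sum_congr rfl fun d hd => ?_
          simp [hc, hd]
        · intro d _ hd
          simp [hd]
      · intro c _ hc
        simp [hc]
    rw [this, ← Finset.sum_add_distrib]
    unfold chordSum
    refine Finset.sum_congr rfl fun c _ => ?_
    rw [← Finset.sum_add_distrib]
    refine Finset.sum_congr rfl fun d _ => ?_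
    by_cases h1 : R c d <;> by_cases h2 : c ∈ T ∧ d ∈ T <;> simp [h1, h2]
  rw [key R, key R', add_sub_add_comm, ← Finset.sum_sub_distrib]
  rw [Finset.sum_eq_zero, add_zero]
  intro c hc
  rw [← Finset.sum_sub_distrib]
  refine Finset.sum_eq_zero fun d hd => sub_eq_zero.mpr ?_
  refine if_congr ?_ rfl rfl
  by_cases h2 : c ∈ T ∧ d ∈ T
  · simp [h2]
  · rw [hR c hc d hd h2]

/-- Chords which are not both sides of the triangle keep their relative position. -/
theorem IsTriplePoint.eventually_sameOrder {s₁ s₂ s₃ : ℝ} (h : IsTriplePoint H s₁ s₂ s₃)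
    {ψ : ℝ × ℝ → ℝ → ℝ × ℝ} (hψ : IsTracking H 0 (doublePairs (H 0)) ψ) {T : Set (ℝ × ℝ)}
    (h12 : (s₁, s₂) ∈ T) (h13 : (s₁, s₃) ∈ T) (h23 : (s₂, s₃) ∈ T) :
    ∀ᶠ t in 𝓝 0, ∀ c ∈ doublePairs (H 0), ∀ d ∈ doublePairs (H 0), ¬ (c ∈ T ∧ d ∈ T) →
      SameOrder c d (ψ c t) (ψ d t) := by
  -- Two chords can share an endpoint only at a triple passage, hence only when both are among the
  -- three given chords. All other pairs have four distinct endpoints and keep their order.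
  have key : ∀ {s t u : ℝ}, (s, t) ∈ doublePairs (H 0) → (t, u) ∈ doublePairs (H 0) →
      (s, t) ∈ T ∧ (s, u) ∈ T ∧ (t, u) ∈ T := by
    intro s t u k1 k2
    obtain ⟨rfl, rfl, rfl⟩ := h.unique s t u ⟨k1, k2⟩
    exact ⟨h12, h13, h23⟩
  refine (eventually_all_finite h.finite).mpr fun c hc =>
    (eventually_all_finite h.finite).mpr fun d hd => ?_
  by_cases hcd : c = d
  · subst hcd
    filter_upwards [hψ.eventually_mem c hc] with t ht _
    have h1 := hc.2.1
    have h2 := ht.2.1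
    simp [SameOrder, h1, h2, h1.not_gt, h2.not_gt]
  by_cases hT : c ∈ T ∧ d ∈ T
  · exact Eventually.of_forall fun _ k => absurd hT k
  have hcψ := hψ.tendsto hc
  have hdψ := hψ.tendsto hd
  obtain ⟨c1, c2⟩ := c
  obtain ⟨d1, d2⟩ := d
  have hc' := hc
  have hd' := hd
  obtain ⟨p1, p2, p3, p4⟩ := hc'
  obtain ⟨q1, q2, q3, q4⟩ := hd'
  dsimp only at p1 p2 p3 p4 q1 q2 q3 q4
  refine (PlaneCurves.eventually_sameOrder hcψ hdψ ?_ ?_ ?_ ?_).mono fun t k _ => k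
  · rintro (rfl : c1 = d1)
    rcases lt_trichotomy c2 d2 with hlt | rfl | hlt
    · have := key hc ⟨p1.trans p2.le, hlt, q3, p4.symm.trans q4⟩
      exact hT ⟨this.1, this.2.1⟩
    · exact hcd rfl
    · have := key hd ⟨p1.trans q2.le, hlt, p3, q4.symm.trans p4⟩
      exact hT ⟨this.2.1, this.1⟩
  · rintro (rfl : c1 = d2)
    have := key hd hc
    exact hT ⟨this.2.2, this.1⟩
  · rintro (rfl : c2 = d1)
    have := key hc hd
    exact hT ⟨this.1, this.2.2⟩
  · rintro (rfl : c2 = d2)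
    rcases lt_trichotomy c1 d1 with hlt | rfl | hlt
    · have := key ⟨p1, hlt, q2.trans q3, p4.trans q4.symm⟩ hd
      exact hT ⟨this.2.1, this.2.2⟩
    · exact hcd rfl
    · have := key ⟨q1, hlt, p2.trans p3, q4.trans p4.symm⟩ hc
      exact hT ⟨this.2.2, this.2.1⟩

/-- With velocities `vᵢ` and motions `mᵢ`, all three products equal `-cross m₁ v₁ * cross v₂ v₃ +
cross m₂ v₂ * cross v₁ v₃ - cross m₃ v₃ * cross v₁ v₂`, because `cross v₂ v₃ • v₁ - cross v₁ v₃ • v₂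
+ cross v₁ v₂ • v₃ = 0`. This `D` measures how the three moving tangent lines fail to be concurrent,
so the exchanges on the three branches are governed by one sign. -/
theorem passage_sub_mul {s₁ s₂ s₃ : ℝ} (h12 : cross (deriv (H 0) s₁) (deriv (H 0) s₂) ≠ 0)
    (h13 : cross (deriv (H 0) s₁) (deriv (H 0) s₃) ≠ 0)
    (h23 : cross (deriv (H 0) s₂) (deriv (H 0) s₃) ≠ 0) : ∃ D : ℝ,
      (passage H s₁ s₂ - passage H s₁ s₃) * (cross (deriv (H 0) s₁) (deriv (H 0) s₂) *
        cross (deriv (H 0) s₁) (deriv (H 0) s₃)) = D ∧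
      (passage H s₂ s₁ - passage H s₂ s₃) * (cross (deriv (H 0) s₁) (deriv (H 0) s₂) *
        cross (deriv (H 0) s₂) (deriv (H 0) s₃)) = D ∧
      (passage H s₃ s₁ - passage H s₃ s₂) * (cross (deriv (H 0) s₁) (deriv (H 0) s₃) *
        cross (deriv (H 0) s₂) (deriv (H 0) s₃)) = D := by
  have k1 : ∀ {a b x y : ℝ}, x ≠ 0 → y ≠ 0 → (a / x - b / y) * (x * y) = a * y - b * x := by
    intro a b x y hx hy
    field_simp
  refine ⟨_, rfl, ?_, ?_⟩ <;> unfold passage <;> rw [k1 h12 h13]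
  · rw [cross_swap (deriv (H 0) s₁) (deriv (H 0) s₂), div_neg, ← neg_div, k1 h12 h23]
    unfold cross
    simp only [Complex.sub_re, Complex.sub_im]
    ring
  · rw [cross_swap (deriv (H 0) s₁) (deriv (H 0) s₃), cross_swap (deriv (H 0) s₂) (deriv (H 0) s₃),
      div_neg, ← neg_div, div_neg, ← neg_div, k1 h13 h23]
    unfold cross
    simp only [Complex.sub_re, Complex.sub_im]
    ring

/-- The effect of the bits of a positive triple point on the pair sums. -/
theorem sum_bits_eq {d₁₂ d₁₃ d₂₃ u v w D : ℝ} (h12 : d₁₂ ≠ 0) (h13 : d₁₃ ≠ 0) (h23 : d₂₃ ≠ 0)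
    (hu : u * (d₁₂ * d₁₃) = D) (hv : v * (d₁₂ * d₂₃) = D) (hw : w * (d₁₃ * d₂₃) = D) (hD : 0 < D) :
    ((if v < 0 then Real.sign d₁₂ * Real.sign d₂₃ else 0)
        - (if 0 < u then Real.sign d₁₂ * Real.sign d₁₃ else 0)
        - (if 0 < w then Real.sign d₁₃ * Real.sign d₂₃ else 0)) -
      ((if 0 < v then Real.sign d₁₂ * Real.sign d₂₃ else 0)
        - (if u < 0 then Real.sign d₁₂ * Real.sign d₁₃ else 0)
        - (if w < 0 then Real.sign d₁₃ * Real.sign d₂₃ else 0)) = -3 ∧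
    ((if u < 0 then Real.sign d₁₂ * Real.sign d₁₃ else 0)
        + (if 0 < v then Real.sign d₁₂ * Real.sign d₂₃ else 0)
        + (if w < 0 then Real.sign d₁₃ * Real.sign d₂₃ else 0)) -
      ((if 0 < u then Real.sign d₁₂ * Real.sign d₁₃ else 0)
        + (if v < 0 then Real.sign d₁₂ * Real.sign d₂₃ else 0)
        + (if 0 < w then Real.sign d₁₃ * Real.sign d₂₃ else 0)) = -1 := by
  -- For `D > 0` the product of the signs of two sides equals the sign of the corresponding
  -- difference of passages. In either case the pair then contributes `-1` to the first change; to
  -- the second the pairs contribute `-1`, `+1`, `-1` in the order in which they are listed.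
  have key : ∀ {a b x : ℝ}, a ≠ 0 → b ≠ 0 → x * (a * b) = D →
      (Real.sign a * Real.sign b = 1 ∧ 0 < x) ∨ (Real.sign a * Real.sign b = -1 ∧ x < 0) := by
    intro a b x ha hb hx
    have hpos : 0 < x * (a * b) := hx ▸ hD
    rcases lt_or_gt_of_ne ha with ha | ha <;> rcases lt_or_gt_of_ne hb with hb | hb
    · exact Or.inl ⟨by rw [Real.sign_of_neg ha, Real.sign_of_neg hb]; norm_num,
        pos_of_mul_pos_left hpos (mul_pos_of_neg_of_neg ha hb).le⟩
    · refine Or.inr ⟨by rw [Real.sign_of_neg ha, Real.sign_of_pos hb]; norm_num, ?_⟩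
      have := mul_neg_of_neg_of_pos ha hb
      by_contra! h0
      nlinarith
    · refine Or.inr ⟨by rw [Real.sign_of_pos ha, Real.sign_of_neg hb]; norm_num, ?_⟩
      have := mul_neg_of_pos_of_neg ha hb
      by_contra! h0
      nlinarith
    · exact Or.inl ⟨by rw [Real.sign_of_pos ha, Real.sign_of_pos hb]; norm_num,
        pos_of_mul_pos_left hpos (mul_pos ha hb).le⟩
  rcases key h12 h13 hu with ⟨e1, k1⟩ | ⟨e1, k1⟩ <;> rcases key h12 h23 hv with ⟨e2, k2⟩ | ⟨e2, k2⟩ <;>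
    rcases key h13 h23 hw with ⟨e3, k3⟩ | ⟨e3, k3⟩ <;>
    simp only [e1, e2, e3, k1, k2, k3, k1.not_gt, k2.not_gt, k3.not_gt, if_true, if_false] <;>
    norm_num

/-- The product of the three differences, multiplied by the square `(d₁₂ d₁₃ d₂₃) ^ 2`, is `D ^ 3`,
while the number of negative differences has the parity of `triangleMatches`, since two of the three
matches are counted by positive differences. Hence the sign of `D` is the sign of the triangle. -/
theorem IsTriplePoint.pos_of_tripleSign {s₁ s₂ s₃ d₁₂ d₁₃ d₂₃ D : ℝ} (h12 : d₁₂ ≠ 0)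
    (h13 : d₁₃ ≠ 0) (h23 : d₂₃ ≠ 0)
    (hu : (passage H s₁ s₂ - passage H s₁ s₃) * (d₁₂ * d₁₃) = D)
    (hv : (passage H s₂ s₁ - passage H s₂ s₃) * (d₁₂ * d₂₃) = D)
    (hw : (passage H s₃ s₁ - passage H s₃ s₂) * (d₁₃ * d₂₃) = D) (hD : D ≠ 0)
    (hs : tripleSign H s₁ s₂ s₃ = 1) : 0 < D := by
  by_contra! hle
  have hneg : D < 0 := lt_of_le_of_ne hle hD
  have key : ∀ {a b x : ℝ}, a ≠ 0 → b ≠ 0 → x * (a * b) = D →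
      (0 < a * b ∧ x < 0) ∨ (a * b < 0 ∧ 0 < x) := by
    intro a b x ha hb hx
    rcases lt_or_gt_of_ne (mul_ne_zero ha hb) with h | h
    · refine Or.inr ⟨h, ?_⟩
      by_contra! h0
      nlinarith
    · refine Or.inl ⟨h, ?_⟩
      by_contra! h0
      nlinarith
  have hprod : 0 < (d₁₂ * d₁₃) * (d₁₂ * d₂₃) * (d₁₃ * d₂₃) := by
    have : (d₁₂ * d₁₃) * (d₁₂ * d₂₃) * (d₁₃ * d₂₃) = (d₁₂ * d₁₃ * d₂₃) ^ 2 := by ring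
    rw [this]
    positivity
  unfold tripleSign triangleMatches at hs
  rcases key h12 h13 hu with ⟨e1, k1⟩ | ⟨e1, k1⟩ <;> rcases key h12 h23 hv with ⟨e2, k2⟩ | ⟨e2, k2⟩ <;>
    rcases key h13 h23 hw with ⟨e3, k3⟩ | ⟨e3, k3⟩
  all_goals
    simp only [sub_pos, sub_neg] at k1 k2 k3
    simp only [k1, k2, k3, k1.not_gt, k2.not_gt, k3.not_gt, if_true, if_false] at hs
    first
    | (exfalso; norm_num at hs; done)
    | exact absurd hprod (not_lt.mpr (by
        first
        | exact mul_nonpos_of_nonneg_of_nonpos (mul_pos e1 e2).le e3.le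
        | exact mul_nonpos_of_nonneg_of_nonpos (mul_pos_of_neg_of_neg e1 e2).le e3.le
        | exact mul_nonpos_of_nonpos_of_nonneg (mul_neg_of_pos_of_neg e1 e2).le e3.le
        | exact mul_nonpos_of_nonpos_of_nonneg (mul_neg_of_neg_of_pos e1 e2).le e3.le))

/-- The effect of a positive triple point on the pair sums, when the base point is not a double
point at time `0`. -/
theorem IsTriplePoint.eventually_change {s₁ s₂ s₃ : ℝ} (h : IsTriplePoint H s₁ s₂ s₃)
    (hs : tripleSign H s₁ s₂ s₃ = 1) (hbase : ∀ q ∈ doublePairs (H 0), 0 < q.1) :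
    ∀ᶠ t in 𝓝[>] (0 : ℝ), doubleCount (H t) = doubleCount (H (-t)) ∧
      sepSubNest (H t) = sepSubNest (H (-t)) - 3 ∧ interSum (H t) = interSum (H (-t)) - 1 := by
  classical
  have h0I : (0 : ℝ) ∈ Icc (-1 : ℝ) 1 := by simp
  obtain ⟨mA, mC⟩ := h.triple
  have mB : (s₁, s₃) ∈ doublePairs (H 0) :=
    ⟨mA.1, mA.2.1.trans mC.2.1, mC.2.2.1, mA.2.2.2.trans mC.2.2.2⟩
  have l12 : s₁ < s₂ := mA.2.1
  have l23 : s₂ < s₃ := mC.2.1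
  have l13 := l12.trans l23
  have tA := h.transverse _ mA
  have tB := h.transverse _ mB
  have tC := h.transverse _ mC
  obtain ⟨D, hu, hv, hw⟩ := passage_sub_mul (H := H) tA tB tC
  have hD0 : D ≠ 0 := by
    rw [← hu]
    exact mul_ne_zero (sub_ne_zero.mpr h.speed) (mul_ne_zero tA tB)
  have hD := pos_of_tripleSign tA tB tC hu hv hw hD0 hs
  have nv : passage H s₂ s₁ ≠ passage H s₂ s₃ := fun e => hD0 (by rw [← hv, e, sub_self, zero_mul])
  have nw : passage H s₃ s₁ ≠ passage H s₃ s₂ := fun e => hD0 (by rw [← hw, e, sub_self, zero_mul])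
  obtain ⟨ψ, hψ⟩ := exists_isTracking h.smooth subset_rfl hbase h.transverse
  set P := h.finite.toFinset with hP
  have hPc : (P : Set (ℝ × ℝ)) = doublePairs (H 0) := h.finite.coe_toFinset
  have hPm : ∀ q, q ∈ P ↔ q ∈ doublePairs (H 0) := fun q => h.finite.mem_toFinset
  set T : Finset (ℝ × ℝ) := {(s₁, s₂), (s₁, s₃), (s₂, s₃)} with hT
  have hTP : T ⊆ P := by
    intro q hq
    simp only [hT, Finset.mem_insert, Finset.mem_singleton] at hq
    rw [hPm]
    rcases hq with rfl | rfl | rfl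
    exacts [mA, mB, mC]
  have hbij := hψ.eventually_bijOn h.smooth h0I h.curve hbase h.finite
  rw [nhdsWithin_eq_nhds.mpr (Icc_mem_nhds (by norm_num) (by norm_num)), ← hPc] at hbij
  have hsame := h.eventually_sameOrder hψ (T := T) (by simp [hT]) (by simp [hT]) (by simp [hT])
  have hsign : ∀ᶠ t in 𝓝 (0 : ℝ), ∀ c ∈ doublePairs (H 0),
      doubleSign (H t) (ψ c t) = doubleSign (H 0) c :=
    (eventually_all_finite h.finite).mpr hψ.eventually_sign
  have aA := hψ.tendsto mA
  have aB := hψ.tendsto mB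
  have aC := hψ.tendsto mC
  -- The six endpoints stay in three groups near `s₁ < s₂ < s₃`; only the order inside each group
  -- can change.
  have hmax : ∀ᶠ t in 𝓝 (0 : ℝ), max (ψ (s₁, s₂) t).1 (ψ (s₁, s₃) t).1 <
        min (ψ (s₁, s₂) t).2 (ψ (s₂, s₃) t).1 ∧
      max (ψ (s₁, s₂) t).2 (ψ (s₂, s₃) t).1 < min (ψ (s₁, s₃) t).2 (ψ (s₂, s₃) t).2 := by
    refine ((aA.fst_nhds.max aB.fst_nhds).eventually_lt (aA.snd_nhds.min aC.fst_nhds) ?_).and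
      ((aA.snd_nhds.max aC.fst_nhds).eventually_lt (aB.snd_nhds.min aC.snd_nhds) ?_)
    · simpa using l12
    · simpa using l23
  have e0 : ∀ q ∈ doublePairs (H 0), ψ q 0 = q := hψ.apply_self
  have dA := hψ.hasDerivAt_passage mA tA
  have dB := hψ.hasDerivAt_passage mB tB
  have dC := hψ.hasDerivAt_passage mC tC
  -- One comparison on each branch: the first passages of `(s₁, s₂)` and `(s₁, s₃)`; the second
  -- passage of `(s₁, s₂)` and the first of `(s₂, s₃)`; the second passages of `(s₁, s₃)` and `(s₂,
  -- s₃)`.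
  have b1 := eventually_lt_iff_of_hasDerivAt dA.1 dB.1 (by rw [e0 _ mA, e0 _ mB]) h.speed
  have b2 := eventually_lt_iff_of_hasDerivAt dA.2 dC.1 (by rw [e0 _ mA, e0 _ mC]) nv
  have b3 := eventually_lt_iff_of_hasDerivAt dB.2 dC.2 (by rw [e0 _ mB, e0 _ mC]) nw
  have hid : Tendsto (fun t : ℝ => t) (𝓝[>] 0) (𝓝 0) := nhdsWithin_le_nhds
  have hneg : Tendsto (fun t : ℝ => -t) (𝓝[>] 0) (𝓝 0) := by simpa using hid.neg
  filter_upwards [hid.eventually hbij, hneg.eventually hbij, hid.eventually hsame,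
    hneg.eventually hsame, hid.eventually hsign, hneg.eventually hsign, hid.eventually hmax,
    hneg.eventually hmax, b1, b2, b3] with t f1 f2 o1 o2 g1 g2 x1 x2 b1 b2 b3
  have hsum : ∀ θ, BijOn (fun q => ψ q θ) P (doublePairs (H θ)) →
      (∀ c ∈ doublePairs (H 0), doubleSign (H θ) (ψ c θ) = doubleSign (H 0) c) →
      ∀ R, pairSum (H θ) (doubleSign (H θ)) R =
        chordSum P (doubleSign (H 0)) (fun c d => R (ψ c θ) (ψ d θ)) := by
    intro θ k1 k2 R
    rw [pairSum_eq_chordSum k1]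
    exact chordSum_congr (fun c hc => k2 c ((hPm c).mp hc)) fun _ _ _ _ => Iff.rfl
  have hdiff : ∀ R : ℝ × ℝ → ℝ × ℝ → Prop,
      (∀ c d c' d', SameOrder c d c' d' → (R c d ↔ R c' d')) →
      pairSum (H t) (doubleSign (H t)) R - pairSum (H (-t)) (doubleSign (H (-t))) R =
        chordSum T (doubleSign (H 0)) (fun c d => R (ψ c t) (ψ d t)) -
        chordSum T (doubleSign (H 0)) (fun c d => R (ψ c (-t)) (ψ d (-t))) := by
    intro R hR
    rw [hsum t f1 g1, hsum (-t) f2 g2]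
    refine chordSum_sub_eq hTP _ fun c hc d hd hcd => ?_
    rw [hPm] at hc hd
    exact (hR _ _ _ _ (o1 c hc d hd hcd)).symm.trans (hR _ _ _ _ (o2 c hc d hd hcd))
  have hAB : ((s₁, s₂) : ℝ × ℝ) ≠ (s₁, s₃) := by simp [l23.ne]
  have hAC : ((s₁, s₂) : ℝ × ℝ) ≠ (s₂, s₃) := by simp [l12.ne]
  have hBC : ((s₁, s₃) : ℝ × ℝ) ≠ (s₂, s₃) := by simp [l12.ne]
  have S := hdiff Separated fun _ _ _ _ h => h.separated
  have N := hdiff Nested fun _ _ _ _ h => h.nested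
  have I := hdiff Interleaved fun _ _ _ _ h => h.interleaved
  obtain ⟨y1, y2⟩ := chordSum_triangle hAB hAC hBC (doubleSign (H 0)) (fun q => ψ q t) x1.1 x1.2
  obtain ⟨z1, z2⟩ :=
    chordSum_triangle hAB hAC hBC (doubleSign (H 0)) (fun q => ψ q (-t)) x2.1 x2.2
  obtain ⟨r1, r2⟩ := sum_bits_eq tA tB tC hu hv hw hD
  simp only [sub_pos, sub_neg] at r1 r2
  simp only [b1.1, b1.2.1, b2.1, b2.2.1, b3.1, b3.2.1] at y1 y2
  simp only [b1.2.2.1, b1.2.2.2, b2.2.2.1, b2.2.2.2, b3.2.2.1, b3.2.2.2] at z1 z2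
  refine ⟨by rw [doubleCount_eq_card f1, doubleCount_eq_card f2], ?_, ?_⟩
  · have := (congrArg₂ (· - ·) y1 z1).trans r1
    unfold sepSubNest
    linarith
  · have := (congrArg₂ (· - ·) y2 z2).trans r2
    unfold interSum
    linarith

/-- `J⁺` changes by `-3 - 3 * (-1) = 0`, hence `St = -J⁺ / 2 - S₃` by `1`; `d` and the index are
constant. -/
theorem arnold_triple {s₁ s₂ s₃ : ℝ} (h : IsTriplePoint H s₁ s₂ s₃)
    (hs : tripleSign H s₁ s₂ s₃ = 1) : Jplus (H 1) = Jplus (H (-1)) ∧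
      Jminus (H 1) = Jminus (H (-1)) ∧ St (H 1) = St (H (-1)) + 1 := by
  have hper : Function.Periodic (H 0) (2 * Real.pi) := (h.curve 0 (by simp)).periodic
  obtain ⟨η, hη, hb⟩ := exists_base_shift hper h.finite
  have hS := h.shiftBase hb
  have hev := hS.eventually_change (by rw [tripleSign_shiftBase, hs]) (fun q hq => by
    obtain ⟨q', hq', rfl⟩ := hb.surjOn hq
    exact add_pos_of_nonneg_of_pos hq'.1 hη)
  obtain ⟨t, ht, ⟨c1, c2, c3⟩, e1, e2⟩ := exists_arnold_eq_near h.toIsRegularHomotopy h.generic η hev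
  obtain ⟨a1, a2, a3⟩ := arnold_eq_iff.mp e1
  obtain ⟨b1, b2, b3⟩ := arnold_eq_iff.mp e2
  have hw := whitneyIndex_eq_of_homotopy hS.toIsRegularHomotopy (t := t) (t' := -t)
    ⟨by linarith [ht.1], ht.2⟩ ⟨by linarith [ht.2], by linarith [ht.1]⟩
  have hJ : Jplus (shiftBase H η t) = Jplus (shiftBase H η (-t)) := by
    rw [Jplus_eq, Jplus_eq, c1, c2, c3, hw]; ring
  refine ⟨by rw [a1, b1, hJ], ?_, ?_⟩
  · rw [a2, b2, Jminus_eq, Jminus_eq, hJ, c1]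
  · rw [a3, b3, St_eq, St_eq, hJ, c3]; ring

end TriplePoint

end PlaneCurves

namespace PlaneCurves

open Set Filter Topology

/-! ### The standard curves -/

theorem contDiff_complex_mk {E : Type*} [NormedAddCommGroup E] [NormedSpace ℝ E] {f g : E → ℝ}
    (hf : ContDiff ℝ ∞ f) (hg : ContDiff ℝ ∞ g) : ContDiff ℝ ∞ fun x => (⟨f x, g x⟩ : ℂ) :=
  Complex.equivRealProdCLM.symm.contDiff.comp (hf.prodMk hg)

theorem hasDerivAt_complex_mk {f g : ℝ → ℝ} {f' g' x : ℝ} (hf : HasDerivAt f f' x)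
    (hg : HasDerivAt g g' x) : HasDerivAt (fun x => (⟨f x, g x⟩ : ℂ)) ⟨f', g'⟩ x :=
  Complex.equivRealProdCLM.symm.hasFDerivAt.comp_hasDerivAt x (hf.prodMk hg)

theorem hasDerivAt_cos_mul (k s : ℝ) :
    HasDerivAt (fun s => Real.cos (k * s)) (-(k * Real.sin (k * s))) s := by
  have := (Real.hasDerivAt_cos (k * s)).comp s ((hasDerivAt_id s).const_mul k)
  refine this.congr_deriv ?_
  ring

theorem hasDerivAt_sin_mul (k s : ℝ) :
    HasDerivAt (fun s => Real.sin (k * s)) (k * Real.cos (k * s)) s := by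
  have := (Real.hasDerivAt_sin (k * s)).comp s ((hasDerivAt_id s).const_mul k)
  refine this.congr_deriv ?_
  ring

/-- The invariants of a curve with all the chords separated and of the same sign. -/
theorem arnold_of_separated {γ : ℝ → ℂ} {m : ℕ} {f : ℕ → ℝ × ℝ} {e : ℝ}
    (hf : BijOn f (Finset.range m : Finset ℕ) (doublePairs γ))
    (hsep : ∀ j k, j < k → k < m → (f j).2 < (f k).1)
    (he : ∀ j < m, doubleSign γ (f j) = e) (hee : e * e = 1) :
    sepSubNest γ = (m : ℝ) * (m - 1) / 2 ∧ interSum γ = 0 ∧ doubleCount γ = m := by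
  have hlt : ∀ j < m, (f j).1 < (f j).2 := fun j hj =>
    (hf.mapsTo (by simpa using hj)).2.1
  have rel : ∀ j ∈ Finset.range m, ∀ k ∈ Finset.range m,
      (Separated (f j) (f k) ↔ j < k) ∧ ¬ Nested (f j) (f k) ∧ ¬ Interleaved (f j) (f k) := by
    intro j hj k hk
    rw [Finset.mem_range] at hj hk
    have h1 := hlt j hj
    have h2 := hlt k hk
    rcases lt_trichotomy j k with h | rfl | h
    · have := hsep j k h hk
      refine ⟨iff_of_true this h, fun hN => ?_, fun hI => ?_⟩
      · linarith [hN.2]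
      · linarith [hI.2.1]
    · refine ⟨iff_of_false (fun hS => ?_) (lt_irrefl j), fun hN => lt_irrefl _ hN.1,
        fun hI => lt_irrefl _ hI.1⟩
      exact h1.not_gt hS
    · have := hsep k j h hj
      refine ⟨iff_of_false (fun hS => ?_) h.not_gt, fun hN => ?_, fun hI => ?_⟩
      · unfold Separated at hS
        linarith
      · linarith [hN.1]
      · linarith [hI.1]
  have hzero : ∀ R : ℝ × ℝ → ℝ × ℝ → Prop, (∀ j ∈ Finset.range m, ∀ k ∈ Finset.range m,
      ¬ R (f j) (f k)) → pairSum γ (doubleSign γ) R = 0 := by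
    intro R hR
    rw [pairSum_eq_chordSum hf]
    unfold chordSum
    exact Finset.sum_eq_zero fun j hj => Finset.sum_eq_zero fun k hk => by simp [hR j hj k hk]
  have hsum : ∀ m : ℕ, (∑ j ∈ Finset.range m, ∑ k ∈ Finset.range m,
      if j < k then (1 : ℝ) else 0) = (m : ℝ) * (m - 1) / 2 := by
    intro m
    induction m with
    | zero => simp
    | succ m ih =>
      rw [Finset.sum_range_succ]
      simp only [Finset.sum_range_succ _ m]
      rw [Finset.sum_add_distrib, ih]
      have h1 : ∑ j ∈ Finset.range m, (if j < m then (1 : ℝ) else 0) = m := by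
        rw [Finset.sum_congr rfl (g := fun _ => (1 : ℝ)) fun j hj => by
          simp [Finset.mem_range.mp hj]]
        simp
      have h2 : ∑ k ∈ Finset.range m, (if m < k then (1 : ℝ) else 0) = 0 :=
        Finset.sum_eq_zero fun k hk => by simp [(Finset.mem_range.mp hk).le]
      rw [h1, h2]
      push_cast
      simp
      ring
  refine ⟨?_, hzero _ fun j hj k hk => (rel j hj k hk).2.2, by
    rw [doubleCount_eq_card hf, Finset.card_range]⟩
  unfold sepSubNest
  rw [hzero Nested fun j hj k hk => (rel j hj k hk).2.1, sub_zero, pairSum_eq_chordSum hf,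
    chordSum_congr (e' := fun _ => e) (R' := fun j k => j < k)
      (fun j hj => he j (Finset.mem_range.mp hj)) (fun j hj k hk => (rel j hj k hk).1), ← hsum]
  unfold chordSum
  simp only [hee]

/-! ### The figure eight -/

section FigureEight

theorem hasDerivAt_figureEight (s : ℝ) :
    HasDerivAt figureEight ⟨-Real.sin s, 2 * Real.cos (2 * s)⟩ s :=
  hasDerivAt_complex_mk (Real.hasDerivAt_cos s) (hasDerivAt_sin_mul 2 s)

theorem isPlaneCurve_figureEight : IsPlaneCurve figureEight where
  smooth := contDiff_complex_mk Real.contDiff_cos (Real.contDiff_sin.comp (by fun_prop))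
  periodic s := by
    unfold figureEight
    rw [Real.cos_add_two_pi, mul_add]
    congr 1
    have := Real.sin_periodic.nat_mul 2 (2 * s)
    push_cast at this
    exact this
  immersed s h := by
    rw [(hasDerivAt_figureEight s).deriv, Complex.ext_iff] at h
    simp only [Complex.zero_re, Complex.zero_im] at h
    have := Real.cos_two_mul' s
    nlinarith [Real.sin_sq_add_cos_sq s]

theorem doublePairs_figureEight :
    doublePairs figureEight = {(Real.pi / 2, 3 * Real.pi / 2)} := by
  have hpi := Real.pi_pos
  ext ⟨s, t⟩
  simp only [doublePairs, mem_ofPred_eq, mem_singleton_iff, Prod.mk.injEq]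
  constructor
  · rintro ⟨h1, h2, h3, h4⟩
    rw [figureEight, figureEight, Complex.ext_iff] at h4
    obtain ⟨h5, h6⟩ := h4
    dsimp only at h5 h6
    rw [Real.cos_eq_cos_iff] at h5
    obtain ⟨k, hk | hk⟩ := h5
    · exfalso
      have hk0 : (0 : ℝ) < k := by
        by_contra! h0
        nlinarith
      have hk1 : (k : ℝ) < 1 := by
        by_contra! h0
        nlinarith
      have a1 : 0 < k := by exact_mod_cast hk0
      have a2 : k < 1 := by exact_mod_cast hk1
      omega
    · have hk0 : (0 : ℝ) < k := by
        by_contra! h0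
        nlinarith
      have hk1 : (k : ℝ) < 2 := by
        by_contra! h0
        nlinarith
      have a1 : 0 < k := by exact_mod_cast hk0
      have a2 : k < 2 := by exact_mod_cast hk1
      obtain rfl : k = 1 := by omega
      have ht : t = 2 * Real.pi - s := by push_cast at hk; linarith
      have hs0 : 0 < s := by linarith
      have hsp : s < Real.pi := by linarith
      rw [ht, show 2 * (2 * Real.pi - s) = -(2 * s) + 2 * Real.pi + 2 * Real.pi by ring,
        Real.sin_add_two_pi, Real.sin_add_two_pi, Real.sin_neg] at h6
      have h7 : Real.sin (2 * s) = 0 := by linarith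
      rw [Real.sin_two_mul] at h7
      have h8 : Real.cos s = 0 := by
        have := Real.sin_pos_of_pos_of_lt_pi hs0 hsp
        rcases mul_eq_zero.mp h7 with h | h
        · linarith
        · exact h
      have h9 : s = Real.pi / 2 :=
        Real.injOn_cos ⟨hs0.le, hsp.le⟩ ⟨by linarith, by linarith⟩ (by rw [h8, Real.cos_pi_div_two])
      exact ⟨h9, by linarith⟩
  · rintro ⟨rfl, rfl⟩
    refine ⟨by linarith, by linarith, by linarith, ?_⟩
    rw [figureEight, figureEight, show 3 * Real.pi / 2 = Real.pi / 2 + Real.pi by ring]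
    rw [Real.cos_add_pi, Real.cos_pi_div_two, neg_zero, mul_add, Real.sin_add_two_pi]

theorem whitneyIndex_neg (γ : ℝ → ℂ) : whitneyIndex (fun s => -γ s) = whitneyIndex γ := by
  unfold whitneyIndex
  have h1 : deriv (fun s => -γ s) = fun s => -deriv γ s := by ext s; exact deriv.fun_neg
  have h2 : deriv (fun s => -deriv γ s) = fun s => -deriv (deriv γ) s := by
    ext s; exact deriv.fun_neg
  rw [h1, h2]
  simp only [neg_div_neg_eq]

/-- Reversal followed by a shift through half a period rotates the curve by a half turn. The index
is invariant under rotation and negated by reversal, so it vanishes. -/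
theorem whitneyIndex_figureEight : whitneyIndex figureEight = 0 := by
  have h := isPlaneCurve_figureEight
  have h1 : (fun s => figureEight (-(s + -Real.pi))) = fun s => -figureEight s := by
    ext s
    unfold figureEight
    rw [show -(s + -Real.pi) = Real.pi - s by ring, Real.cos_pi_sub,
      show 2 * (Real.pi - s) = 2 * Real.pi - 2 * s by ring, Real.sin_two_pi_sub]
    apply Complex.ext <;> simp
  have h2 := whitneyIndex_comp_add h.comp_neg (-Real.pi)
  have h3 := whitneyIndex_comp_neg h
  rw [h1, whitneyIndex_neg, h3] at h2
  linarith

theorem arnold_figureEight :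
    Jplus figureEight = 0 ∧ Jminus figureEight = -1 ∧ St figureEight = 0 := by
  have hb : BijOn (fun _ : ℕ => (Real.pi / 2, 3 * Real.pi / 2)) (Finset.range 1 : Finset ℕ)
      (doublePairs figureEight) := by
    rw [doublePairs_figureEight]
    simp
  have hx : doubleSign figureEight (Real.pi / 2, 3 * Real.pi / 2) = 1 := by
    unfold doubleSign
    rw [(hasDerivAt_figureEight _).deriv, (hasDerivAt_figureEight _).deriv]
    apply Real.sign_of_pos
    unfold cross
    dsimp only
    rw [show 3 * Real.pi / 2 = Real.pi / 2 + Real.pi by ring, Real.sin_add_pi, mul_add,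
      Real.cos_add_two_pi, show 2 * (Real.pi / 2) = Real.pi by ring, Real.cos_pi,
      Real.sin_pi_div_two]
    norm_num
  obtain ⟨h1, h2, h3⟩ := arnold_of_separated hb (fun j k h h' => by omega)
    (fun _ _ => hx) (by norm_num)
  have hJ : Jplus figureEight = 0 := by
    rw [Jplus_eq, h1, h2, h3, whitneyIndex_figureEight]; norm_num
  refine ⟨hJ, ?_, ?_⟩
  · rw [Jminus_eq, hJ, h3]; norm_num
  · rw [St_eq, hJ, h2]; norm_num

end FigureEight

end PlaneCurves

namespace PlaneCurves

open Set Filter Topology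

/-! ### The circles with inner kinks -/

section KinkedCircle

/-- The curve `c e ^ (√-1 s) + 2 e ^ (√-1 (m + 1) s)`. -/
noncomputable def epitrochoid (m : ℕ) (c s : ℝ) : ℂ :=
  ⟨c * Real.cos s + 2 * Real.cos ((m + 1) * s), c * Real.sin s + 2 * Real.sin ((m + 1) * s)⟩

theorem kinkedCircle_eq (m : ℕ) : kinkedCircle m = epitrochoid m (2 * m + 1) := by
  ext s
  unfold kinkedCircle epitrochoid
  rw [show (2 * (m : ℂ) + 1) = ((2 * m + 1 : ℝ) : ℂ) by push_cast; rfl]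
  apply Complex.ext
  · rw [Complex.add_re, Complex.re_ofReal_mul, Complex.exp_ofReal_mul_I_re, Complex.mul_re,
      Complex.exp_ofReal_mul_I_re]
    simp
  · rw [Complex.add_im, Complex.im_ofReal_mul, Complex.exp_ofReal_mul_I_im, Complex.mul_im,
      Complex.exp_ofReal_mul_I_im]
    simp

theorem hasDerivAt_epitrochoid (m : ℕ) (c s : ℝ) : HasDerivAt (epitrochoid m c)
    ⟨-(c * Real.sin s + 2 * (m + 1) * Real.sin ((m + 1) * s)),
      c * Real.cos s + 2 * (m + 1) * Real.cos ((m + 1) * s)⟩ s := by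
  have := hasDerivAt_complex_mk
    (((Real.hasDerivAt_cos s).const_mul c).fun_add ((hasDerivAt_cos_mul (m + 1) s).const_mul 2))
    (((Real.hasDerivAt_sin s).const_mul c).fun_add ((hasDerivAt_sin_mul (m + 1) s).const_mul 2))
  refine this.congr_deriv ?_
  apply Complex.ext <;> dsimp only <;> ring

theorem contDiff_epitrochoid_family (m : ℕ) {E : Type*} [NormedAddCommGroup E] [NormedSpace ℝ E]
    {f g : E → ℝ} (hf : ContDiff ℝ ∞ f) (hg : ContDiff ℝ ∞ g) :
    ContDiff ℝ ∞ fun x => epitrochoid m (f x) (g x) := by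
  refine contDiff_complex_mk ?_ ?_
  · exact (hf.mul (Real.contDiff_cos.comp hg)).add
      (contDiff_const.mul (Real.contDiff_cos.comp (contDiff_const.mul hg)))
  · exact (hf.mul (Real.contDiff_sin.comp hg)).add
      (contDiff_const.mul (Real.contDiff_sin.comp (contDiff_const.mul hg)))

/-- For `0 ≤ c < 2 (m + 1)` the speed of the second rotating term exceeds that of the first, so the
velocity cannot vanish. -/
theorem isPlaneCurve_epitrochoid (m : ℕ) {c : ℝ} (h0 : 0 ≤ c) (hc : c < 2 * (m + 1)) :
    IsPlaneCurve (epitrochoid m c) where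
  smooth := contDiff_epitrochoid_family m contDiff_const contDiff_id
  periodic s := by
    unfold epitrochoid
    have h1 := Real.sin_periodic.nat_mul (m + 1) ((m + 1) * s)
    have h2 := Real.cos_periodic.nat_mul (m + 1) ((m + 1) * s)
    push_cast at h1 h2
    rw [Real.cos_add_two_pi, Real.sin_add_two_pi, mul_add, h1, h2]
  immersed s h := by
    rw [(hasDerivAt_epitrochoid m c s).deriv, Complex.ext_iff] at h
    obtain ⟨h1, h2⟩ := h
    simp only [Complex.zero_re, Complex.zero_im] at h1 h2
    have e1 := Real.sin_sq_add_cos_sq s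
    have e2 := Real.sin_sq_add_cos_sq ((m + 1) * s)
    have e3 : c * Real.sin s = -(2 * (m + 1) * Real.sin ((m + 1) * s)) := by linarith
    have e4 : c * Real.cos s = -(2 * (m + 1) * Real.cos ((m + 1) * s)) := by linarith
    have : c ^ 2 = (2 * ((m : ℝ) + 1)) ^ 2 := by
      calc c ^ 2 = (c * Real.sin s) ^ 2 + (c * Real.cos s) ^ 2 := by linear_combination (-c ^ 2) * e1
        _ = (2 * ((m : ℝ) + 1)) ^ 2 := by
          rw [e3, e4]; linear_combination ((2 * ((m : ℝ) + 1)) ^ 2) * e2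
    nlinarith

/-- Shrinking the coefficient `2 m + 1` linearly to `0` keeps the curve immersed and ends at a
circle run through `m + 1` times, for which `γ'' / γ'` is the constant `(m + 1) I`. -/
theorem whitneyIndex_kinkedCircle (m : ℕ) : whitneyIndex (kinkedCircle m) = m + 1 := by
  have hH : IsRegularHomotopy fun t s => epitrochoid m ((2 * m + 1) * (1 - t) / 2) s :=
    { smooth := contDiff_epitrochoid_family m (by fun_prop) contDiff_snd
      curve := fun t ht => by
        have hm : (0 : ℝ) ≤ m := Nat.cast_nonneg m
        refine isPlaneCurve_epitrochoid m ?_ ?_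
        · have := mul_nonneg (by positivity : (0 : ℝ) ≤ 2 * m + 1) (sub_nonneg.mpr ht.2)
          linarith
        · have := mul_nonneg (by positivity : (0 : ℝ) ≤ 2 * m + 1) (sub_nonneg.mpr ht.1)
          linarith }
  have := whitneyIndex_eq_of_homotopy hH (t := -1) (t' := 1) (by simp) (by simp)
  rw [show (2 * (m : ℝ) + 1) * (1 - -1) / 2 = 2 * m + 1 by ring, sub_self, mul_zero, zero_div]
    at this
  rw [kinkedCircle_eq, this]
  have h1 : deriv (epitrochoid m 0) = fun s => (2 * (m + 1) : ℝ) *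
      (Complex.I * Complex.exp (((m + 1) * s : ℝ) * Complex.I)) := by
    ext s
    rw [(hasDerivAt_epitrochoid m 0 s).deriv]
    apply Complex.ext <;> rw [Complex.exp_mul_I] <;>
      simp [← Complex.ofReal_cos, ← Complex.ofReal_sin, -Complex.ofReal_add, -Complex.ofReal_mul]
  have h2 : ∀ s, deriv (deriv (epitrochoid m 0)) s = Complex.I * (m + 1) * deriv (epitrochoid m 0) s := by
    intro s
    rw [h1]
    have : HasDerivAt (fun s : ℝ => Complex.exp (((m + 1) * s : ℝ) * Complex.I))
        (Complex.exp (((m + 1) * s : ℝ) * Complex.I) * ((m + 1) * Complex.I)) s := by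
      have h3 : HasDerivAt (fun s : ℝ => (((m + 1) * s : ℝ) : ℂ) * Complex.I)
          ((m + 1) * Complex.I) s := by
        have := (((hasDerivAt_id s).const_mul ((m : ℝ) + 1)).ofReal_comp).mul_const Complex.I
        refine this.congr_deriv ?_
        push_cast
        ring
      exact h3.cexp
    rw [((this.const_mul Complex.I).const_mul ((2 * (m + 1) : ℝ) : ℂ)).deriv]
    ring
  have h3 : ∀ s, (deriv (deriv (epitrochoid m 0)) s / deriv (epitrochoid m 0) s).im = m + 1 := by
    intro s
    rw [h2, mul_div_assoc, div_self]
    · simp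
    · exact (isPlaneCurve_epitrochoid m le_rfl (by positivity)).immersed s
  unfold whitneyIndex
  simp only [h3]
  rw [intervalIntegral.integral_const]
  have := Real.pi_pos
  simp

/-- In terms of the midpoint `u` and the half-difference `h`, the difference of the two points,
rotated by `-u`, has as its components multiples of the two expressions on the right. -/
theorem epitrochoid_eq_iff (m : ℕ) (c u h : ℝ) :
    epitrochoid m c (u - h) = epitrochoid m c (u + h) ↔
      Real.sin ((m + 1) * h) * Real.sin (m * u) = 0 ∧
      c * Real.sin h + 2 * Real.cos (m * u) * Real.sin ((m + 1) * h) = 0 := by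
  have e := Real.sin_sq_add_cos_sq u
  have h1 : Real.sin ((m + 1) * u) = Real.sin (m * u) * Real.cos u + Real.cos (m * u) * Real.sin u := by
    rw [← Real.sin_add]; ring_nf
  have h2 : Real.cos ((m + 1) * u) = Real.cos (m * u) * Real.cos u - Real.sin (m * u) * Real.sin u := by
    rw [← Real.cos_add]; ring_nf
  rw [epitrochoid, epitrochoid, Complex.ext_iff]
  dsimp only
  rw [mul_sub, mul_add, Real.cos_sub, Real.cos_add, Real.sin_sub, Real.sin_add, Real.cos_sub,
    Real.cos_add, Real.sin_sub, Real.sin_add, h1, h2]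
  constructor
  · rintro ⟨k1, k2⟩
    constructor
    · linear_combination (Real.cos u / 4) * k1 + (Real.sin u / 4) * k2 -
        (Real.sin ((m + 1) * h) * Real.sin (m * u)) * e
    · linear_combination (Real.sin u / 2) * k1 - (Real.cos u / 2) * k2 -
        (c * Real.sin h + 2 * Real.cos (m * u) * Real.sin ((m + 1) * h)) * e
  · rintro ⟨k1, k2⟩
    constructor
    · linear_combination (2 * Real.sin u) * k2 + (4 * Real.cos u) * k1
    · linear_combination (-2 * Real.cos u) * k2 + (4 * Real.sin u) * k1

/-- The difference of the two sides vanishes at `0` and has derivative `-((m + 1) ^ 2 - 1) sin ((m +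
1) h) sin h < 0` inside the interval. It serves twice: it makes `sin ((m + 1) h) / sin h`
decreasing, and it gives the sign of the kinks. -/
theorem mul_cos_mul_sin_lt (m : ℕ) (hm : 1 ≤ m) {h : ℝ} (h0 : 0 < h)
    (h1 : h ≤ Real.pi / (m + 1)) :
    (m + 1) * (Real.cos ((m + 1) * h) * Real.sin h) < Real.sin ((m + 1) * h) * Real.cos h := by
  have hm' : (1 : ℝ) ≤ m := by exact_mod_cast hm
  set N : ℝ → ℝ := fun h =>
    (m + 1) * (Real.cos ((m + 1) * h) * Real.sin h) - Real.sin ((m + 1) * h) * Real.cos h with hN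
  have hd : ∀ h, HasDerivAt N (-(((m : ℝ) + 1) ^ 2 - 1) * (Real.sin ((m + 1) * h) * Real.sin h)) h := by
    intro h
    have := (((hasDerivAt_cos_mul (m + 1) h).mul (Real.hasDerivAt_sin h)).const_mul ((m : ℝ) + 1)).sub
      ((hasDerivAt_sin_mul (m + 1) h).mul (Real.hasDerivAt_cos h))
    refine this.congr_deriv ?_
    ring
  have hanti : StrictAntiOn N (Icc 0 (Real.pi / (m + 1))) := by
    refine strictAntiOn_of_deriv_neg (convex_Icc _ _)
      (fun x _ => (hd x).continuousAt.continuousWithinAt) fun x hx => ?_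
    rw [interior_Icc] at hx
    rw [(hd x).deriv]
    have k1 : 0 < Real.sin x := Real.sin_pos_of_pos_of_lt_pi hx.1
      (hx.2.trans (div_lt_self Real.pi_pos (by linarith)))
    have k2 : 0 < Real.sin ((m + 1) * x) := by
      refine Real.sin_pos_of_pos_of_lt_pi (mul_pos (by linarith) hx.1) ?_
      have := (lt_div_iff₀ (by linarith)).mp hx.2
      linarith
    have k3 : (0 : ℝ) < (m + 1) ^ 2 - 1 := by nlinarith
    nlinarith [mul_pos k3 (mul_pos k2 k1)]
  have := hanti ⟨le_rfl, h0.le.trans h1⟩ ⟨h0.le, h1⟩ h0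
  simp only [hN, mul_zero, Real.sin_zero, Real.cos_zero, zero_mul, sub_zero] at this
  linarith

/-- The ratio `sin ((m + 1) h) / sin h` decreases strictly from the limit `m + 1` to `0`, so it
takes the intermediate value `(2 m + 1) / 2` exactly once. -/
theorem exists_unique_kink (m : ℕ) (hm : 1 ≤ m) : ∃ h₀ : ℝ, 0 < h₀ ∧ h₀ < Real.pi / (m + 1) ∧
    2 * Real.sin ((m + 1) * h₀) = (2 * m + 1) * Real.sin h₀ ∧
    ∀ h, 0 < h → h ≤ Real.pi / (m + 1) →
      2 * Real.sin ((m + 1) * h) = (2 * m + 1) * Real.sin h → h = h₀ := by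
  have hm' : (1 : ℝ) ≤ m := by exact_mod_cast hm
  set b := Real.pi / (m + 1) with hb
  have hb0 : 0 < b := div_pos Real.pi_pos (by linarith)
  have hbpi : b < Real.pi := div_lt_self Real.pi_pos (by linarith)
  have hsin : ∀ h, 0 < h → h ≤ b → 0 < Real.sin h := fun h h0 h1 =>
    Real.sin_pos_of_pos_of_lt_pi h0 (h1.trans_lt hbpi)
  set F : ℝ → ℝ := fun h => Real.sin ((m + 1) * h) / Real.sin h with hF
  have hanti : StrictAntiOn F (Ioc 0 b) := by
    have hd : ∀ x ∈ Ioc 0 b, HasDerivAt F (((m + 1) * Real.cos ((m + 1) * x) * Real.sin x -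
        Real.sin ((m + 1) * x) * Real.cos x) / Real.sin x ^ 2) x := fun x hx =>
      (hasDerivAt_sin_mul (m + 1) x).div (Real.hasDerivAt_sin x) (hsin x hx.1 hx.2).ne'
    refine strictAntiOn_of_deriv_neg (convex_Ioc _ _)
      (fun x hx => (hd x hx).continuousAt.continuousWithinAt) fun x hx => ?_
    rw [interior_Ioc] at hx
    rw [(hd x ⟨hx.1, hx.2.le⟩).deriv]
    refine div_neg_of_neg_of_pos ?_ (pow_pos (hsin x hx.1 hx.2.le) 2)
    have := mul_cos_mul_sin_lt m hm hx.1 hx.2.le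
    linarith
  have hsol : ∀ h, 0 < h → h ≤ b → (2 * Real.sin ((m + 1) * h) = (2 * m + 1) * Real.sin h ↔
      F h = (2 * m + 1) / 2) := by
    intro h h0 h1
    rw [hF, div_eq_iff (hsin h h0 h1).ne']
    constructor <;> intro h <;> linarith
  -- The derivative at `0` of the difference is `2 (m + 1) - (2 m + 1) = 1`, which provides a
  -- positive value near `0`.
  obtain ⟨δ, hδ, hδb, hδ'⟩ : ∃ δ, 0 < δ ∧ δ < b ∧
      (2 * m + 1) * Real.sin δ < 2 * Real.sin ((m + 1) * δ) := by
    have hd : HasDerivAt (fun h => 2 * Real.sin ((m + 1) * h) - (2 * m + 1) * Real.sin h) 1 0 := by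
      have := ((hasDerivAt_sin_mul (m + 1) 0).const_mul 2).fun_sub
        ((Real.hasDerivAt_sin 0).const_mul (2 * (m : ℝ) + 1))
      refine this.congr_deriv ?_
      simp
      ring
    have := (eventually_lt_of_deriv_pos hd one_pos).filter_mono (nhdsWithin_le_nhds (s := Ioi 0))
    obtain ⟨δ, h1, h2⟩ := (this.and (Ioo_mem_nhdsGT hb0)).exists
    refine ⟨δ, h2.1, h2.2, ?_⟩
    have := h1.1 h2.1
    simp only [mul_zero, Real.sin_zero, sub_self, sub_pos] at this
    exact this
  have hcont : ContinuousOn (fun h => 2 * Real.sin ((m + 1) * h) - (2 * m + 1) * Real.sin h)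
      (Icc δ b) := by fun_prop
  have hbneg : 2 * Real.sin ((m + 1) * b) - (2 * m + 1) * Real.sin b < 0 := by
    rw [hb, mul_div_cancel₀ _ (by linarith : (m : ℝ) + 1 ≠ 0), Real.sin_pi]
    have := hsin b hb0 le_rfl
    nlinarith
  obtain ⟨h₀, hh, he⟩ := intermediate_value_Icc' hδb.le hcont ⟨hbneg.le, (sub_pos.mpr hδ').le⟩
  have h00 : 0 < h₀ := hδ.trans_le hh.1
  refine ⟨h₀, h00, lt_of_le_of_ne hh.2 ?_, by simp only at he; linarith, fun h k0 k1 k => ?_⟩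
  · rintro rfl
    exact hbneg.ne he
  · refine hanti.injOn ⟨k0, k1⟩ ⟨h00, hh.2⟩ ?_
    rw [(hsol h k0 k1).mp k, (hsol h₀ h00 hh.2).mp (by simp only at he; linarith)]

/-- The solutions of the kink equation in `(0, π / 2]`. -/
theorem eq_of_kink_equation {m : ℕ} (hm : 1 ≤ m) {h₀ : ℝ}
    (huniq : ∀ h, 0 < h → h ≤ Real.pi / (m + 1) →
      2 * Real.sin ((m + 1) * h) = (2 * m + 1) * Real.sin h → h = h₀) {h σ : ℝ} (h0 : 0 < h)
    (h1 : h ≤ Real.pi / 2) (hσ : σ = 1 ∨ σ = -1)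
    (he : (2 * m + 1) * Real.sin h + 2 * σ * Real.sin ((m + 1) * h) = 0) :
    σ = -1 ∧ h = h₀ := by
  have hm' : (1 : ℝ) ≤ m := by exact_mod_cast hm
  have hpi := Real.pi_pos
  have hle : (2 * m + 1) * Real.sin h ≤ 2 := by
    have a1 := Real.sin_le_one ((m + 1) * h)
    have a2 := Real.neg_one_le_sin ((m + 1) * h)
    rcases hσ with rfl | rfl <;> linarith
  -- Jordan's inequality together with `(2 m + 1) sin h ≤ 2` forces `h ≤ π / (2 m + 1)`, inside the
  -- interval of uniqueness; there both sines are positive, which excludes `σ = 1`.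
  have hj : 2 / Real.pi * h ≤ Real.sin h := Real.mul_le_sin h0.le h1
  have hb : h ≤ Real.pi / (2 * m + 1) := by
    rw [le_div_iff₀ (by linarith)]
    have : 2 / Real.pi * h * (2 * m + 1) ≤ 2 := by nlinarith
    have h3 : 2 / Real.pi * h * (2 * m + 1) = 2 * (h * (2 * m + 1)) / Real.pi := by ring
    rw [h3, div_le_iff₀ hpi] at this
    linarith
  have hb' : h < Real.pi / (m + 1) :=
    hb.trans_lt (div_lt_div_of_pos_left hpi (by linarith) (by linarith))
  have hs1 : 0 < Real.sin h := Real.sin_pos_of_pos_of_lt_pi h0 (by linarith)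
  have hs2 : 0 < Real.sin ((m + 1) * h) := by
    refine Real.sin_pos_of_pos_of_lt_pi (mul_pos (by linarith) h0) ?_
    have := (lt_div_iff₀ (by linarith)).mp hb'
    linarith
  rcases hσ with rfl | rfl
  · nlinarith
  · exact ⟨rfl, huniq h h0 hb'.le (by linarith)⟩

theorem cos_int_mul_pi_eq (k : ℤ) :
    (Real.cos (k * Real.pi) = 1 ∧ Even k) ∨ (Real.cos (k * Real.pi) = -1 ∧ Odd k) := by
  rcases Int.even_or_odd k with h | h
  · exact Or.inl ⟨by rw [Real.cos_int_mul_pi, h.neg_one_zpow], h⟩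
  · exact Or.inr ⟨by rw [Real.cos_int_mul_pi, h.neg_one_zpow], h⟩

/-- The first condition of `epitrochoid_eq_iff` puts the midpoint at `k π / m`, since the second one
prevents `sin ((m + 1) h)` from vanishing. The kinks are the odd `k` with half-width `h₀`. -/
theorem bijOn_kinkedCircle {m : ℕ} (hm : 1 ≤ m) {h₀ : ℝ} (h0 : 0 < h₀)
    (h1 : h₀ < Real.pi / (m + 1))
    (he : 2 * Real.sin ((m + 1) * h₀) = (2 * m + 1) * Real.sin h₀)
    (huniq : ∀ h, 0 < h → h ≤ Real.pi / (m + 1) →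
      2 * Real.sin ((m + 1) * h) = (2 * m + 1) * Real.sin h → h = h₀) :
    BijOn (fun j : ℕ => ((2 * j + 1) * Real.pi / m - h₀, (2 * j + 1) * Real.pi / m + h₀))
      (Finset.range m : Finset ℕ) (doublePairs (kinkedCircle m)) := by
  have hpi := Real.pi_pos
  have hm' : (1 : ℝ) ≤ m := by exact_mod_cast hm
  have hm0 : (0 : ℝ) < m := by linarith
  have hlt : Real.pi / (m + 1) < Real.pi / m := div_lt_div_of_pos_left hpi hm0 (by linarith)
  have hh : h₀ < Real.pi / m := h1.trans hlt
  rw [kinkedCircle_eq]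
  refine ⟨fun j hj => ?_, fun j _ k _ hjk => ?_, ?_⟩
  · rw [Finset.mem_coe, Finset.mem_range] at hj
    have hj' : (j : ℝ) + 1 ≤ m := by exact_mod_cast hj
    have hj0 : (0 : ℝ) ≤ j := Nat.cast_nonneg j
    have k1 : Real.pi / m ≤ (2 * j + 1) * Real.pi / m := by
      rw [div_le_div_iff_of_pos_right hm0]
      nlinarith
    have k2 : (2 * j + 1) * Real.pi / m ≤ 2 * Real.pi - Real.pi / m := by
      rw [div_le_iff₀ hm0, sub_mul, div_mul_cancel₀ _ hm0.ne']
      nlinarith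
    refine ⟨by dsimp only; linarith, by dsimp only; linarith, by dsimp only; linarith, ?_⟩
    refine (epitrochoid_eq_iff m _ _ _).mpr ?_
    have hj1 : (m : ℝ) * ((2 * j + 1) * Real.pi / m) = Real.pi + j * (2 * Real.pi) := by
      field_simp
      ring
    rw [hj1, Real.sin_add_nat_mul_two_pi, Real.cos_add_nat_mul_two_pi, Real.sin_pi, Real.cos_pi]
    exact ⟨by ring, by linarith⟩
  · simp only [Prod.mk.injEq, sub_left_inj] at hjk
    have := (div_left_inj' hm0.ne').mp hjk.1
    have := mul_right_cancel₀ hpi.ne' this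
    have : (j : ℝ) = k := by linarith
    exact_mod_cast this
  · rintro ⟨s, t⟩ ⟨k1, k2, k3, k4⟩
    dsimp only at k1 k2 k3 k4
    obtain ⟨u, hu⟩ : ∃ u, u = (s + t) / 2 := ⟨_, rfl⟩
    obtain ⟨h, hh'⟩ : ∃ h, h = (t - s) / 2 := ⟨_, rfl⟩
    obtain rfl : s = u - h := by rw [hu, hh']; ring
    obtain rfl : t = u + h := by linarith
    have hpos : 0 < h := by linarith
    have hlt' : h < Real.pi := by linarith
    obtain ⟨e1, e2⟩ := (epitrochoid_eq_iff m _ _ _).mp k4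
    have hsin := Real.sin_pos_of_pos_of_lt_pi hpos hlt'
    have hne : Real.sin ((m + 1) * h) ≠ 0 := by
      intro h0
      rw [h0, mul_zero, add_zero] at e2
      exact (mul_pos (by linarith : (0 : ℝ) < 2 * m + 1) hsin).ne' e2
    obtain ⟨k, hk⟩ := Real.sin_eq_zero_iff.mp ((mul_eq_zero.mp e1).resolve_left hne)
    have huk : u = k * Real.pi / m := by rw [hk]; field_simp
    rw [← hk] at e2
    have hcos := cos_int_mul_pi_eq k
    have hσ : Real.cos (k * Real.pi) = 1 ∨ Real.cos (k * Real.pi) = -1 :=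
      hcos.imp (fun h => h.1) fun h => h.1
    rcases le_or_gt h (Real.pi / 2) with hle | hgt
    · obtain ⟨a1, rfl⟩ := eq_of_kink_equation hm huniq hpos hle hσ e2
      rcases hcos with ⟨b1, -⟩ | ⟨-, b⟩
      · exact absurd (a1.symm.trans b1) (by norm_num)
      obtain ⟨j, rfl⟩ := b
      have c1 : (0 : ℝ) < (2 * j + 1 : ℤ) := by
        by_contra! hneg
        have : ((2 * j + 1 : ℤ) : ℝ) * Real.pi / m ≤ 0 :=
          div_nonpos_of_nonpos_of_nonneg (mul_nonpos_of_nonpos_of_nonneg hneg hpi.le) hm0.le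
        linarith
      have c2 : ((2 * j + 1 : ℤ) : ℝ) < 2 * m := by
        have : ((2 * j + 1 : ℤ) : ℝ) * Real.pi / m < 2 * Real.pi := by linarith
        rw [div_lt_iff₀ hm0] at this
        nlinarith
      have d1 : 0 < 2 * j + 1 := by exact_mod_cast c1
      have d2 : 2 * j + 1 < 2 * m := by exact_mod_cast c2
      lift j to ℕ using by omega
      refine ⟨j, by simp only [Finset.coe_range, mem_Iio]; omega, ?_⟩
      rw [huk]
      push_cast
      rfl
    -- For `h > π / 2`, `π - h` solves the kink equation with the sign `cos (k π) (-1) ^ m`. This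
    -- sign must be `-1`, so `k ≠ m` and the midpoint is at distance at least `π / m > h₀` from `π`;
    -- but both parameters lie in one period, which requires a distance of at most `π - h = h₀`.
    · exfalso
      have e3 : Real.sin ((m + 1) * h) =
          -((-1) ^ (m + 1) * Real.sin ((m + 1) * (Real.pi - h))) := by
        rw [show ((m : ℝ) + 1) * h = ((m + 1 : ℕ) : ℝ) * Real.pi - (m + 1) * (Real.pi - h) by
          push_cast; ring, Real.sin_nat_mul_pi_sub]
      rw [e3, ← Real.sin_pi_sub h] at e2
      have hm1 : ((-1 : ℝ) ^ m = 1 ∧ Even m) ∨ ((-1 : ℝ) ^ m = -1 ∧ Odd m) := by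
        rcases Nat.even_or_odd m with h | h
        · exact Or.inl ⟨h.neg_one_pow, h⟩
        · exact Or.inr ⟨h.neg_one_pow, h⟩
      have hσ' : Real.cos (k * Real.pi) * (-1) ^ m = 1 ∨ Real.cos (k * Real.pi) * (-1) ^ m = -1 := by
        rcases hσ with a | a <;> rcases hm1 with ⟨b, -⟩ | ⟨b, -⟩ <;> rw [a, b] <;> norm_num
      obtain ⟨a1, a2⟩ := eq_of_kink_equation hm huniq (h := Real.pi - h) (by linarith) (by linarith) hσ'
        (by rw [pow_succ] at e2; linarith)
      have hkm : k ≠ m := by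
        rintro rfl
        rcases hcos with ⟨b1, b2⟩ | ⟨b1, b2⟩ <;> rcases hm1 with ⟨d1, d2⟩ | ⟨d1, d2⟩
        · rw [b1, d1] at a1; norm_num at a1
        · exact (Int.not_even_iff_odd.mpr (by exact_mod_cast d2)) b2
        · exact (Int.not_even_iff_odd.mpr b2) (by exact_mod_cast d2)
        · rw [b1, d1] at a1; norm_num at a1
      have hup : u = Real.pi + (k - m) * (Real.pi / m) := by
        rw [huk]; field_simp; ring
      have hq : 0 < Real.pi / m := div_pos hpi hm0
      rcases lt_or_gt_of_ne hkm with hlt1 | hlt1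
      · have : (k : ℝ) + 1 ≤ m := by exact_mod_cast hlt1
        nlinarith
      · have : (m : ℝ) + 1 ≤ k := by exact_mod_cast hlt1
        nlinarith

theorem cross_deriv_epitrochoid (m : ℕ) (c s t : ℝ) :
    cross (deriv (epitrochoid m c) s) (deriv (epitrochoid m c) t) =
      c ^ 2 * Real.sin (t - s) + 4 * (m + 1) ^ 2 * Real.sin ((m + 1) * t - (m + 1) * s) +
      2 * c * (m + 1) * (Real.sin ((m + 1) * t - s) + Real.sin (t - (m + 1) * s)) := by
  rw [(hasDerivAt_epitrochoid m c s).deriv, (hasDerivAt_epitrochoid m c t).deriv]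
  unfold cross
  dsimp only
  rw [Real.sin_sub, Real.sin_sub, Real.sin_sub, Real.sin_sub]
  ring

theorem cross_deriv_kink {m : ℕ} (hm : 1 ≤ m) {h₀ : ℝ}
    (he : 2 * Real.sin ((m + 1) * h₀) = (2 * m + 1) * Real.sin h₀) (j : ℕ) :
    cross (deriv (kinkedCircle m) ((2 * j + 1) * Real.pi / m - h₀))
        (deriv (kinkedCircle m) ((2 * j + 1) * Real.pi / m + h₀)) =
      -(2 * m * (2 * m + 1) * Real.sin h₀ *
        ((2 * m + 1) * Real.cos h₀ - 2 * (m + 1) * Real.cos ((m + 1) * h₀))) := by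
  have hm0 : (m : ℝ) ≠ 0 := by positivity
  rw [kinkedCircle_eq, cross_deriv_epitrochoid]
  have e : (m : ℝ) * ((2 * j + 1) * Real.pi / m) = j * (2 * Real.pi) + Real.pi := by
    field_simp
  set u := (2 * j + 1) * Real.pi / m with hu
  rw [show u + h₀ - (u - h₀) = 2 * h₀ by ring,
    show (m + 1) * (u + h₀) - (m + 1) * (u - h₀) = 2 * ((m + 1) * h₀) by ring,
    show (m + 1) * (u + h₀) - (u - h₀) = (m + 1) * h₀ + h₀ + m * u by ring,
    show u + h₀ - (m + 1) * (u - h₀) = (m + 1) * h₀ + h₀ - m * u by ring, e,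
    ← add_assoc, ← sub_sub, Real.sin_add_pi, Real.sin_sub_pi, Real.sin_add_nat_mul_two_pi,
    Real.sin_sub_nat_mul_two_pi, Real.sin_two_mul, Real.sin_two_mul, Real.sin_add]
  have he' : Real.sin ((m + 1) * h₀) = (2 * m + 1) * Real.sin h₀ / 2 := by linarith
  rw [he']
  ring

theorem arnold_kinkedCircle (m : ℕ) : Jplus (kinkedCircle m) = -2 * m ∧
    Jminus (kinkedCircle m) = -3 * m ∧ St (kinkedCircle m) = m := by
  have hpi := Real.pi_pos
  have key : sepSubNest (kinkedCircle m) = (m : ℝ) * (m - 1) / 2 ∧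
      interSum (kinkedCircle m) = 0 ∧ doubleCount (kinkedCircle m) = m := by
    rcases Nat.eq_zero_or_pos m with rfl | hm
    · refine arnold_of_separated (f := fun _ => 0) (e := 1) ?_ (by omega) (by omega) (by norm_num)
      rw [kinkedCircle_eq]
      convert bijOn_empty _
      · simp
      · rw [eq_empty_iff_forall_notMem]
        rintro ⟨s, t⟩ ⟨k1, k2, k3, k4⟩
        dsimp only at k1 k2 k3 k4
        have e2 := ((epitrochoid_eq_iff 0 (2 * ((0 : ℕ) : ℝ) + 1) ((s + t) / 2) ((t - s) / 2)).mp (by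
          convert k4 using 2 <;> ring)).2
        have := Real.sin_pos_of_pos_of_lt_pi (x := (t - s) / 2) (by linarith) (by linarith)
        simp at e2
        linarith
    · have hm' : (1 : ℝ) ≤ m := by exact_mod_cast hm
      have hm0 : (0 : ℝ) < m := by linarith
      obtain ⟨h₀, h0, h1, he, huniq⟩ := exists_unique_kink m hm
      have hh : h₀ < Real.pi / m :=
        h1.trans (div_lt_div_of_pos_left hpi hm0 (by linarith))
      refine arnold_of_separated (e := -1) (bijOn_kinkedCircle hm h0 h1 he huniq) ?_ ?_ (by norm_num)
      · intro j k hjk _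
        dsimp only
        have : (j : ℝ) + 1 ≤ k := by exact_mod_cast hjk
        have h2 : (2 * j + 1) * Real.pi / m + 2 * (Real.pi / m) ≤ (2 * k + 1) * Real.pi / m := by
          rw [mul_div_assoc, mul_div_assoc]
          have := div_pos hpi hm0
          nlinarith
        linarith
      · intro j _
        unfold doubleSign
        rw [cross_deriv_kink hm he]
        apply Real.sign_of_neg
        have hs : 0 < Real.sin h₀ := Real.sin_pos_of_pos_of_lt_pi h0
          (h1.trans (div_lt_self hpi (by linarith)))
        have := mul_cos_mul_sin_lt m hm h0 h1.le
        -- The inequality of `mul_cos_mul_sin_lt`, with `sin ((m + 1) h₀)` eliminated by the kink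
        -- equation.
        have hp : 0 < (2 * m + 1) * Real.cos h₀ - 2 * (m + 1) * Real.cos ((m + 1) * h₀) := by
          by_contra! hneg
          have h2 := mul_nonneg hs.le (sub_nonneg.mpr (sub_nonpos.mp hneg))
          have h3 := congrArg (· * Real.cos h₀) he
          linarith
        rw [neg_lt_zero]
        positivity
  obtain ⟨h1, h2, h3⟩ := key
  have hJ : Jplus (kinkedCircle m) = -2 * m := by
    rw [Jplus_eq, h1, h2, h3, whitneyIndex_kinkedCircle]; ring
  refine ⟨hJ, ?_, ?_⟩
  · rw [Jminus_eq, hJ, h3]; ring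
  · rw [St_eq, hJ, h2]; ring

end KinkedCircle

end PlaneCurves

namespace PlaneCurves

open Set Filter Topology

/-! ### The curves `Gamma n` and their Gauss diagrams -/

section Gamma

theorem Gamma_eq (n : ℕ) (s : ℝ) : Gamma n s =
    ⟨(2 + Real.cos (n * s)) * Real.cos ((n + 1) * s),
      (2 + Real.cos (n * s)) * Real.sin ((n + 1) * s)⟩ := by
  unfold Gamma
  apply Complex.ext
  · rw [Complex.re_ofReal_mul, Complex.exp_ofReal_mul_I_re]
  · rw [Complex.im_ofReal_mul, Complex.exp_ofReal_mul_I_im]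

theorem hasDerivAt_Gamma (n : ℕ) (s : ℝ) : HasDerivAt (Gamma n)
    ⟨-(n * Real.sin (n * s)) * Real.cos ((n + 1) * s) -
        (n + 1) * (2 + Real.cos (n * s)) * Real.sin ((n + 1) * s),
      -(n * Real.sin (n * s)) * Real.sin ((n + 1) * s) +
        (n + 1) * (2 + Real.cos (n * s)) * Real.cos ((n + 1) * s)⟩ s := by
  have h1 := (hasDerivAt_cos_mul n s).const_add 2
  have := hasDerivAt_complex_mk (h1.fun_mul (hasDerivAt_cos_mul (n + 1) s))
    (h1.fun_mul (hasDerivAt_sin_mul (n + 1) s))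
  rw [show Gamma n = fun s => ⟨(2 + Real.cos (n * s)) * Real.cos ((n + 1) * s),
      (2 + Real.cos (n * s)) * Real.sin ((n + 1) * s)⟩ from funext (Gamma_eq n)]
  refine this.congr_deriv ?_
  apply Complex.ext <;> dsimp only <;> ring

theorem two_add_cos_pos (x : ℝ) : 0 < 2 + Real.cos x := by
  linarith [Real.neg_one_le_cos x]

theorem isPlaneCurve_Gamma (n : ℕ) : IsPlaneCurve (Gamma n) where
  smooth := by
    rw [show Gamma n = fun s => ⟨(2 + Real.cos (n * s)) * Real.cos ((n + 1) * s),
      (2 + Real.cos (n * s)) * Real.sin ((n + 1) * s)⟩ from funext (Gamma_eq n)]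
    have h1 : ContDiff ℝ ∞ fun s : ℝ => (n : ℝ) * s := by fun_prop
    have h2 : ContDiff ℝ ∞ fun s : ℝ => ((n : ℝ) + 1) * s := by fun_prop
    have h3 := contDiff_const (c := (2 : ℝ)).add (Real.contDiff_cos.comp h1)
    exact contDiff_complex_mk (h3.mul (Real.contDiff_cos.comp h2))
      (h3.mul (Real.contDiff_sin.comp h2))
  periodic s := by
    have h1 := Real.cos_periodic.nat_mul n (n * s)
    have h2 := Real.cos_periodic.nat_mul (n + 1) ((n + 1) * s)
    have h3 := Real.sin_periodic.nat_mul (n + 1) ((n + 1) * s)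
    push_cast at h1 h2 h3
    rw [Gamma_eq, Gamma_eq, mul_add, mul_add, h1, h2, h3]
  immersed s h := by
    rw [(hasDerivAt_Gamma n s).deriv, Complex.ext_iff] at h
    obtain ⟨h1, h2⟩ := h
    simp only [Complex.zero_re, Complex.zero_im] at h1 h2
    have e := Real.sin_sq_add_cos_sq ((n + 1) * s)
    have h3 : ((n : ℝ) + 1) * (2 + Real.cos (n * s)) = 0 := by
      linear_combination Real.cos ((n + 1) * s) * h2 - Real.sin ((n + 1) * s) * h1 -
        ((n : ℝ) + 1) * (2 + Real.cos (n * s)) * e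
    have := two_add_cos_pos (n * s)
    have : (0 : ℝ) < ((n : ℝ) + 1) * (2 + Real.cos (n * s)) := by positivity
    linarith

/-- The radius `2 + cos` is positive, so polar coordinates determine the point up to full turns of
the angle. -/
theorem Gamma_eq_iff (n : ℕ) (s t : ℝ) : Gamma n s = Gamma n t ↔
    Real.cos (n * s) = Real.cos (n * t) ∧ Real.cos ((n + 1) * s) = Real.cos ((n + 1) * t) ∧
      Real.sin ((n + 1) * s) = Real.sin ((n + 1) * t) := by
  rw [Gamma_eq, Gamma_eq, Complex.ext_iff]
  dsimp only
  constructor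
  · rintro ⟨h1, h2⟩
    have r1 := two_add_cos_pos (n * s)
    have r2 := two_add_cos_pos (n * t)
    have e1 := Real.sin_sq_add_cos_sq ((n + 1) * s)
    have e2 := Real.sin_sq_add_cos_sq ((n + 1) * t)
    have hr : (2 + Real.cos (n * s)) ^ 2 = (2 + Real.cos (n * t)) ^ 2 := by
      have k1 := congrArg (· ^ 2) h1
      have k2 := congrArg (· ^ 2) h2
      simp only [mul_pow] at k1 k2
      linear_combination k1 + k2 - (2 + Real.cos (n * s)) ^ 2 * e1 +
        (2 + Real.cos (n * t)) ^ 2 * e2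
    have hr' := (pow_left_inj₀ r1.le r2.le two_ne_zero).mp hr
    rw [hr'] at h1 h2
    exact ⟨by linarith, mul_left_cancel₀ r2.ne' h1, mul_left_cancel₀ r2.ne' h2⟩
  · rintro ⟨h1, h2, h3⟩
    rw [h1, h2, h3]
    exact ⟨rfl, rfl⟩

/-- At a double point the two velocities have equal angular components and differ only in the radial
one. -/
theorem cross_deriv_Gamma {n : ℕ} {s t : ℝ} (h : Gamma n s = Gamma n t) :
    cross (deriv (Gamma n) s) (deriv (Gamma n) t) =
      n * (n + 1) * (2 + Real.cos (n * s)) * (Real.sin (n * t) - Real.sin (n * s)) := by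
  obtain ⟨h1, h2, h3⟩ := (Gamma_eq_iff n s t).mp h
  rw [(hasDerivAt_Gamma n s).deriv, (hasDerivAt_Gamma n t).deriv]
  unfold cross
  dsimp only
  rw [← h1, ← h2, ← h3]
  linear_combination (n * (n + 1) * (2 + Real.cos (n * s)) *
    (Real.sin (n * t) - Real.sin (n * s))) * Real.sin_sq_add_cos_sq ((n + 1) * s)

/-- The chords of `Gamma n` are indexed by the pairs `x < y` in `[0, 2 n]` of the same parity. -/
noncomputable def gammaChord (n : ℕ) (c : ℕ × ℕ) : ℝ × ℝ :=
  (((2 * n + 1) * c.1 + c.2) * (Real.pi / (2 * n * (n + 1))),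
    ((2 * n + 1) * c.2 + c.1) * (Real.pi / (2 * n * (n + 1))))

/-- The pairs `x < y` in `[0, 2 n]` of the same parity. -/
def gammaIndex (n : ℕ) : Finset (ℕ × ℕ) :=
  (Finset.range (2 * n + 1) ×ˢ Finset.range (2 * n + 1)).filter
    fun c => c.1 < c.2 ∧ c.1 % 2 = c.2 % 2

theorem mem_gammaIndex {n : ℕ} {c : ℕ × ℕ} :
    c ∈ gammaIndex n ↔ c.1 < c.2 ∧ c.2 ≤ 2 * n ∧ c.1 % 2 = c.2 % 2 := by
  simp only [gammaIndex, Finset.mem_filter, Finset.mem_product, Finset.mem_range]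
  omega

theorem mul_add_lt_iff {M u v u' v' : ℕ} (h : v < M) (h' : v' < M) :
    M * u + v < M * u' + v' ↔ u < u' ∨ u = u' ∧ v < v' := by
  rcases lt_trichotomy u u' with hu | rfl | hu
  · have : M * (u + 1) ≤ M * u' := Nat.mul_le_mul_left M hu
    rw [mul_add, mul_one] at this
    exact iff_of_true (by omega) (Or.inl hu)
  · simp
  · have : M * (u' + 1) ≤ M * u := Nat.mul_le_mul_left M hu
    rw [mul_add, mul_one] at this
    exact iff_of_false (by omega) (by omega)

/-- In units of `π / (2 n (n + 1))` an endpoint is the number with digits `u`, `v` in base `2 n +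
1`; the order along the curve is therefore lexicographic. -/
theorem gamma_lt_iff {n : ℕ} (hn : 1 ≤ n) {u v u' v' : ℕ} (h : v ≤ 2 * n) (h' : v' ≤ 2 * n) :
    ((2 * n + 1) * u + v : ℝ) * (Real.pi / (2 * n * (n + 1))) <
      ((2 * n + 1) * u' + v' : ℝ) * (Real.pi / (2 * n * (n + 1))) ↔
      u < u' ∨ u = u' ∧ v < v' := by
  have hn' : (0 : ℝ) < n := by exact_mod_cast hn
  rw [mul_lt_mul_iff_left₀ (by have := Real.pi_pos; positivity),
    ← mul_add_lt_iff (M := 2 * n + 1) (by omega) (by omega)]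
  norm_cast

theorem sum_gammaChord {n : ℕ} (hn : 1 ≤ n) (c : ℕ × ℕ) :
    n * ((gammaChord n c).1 + (gammaChord n c).2) = (c.1 + c.2) * Real.pi ∧
    (n + 1) * ((gammaChord n c).2 - (gammaChord n c).1) = (c.2 - c.1) * Real.pi := by
  have hn' : (0 : ℝ) < n := by exact_mod_cast hn
  unfold gammaChord
  constructor
  · field_simp
    ring
  · field_simp
    ring

theorem gammaChord_mem {n : ℕ} (hn : 1 ≤ n) {c : ℕ × ℕ} (hc : c ∈ gammaIndex n) :
    gammaChord n c ∈ doublePairs (Gamma n) := by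
  have hn' : (1 : ℝ) ≤ n := by exact_mod_cast hn
  have hpi := Real.pi_pos
  obtain ⟨h1, h2, h3⟩ := mem_gammaIndex.mp hc
  obtain ⟨e1, e2⟩ := sum_gammaChord hn c
  refine ⟨?_, ?_, ?_, ?_⟩
  · unfold gammaChord
    positivity
  · exact (gamma_lt_iff hn (by omega) (by omega)).mpr (Or.inl h1)
  · unfold gammaChord
    dsimp only
    rw [mul_div_assoc', div_lt_iff₀ (by positivity)]
    have k1 : (c.1 : ℝ) + 1 ≤ c.2 := by exact_mod_cast h1
    have k2 : (c.2 : ℝ) ≤ 2 * n := by exact_mod_cast h2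
    have : (2 * n + 1) * (c.2 : ℝ) + c.1 < 4 * n * (n + 1) := by nlinarith
    nlinarith
  · rw [Gamma_eq_iff]
    obtain ⟨l, hl⟩ : ∃ l, c.2 = c.1 + 2 * l := ⟨(c.2 - c.1) / 2, by omega⟩
    have hl' : (c.2 : ℝ) = c.1 + 2 * l := by exact_mod_cast hl
    rw [hl'] at e1 e2
    have a1 : (n + 1) * (gammaChord n c).2 = (n + 1) * (gammaChord n c).1 + l * (2 * Real.pi) := by
      linarith
    have a2 : n * (gammaChord n c).2 = ((c.1 + l : ℕ) : ℝ) * (2 * Real.pi) - n * (gammaChord n c).1 := by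
      push_cast; linarith
    rw [a1, a2, Real.cos_add_nat_mul_two_pi, Real.sin_add_nat_mul_two_pi,
      Real.cos_nat_mul_two_pi_sub]
    exact ⟨rfl, rfl, rfl⟩

theorem bijOn_gammaChord {n : ℕ} (hn : 1 ≤ n) :
    BijOn (gammaChord n) (gammaIndex n) (doublePairs (Gamma n)) := by
  have hn' : (1 : ℝ) ≤ n := by exact_mod_cast hn
  have hpi := Real.pi_pos
  refine ⟨fun c hc => gammaChord_mem hn hc, fun c hc d hd hcd => ?_, ?_⟩
  · obtain ⟨h1, h2, -⟩ := mem_gammaIndex.mp hc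
    obtain ⟨k1, k2, -⟩ := mem_gammaIndex.mp hd
    have e := congrArg Prod.fst hcd
    have l1 := (gamma_lt_iff hn h2 k2 (u := c.1) (u' := d.1)).not.mp e.not_lt
    have l2 := (gamma_lt_iff hn k2 h2 (u := d.1) (u' := c.1)).not.mp e.not_gt
    exact Prod.ext (by omega) (by omega)
  · rintro ⟨s, t⟩ ⟨k1, k2, k3, k4⟩
    dsimp only at k1 k2 k3 k4
    obtain ⟨h1, h2, h3⟩ := (Gamma_eq_iff n s t).mp k4
    obtain ⟨l, hl⟩ := Real.Angle.angle_eq_iff_two_pi_dvd_sub.mp (Real.Angle.cos_sin_inj h2.symm h3.symm)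
    obtain ⟨k, hk⟩ := Real.cos_eq_cos_iff.mp h1
    have hts : t - s < 2 * Real.pi := by linarith
    -- If the radial phases agree modulo `2π`, then `n (t - s)` and `(n + 1) (t - s)` are both
    -- multiples of `2π`, hence so is `t - s`, which is impossible in one period. Only opposite
    -- radial phases remain.
    rcases hk with hk | hk
    · exfalso
      have h4 : t - s = 2 * Real.pi * (l - k : ℤ) := by push_cast; linarith
      rw [h4] at hts
      have a1 : (0 : ℝ) < (l - k : ℤ) := by
        have : 0 < 2 * Real.pi * ((l - k : ℤ) : ℝ) := by linarith
        exact pos_of_mul_pos_right this (by positivity)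
      have a2 : ((l - k : ℤ) : ℝ) < 1 := by nlinarith
      have b1 : 0 < l - k := by exact_mod_cast a1
      have b2 : l - k < 1 := by exact_mod_cast a2
      omega
    have hl0 : 0 < l := by
      have : (0 : ℝ) < l := by
        have : 0 < 2 * Real.pi * (l : ℝ) := by rw [← hl]; nlinarith
        exact pos_of_mul_pos_right this (by positivity)
      exact_mod_cast this
    have hln : l < n + 1 := by
      have : (l : ℝ) < n + 1 := by
        have : 2 * Real.pi * (l : ℝ) < 2 * Real.pi * (n + 1) := by rw [← hl]; nlinarith
        exact lt_of_mul_lt_mul_left this (by positivity)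
      exact_mod_cast this
    have es : 2 * n * (n + 1) * s = 2 * Real.pi * (k * (n + 1) - l * n) := by
      linear_combination (n + 1 : ℝ) * hk - (n : ℝ) * hl
    have et : 2 * n * (n + 1) * t = 2 * Real.pi * (k * (n + 1) + l * n) := by
      linear_combination (n + 1 : ℝ) * hk + (n : ℝ) * hl
    have c1 : 0 ≤ k * (n + 1) - l * n := by
      have : (0 : ℝ) ≤ k * (n + 1) - l * n := by
        have : 0 ≤ 2 * Real.pi * (k * (n + 1) - l * n) := by rw [← es]; positivity
        exact nonneg_of_mul_nonneg_right this (by positivity)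
      exact_mod_cast this
    have c2 : k * (n + 1) + l * n < 2 * n * (n + 1) := by
      have : (k * (n + 1) + l * n : ℝ) < 2 * n * (n + 1) := by
        have : 2 * Real.pi * (k * (n + 1) + l * n) < 2 * Real.pi * (2 * n * (n + 1)) := by
          rw [← et]
          have : 0 < 2 * (n : ℝ) * (n + 1) := by positivity
          nlinarith
        exact lt_of_mul_lt_mul_left this (by positivity)
      exact_mod_cast this
    -- The labels are `x = k - l` and `y = k + l`. Integrality enters here: `k ≤ l - 1` would give
    -- `k (n + 1) - l n ≤ l - (n + 1) < 0`, and the upper bound is similar.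
    have c3 : 0 ≤ k - l := by
      by_contra! hneg
      nlinarith
    have c4 : k + l ≤ 2 * n := by
      by_contra! hneg
      nlinarith
    obtain ⟨x, hx⟩ := Int.eq_ofNat_of_zero_le c3
    obtain ⟨y, hy⟩ := Int.eq_ofNat_of_zero_le (by omega : 0 ≤ k + l)
    refine ⟨(x, y), mem_gammaIndex.mpr ⟨by dsimp only; omega, by dsimp only; omega,
      by dsimp only; omega⟩, ?_⟩
    have hx' : (k : ℝ) - l = x := by exact_mod_cast hx
    have hy' : (k : ℝ) + l = y := by exact_mod_cast hy
    unfold gammaChord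
    dsimp only
    rw [← hx', ← hy', mul_div_assoc', mul_div_assoc']
    refine Prod.ext ?_ ?_ <;> dsimp only
    · rw [div_eq_iff (by positivity)]
      linarith
    · rw [div_eq_iff (by positivity)]
      linarith

/-- By `cross_deriv_Gamma` the sign is that of `sin (n t) - sin (n s)`. With `c.2 = c.1 + 2 l`,
sum-to-product leaves a positive multiple of `-(-1) ^ l (-1) ^ (c.1 + l)`, because `0 < l < n + 1`.
-/
theorem sign_cross_gammaChord {n : ℕ} (hn : 1 ≤ n) {c : ℕ × ℕ} (hc : c ∈ gammaIndex n) :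
    doubleSign (Gamma n) (gammaChord n c) = -(-1) ^ c.1 := by
  have hn' : (1 : ℝ) ≤ n := by exact_mod_cast hn
  have hpi := Real.pi_pos
  have hmem := gammaChord_mem hn hc
  obtain ⟨h1, h2, h3⟩ := mem_gammaIndex.mp hc
  obtain ⟨e1, e2⟩ := sum_gammaChord hn c
  obtain ⟨l, hl⟩ : ∃ l, c.2 = c.1 + 2 * l := ⟨(c.2 - c.1) / 2, by omega⟩
  have hl' : (c.2 : ℝ) = c.1 + 2 * l := by exact_mod_cast hl
  rw [hl'] at e1 e2
  unfold doubleSign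
  rw [cross_deriv_Gamma hmem.2.2.2, Real.sin_sub_sin]
  have a1 : (n * (gammaChord n c).2 + n * (gammaChord n c).1) / 2 = ((c.1 + l : ℕ) : ℝ) * Real.pi := by
    push_cast; linarith
  have a2 : (n * (gammaChord n c).2 - n * (gammaChord n c).1) / 2 =
      l * Real.pi - l * Real.pi / (n + 1) := by
    have : (gammaChord n c).2 - (gammaChord n c).1 = 2 * l * Real.pi / (n + 1) := by
      rw [eq_div_iff (by positivity)]; linarith
    rw [← mul_sub, this]
    field_simp
    ring
  rw [a1, a2, Real.cos_nat_mul_pi, Real.sin_nat_mul_pi_sub]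
  have hl0 : (0 : ℝ) < l := by
    have : 0 < l := by omega
    exact_mod_cast this
  have hln : (l : ℝ) < n + 1 := by
    have : l < n + 1 := by omega
    exact_mod_cast this
  have hs : 0 < Real.sin (l * Real.pi / (n + 1)) := by
    refine Real.sin_pos_of_pos_of_lt_pi (by positivity) ?_
    rw [div_lt_iff₀ (by positivity)]
    nlinarith
  have hr := two_add_cos_pos (n * (gammaChord n c).1)
  have hK : 0 < n * (n + 1) * (2 + Real.cos (n * (gammaChord n c).1)) * 2 *
      Real.sin (l * Real.pi / (n + 1)) := by positivity
  have hsq : ((-1 : ℝ) ^ l) * (-1) ^ l = 1 := by rw [← mul_pow]; norm_num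
  have : n * (n + 1) * (2 + Real.cos (n * (gammaChord n c).1)) *
      (2 * -((-1) ^ l * Real.sin (l * Real.pi / (n + 1))) * (-1) ^ (c.1 + l)) =
      -(-1) ^ c.1 * (n * (n + 1) * (2 + Real.cos (n * (gammaChord n c).1)) * 2 *
      Real.sin (l * Real.pi / (n + 1))) := by
    rw [pow_add]
    linear_combination (-(-1) ^ c.1 * (n * (n + 1) * (2 + Real.cos (n * (gammaChord n c).1)) * 2 *
      Real.sin (l * Real.pi / (n + 1)))) * hsq
  rw [this]
  rcases neg_one_pow_eq_or ℝ c.1 with h | h <;> rw [h]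
  · rw [Real.sign_of_neg (by linarith)]
  · rw [Real.sign_of_pos (by linarith)]; norm_num

theorem isGenericCurve_Gamma {n : ℕ} (hn : 1 ≤ n) : IsGenericCurve (Gamma n) where
  toIsPlaneCurve := isPlaneCurve_Gamma n
  finite := by
    rw [← (bijOn_gammaChord hn).image_eq]
    exact (gammaIndex n).finite_toSet.image _
  transverse p hp h := by
    obtain ⟨c, hc, rfl⟩ := (bijOn_gammaChord hn).surjOn hp
    have := sign_cross_gammaChord hn hc
    unfold doubleSign at this
    rw [h, Real.sign_zero] at this
    exact neg_ne_zero.mpr (pow_ne_zero _ (by norm_num)) this.symm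
  no_triple s t u h := by
    obtain ⟨c, hc, hcs⟩ := (bijOn_gammaChord hn).surjOn h.1
    obtain ⟨d, hd, hds⟩ := (bijOn_gammaChord hn).surjOn h.2
    obtain ⟨h1, h2, -⟩ := mem_gammaIndex.mp hc
    obtain ⟨k1, k2, -⟩ := mem_gammaIndex.mp hd
    have e : (gammaChord n c).2 = (gammaChord n d).1 := by rw [hcs, hds]
    have l1 := (gamma_lt_iff hn (by omega) k2 (u := c.2) (v := c.1) (u' := d.1)).not.mp e.not_lt
    have l2 := (gamma_lt_iff hn k2 (by omega) (u := d.1) (u' := c.2) (v' := c.1)).not.mp e.not_gt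
    omega

/-- Ties between the leading digits are settled by the other label: equal first labels or equal
second labels still give interleaved chords, whereas `d.1 = c.2` does not. -/
theorem interleaved_gammaChord {n : ℕ} (hn : 1 ≤ n) {c d : ℕ × ℕ} (hc : c ∈ gammaIndex n)
    (hd : d ∈ gammaIndex n) : Interleaved (gammaChord n c) (gammaChord n d) ↔
      (c.1 ≤ d.1 ∧ d.1 < c.2 ∧ c.2 ≤ d.2) ∧ c ≠ d := by
  obtain ⟨h1, h2, -⟩ := mem_gammaIndex.mp hc
  obtain ⟨k1, k2, -⟩ := mem_gammaIndex.mp hd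
  have l1 := gamma_lt_iff hn h2 k2 (u := c.1) (u' := d.1)
  have l2 := gamma_lt_iff hn k2 (by omega) (u := d.1) (v' := c.1) (u' := c.2)
  have l3 := gamma_lt_iff hn (by omega) (by omega) (u := c.2) (v := c.1) (u' := d.2) (v' := d.1)
  unfold Interleaved
  rw [Ne, Prod.ext_iff]
  refine (and_congr l1 (and_congr l2 l3)).trans ?_
  omega

end Gamma

end PlaneCurves

namespace PlaneCurves

open Set Filter Topology

/-! ### Counting the chords of `Gamma n` -/

section GammaSums

/-- The pairs `p < q < N`. -/
def triangle (N : ℕ) : Finset (ℕ × ℕ) :=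
  (Finset.range N ×ˢ Finset.range N).filter fun c => c.1 < c.2

theorem mem_triangle {N : ℕ} {c : ℕ × ℕ} : c ∈ triangle N ↔ c.1 < c.2 ∧ c.2 < N := by
  simp only [triangle, Finset.mem_filter, Finset.mem_product, Finset.mem_range]
  omega

theorem sum_triangle (N : ℕ) (g : ℕ × ℕ → ℝ) :
    ∑ c ∈ triangle N, g c = ∑ q ∈ Finset.range N, ∑ p ∈ Finset.range q, g (p, q) := by
  rw [Finset.sum_sigma']
  refine Finset.sum_nbij' (fun c => ⟨c.2, c.1⟩) (fun x => (x.2, x.1)) ?_ ?_ ?_ ?_ ?_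
  · intro c hc
    rw [mem_triangle] at hc
    simp [hc]
  · rintro ⟨q, p⟩ hx
    simp only [Finset.mem_sigma, Finset.mem_range] at hx
    exact mem_triangle.mpr ⟨hx.2, hx.1⟩
  · intro c _; rfl
  · intro x _; rfl
  · intro c _; rfl

/-- Even chords are the pairs `(2 p, 2 q)` with `q ≤ n`, odd ones the pairs `(2 p + 1, 2 q + 1)`
with `q < n`; they have signs `-1` and `+1`. -/
theorem sum_gammaIndex (n : ℕ) (g : ℕ × ℕ → ℝ) :
    ∑ c ∈ gammaIndex n, g c = ∑ c ∈ triangle (n + 1), g (2 * c.1, 2 * c.2) +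
      ∑ c ∈ triangle n, g (2 * c.1 + 1, 2 * c.2 + 1) := by
  rw [← Finset.sum_filter_add_sum_filter_not (gammaIndex n) (fun c => c.1 % 2 = 0)]
  congr 1
  · refine Finset.sum_nbij' (fun c => (c.1 / 2, c.2 / 2)) (fun c => (2 * c.1, 2 * c.2)) ?_ ?_ ?_ ?_ ?_
    · intro c hc
      rw [Finset.mem_filter, mem_gammaIndex] at hc
      rw [mem_triangle]
      dsimp only
      omega
    · intro c hc
      rw [mem_triangle] at hc
      rw [Finset.mem_filter, mem_gammaIndex]
      dsimp only
      omega
    · intro c hc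
      rw [Finset.mem_filter, mem_gammaIndex] at hc
      refine Prod.ext ?_ ?_ <;> dsimp only <;> omega
    · intro c _
      refine Prod.ext ?_ ?_ <;> dsimp only <;> omega
    · intro c hc
      rw [Finset.mem_filter, mem_gammaIndex] at hc
      congr 1
      refine Prod.ext ?_ ?_ <;> dsimp only <;> omega
  · refine Finset.sum_nbij' (fun c => (c.1 / 2, c.2 / 2)) (fun c => (2 * c.1 + 1, 2 * c.2 + 1))
      ?_ ?_ ?_ ?_ ?_
    · intro c hc
      rw [Finset.mem_filter, mem_gammaIndex] at hc
      rw [mem_triangle]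
      dsimp only
      omega
    · intro c hc
      rw [mem_triangle] at hc
      rw [Finset.mem_filter, mem_gammaIndex]
      dsimp only
      omega
    · intro c hc
      rw [Finset.mem_filter, mem_gammaIndex] at hc
      refine Prod.ext ?_ ?_ <;> dsimp only <;> omega
    · intro c _
      refine Prod.ext ?_ ?_ <;> dsimp only <;> omega
    · intro c hc
      rw [Finset.mem_filter, mem_gammaIndex] at hc
      congr 1
      refine Prod.ext ?_ ?_ <;> dsimp only <;> omega

/-- The number of elements of `triangle N` interleaved with `(p, q)`, in the weak sense. -/
theorem sum_triangle_interleaved {N p q : ℕ} (hpq : p ≤ q) (hq : q ≤ N) :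
    (∑ d ∈ triangle N, if p ≤ d.1 ∧ d.1 < q ∧ q ≤ d.2 then (1 : ℝ) else 0) =
      ((q : ℝ) - p) * (N - q) := by
  rw [← Finset.sum_filter, Finset.sum_const, nsmul_one]
  have : (triangle N).filter (fun d => p ≤ d.1 ∧ d.1 < q ∧ q ≤ d.2) =
      Finset.Ico p q ×ˢ Finset.Ico q N := by
    ext d
    simp only [Finset.mem_filter, mem_triangle, Finset.mem_product, Finset.mem_Ico]
    omega
  rw [this, Finset.card_product, Nat.card_Ico, Nat.card_Ico, Nat.cast_mul, Nat.cast_sub hpq,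
    Nat.cast_sub hq]

/-- The weak count includes the chord `c` itself, whence the correction `-1`. -/
theorem sum_triangle_interleaved_ne {N : ℕ} {c : ℕ × ℕ} (hc : c ∈ triangle N) :
    (∑ d ∈ triangle N, if (c.1 ≤ d.1 ∧ d.1 < c.2 ∧ c.2 ≤ d.2) ∧ c ≠ d then (1 : ℝ) else 0) =
      ((c.2 : ℝ) - c.1) * (N - c.2) - 1 := by
  have h := mem_triangle.mp hc
  rw [← sum_triangle_interleaved h.1.le h.2.le, eq_sub_iff_add_eq]
  have : (1 : ℝ) = ∑ d ∈ triangle N, if c = d then 1 else 0 := by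
    rw [Finset.sum_ite_eq, if_pos hc]
  rw [this, ← Finset.sum_add_distrib]
  refine Finset.sum_congr rfl fun d _ => ?_
  by_cases hcd : c = d
  · subst hcd
    simp [h.1, hc]
  · simp [hcd]

theorem sum_triangle_one (N : ℕ) : ∑ _c ∈ triangle N, (1 : ℝ) = N * (N - 1) / 2 := by
  rw [sum_triangle]
  simp only [Finset.sum_const, Finset.card_range, nsmul_one]
  induction N with
  | zero => simp
  | succ N ih =>
    rw [Finset.sum_range_succ, ih]
    push_cast
    ring

theorem sum_triangle_sub (N : ℕ) :
    ∑ c ∈ triangle N, ((c.2 : ℝ) - c.1) = ((N : ℝ) + 1) * N * (N - 1) / 6 := by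
  have h : ∀ q : ℕ, ∀ m : ℕ, ∑ p ∈ Finset.range m, ((q : ℝ) - p) = m * q - m * (m - 1) / 2 := by
    intro q m
    induction m with
    | zero => simp
    | succ m ih =>
      rw [Finset.sum_range_succ, ih]
      push_cast
      ring
  rw [sum_triangle]
  simp only [h]
  induction N with
  | zero => simp
  | succ N ih =>
    rw [Finset.sum_range_succ, ih]
    push_cast
    ring

theorem cast_choose_three (n : ℕ) : (n.choose 3 : ℝ) = (n : ℝ) * (n - 1) * (n - 2) / 6 := by
  induction n with
  | zero => simp
  | succ n ih =>
    rw [Nat.choose_succ_succ' n 2, Nat.cast_add, ih, Nat.cast_choose_two]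
    push_cast
    ring

/-- An even chord `(2 p, 2 q)` as first member of a pair contributes `(q - p) (n + 1 - q) - 1` from
even chords and `-(q - p) (n - q)` from odd ones, in all `q - p - 1`. For an odd chord the two
counts cancel up to the chord itself, leaving `-1`. The total is `(n + 2).choose 3 - (n + 1).choose
2 - n.choose 2`. -/
theorem chordSum_gammaIndex (n : ℕ) :
    chordSum (gammaIndex n) (fun c => -(-1) ^ c.1)
      (fun c d => (c.1 ≤ d.1 ∧ d.1 < c.2 ∧ c.2 ≤ d.2) ∧ c ≠ d) = n.choose 3 := by
  have even : ∀ c ∈ triangle (n + 1), (∑ d ∈ gammaIndex n,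
      if (2 * c.1 ≤ d.1 ∧ d.1 < 2 * c.2 ∧ 2 * c.2 ≤ d.2) ∧ (2 * c.1, 2 * c.2) ≠ d then
        (-(-1 : ℝ) ^ (2 * c.1)) * -(-1) ^ d.1 else 0) = ((c.2 : ℝ) - c.1) - 1 := by
    intro c hc
    have h := mem_triangle.mp hc
    have e1 := sum_triangle_interleaved_ne hc
    have e2 := sum_triangle_interleaved (N := n) h.1.le (by omega : c.2 ≤ n)
    rw [sum_gammaIndex]
    have e3 : (((c.2 : ℝ) - c.1) * ((n + 1 : ℕ) - c.2) - 1) + -(((c.2 : ℝ) - c.1) * (n - c.2)) =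
        ((c.2 : ℝ) - c.1) - 1 := by
      push_cast; ring
    refine Eq.trans ?_ e3
    rw [← e1, ← e2, ← Finset.sum_neg_distrib]
    congr 1
    · refine Finset.sum_congr rfl fun d _ => ?_
      have : ((2 * c.1 ≤ 2 * d.1 ∧ 2 * d.1 < 2 * c.2 ∧ 2 * c.2 ≤ 2 * d.2) ∧
          (2 * c.1, 2 * c.2) ≠ (2 * d.1, 2 * d.2)) ↔
          (c.1 ≤ d.1 ∧ d.1 < c.2 ∧ c.2 ≤ d.2) ∧ c ≠ d := by
        rw [Ne, Ne, Prod.ext_iff, Prod.ext_iff]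
        dsimp only
        omega
      simp only [this, pow_mul]
      norm_num
    · refine Finset.sum_congr rfl fun d _ => ?_
      have : ((2 * c.1 ≤ 2 * d.1 + 1 ∧ 2 * d.1 + 1 < 2 * c.2 ∧ 2 * c.2 ≤ 2 * d.2 + 1) ∧
          (2 * c.1, 2 * c.2) ≠ (2 * d.1 + 1, 2 * d.2 + 1)) ↔
          (c.1 ≤ d.1 ∧ d.1 < c.2 ∧ c.2 ≤ d.2) := by
        rw [Ne, Prod.ext_iff]
        dsimp only
        omega
      simp only [this, pow_mul, pow_succ]
      split_ifs <;> norm_num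
  have odd : ∀ c ∈ triangle n, (∑ d ∈ gammaIndex n,
      if (2 * c.1 + 1 ≤ d.1 ∧ d.1 < 2 * c.2 + 1 ∧ 2 * c.2 + 1 ≤ d.2) ∧
        (2 * c.1 + 1, 2 * c.2 + 1) ≠ d then
        (-(-1 : ℝ) ^ (2 * c.1 + 1)) * -(-1) ^ d.1 else 0) = -1 := by
    intro c hc
    have h := mem_triangle.mp hc
    have e1 := sum_triangle_interleaved_ne hc
    have e2 := sum_triangle_interleaved (N := n + 1) (p := c.1 + 1) (q := c.2 + 1) (by omega) (by omega)
    rw [sum_gammaIndex]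
    have e3 : -(((c.2 + 1 : ℕ) - (c.1 + 1 : ℕ) : ℝ) * ((n + 1 : ℕ) - (c.2 + 1 : ℕ))) +
        (((c.2 : ℝ) - c.1) * (n - c.2) - 1) = -1 := by
      push_cast; ring
    refine Eq.trans ?_ e3
    rw [← e1, ← e2, ← Finset.sum_neg_distrib]
    congr 1
    · refine Finset.sum_congr rfl fun d _ => ?_
      have : ((2 * c.1 + 1 ≤ 2 * d.1 ∧ 2 * d.1 < 2 * c.2 + 1 ∧ 2 * c.2 + 1 ≤ 2 * d.2) ∧
          (2 * c.1 + 1, 2 * c.2 + 1) ≠ (2 * d.1, 2 * d.2)) ↔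
          (c.1 + 1 ≤ d.1 ∧ d.1 < c.2 + 1 ∧ c.2 + 1 ≤ d.2) := by
        rw [Ne, Prod.ext_iff]
        dsimp only
        omega
      simp only [this, pow_mul, pow_succ]
      split_ifs <;> norm_num
    · refine Finset.sum_congr rfl fun d _ => ?_
      have : ((2 * c.1 + 1 ≤ 2 * d.1 + 1 ∧ 2 * d.1 + 1 < 2 * c.2 + 1 ∧
          2 * c.2 + 1 ≤ 2 * d.2 + 1) ∧
          (2 * c.1 + 1, 2 * c.2 + 1) ≠ (2 * d.1 + 1, 2 * d.2 + 1)) ↔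
          (c.1 ≤ d.1 ∧ d.1 < c.2 ∧ c.2 ≤ d.2) ∧ c ≠ d := by
        rw [Ne, Ne, Prod.ext_iff, Prod.ext_iff]
        dsimp only
        omega
      simp only [this, pow_mul, pow_succ]
      split_ifs <;> norm_num
  have key : chordSum (gammaIndex n) (fun c => -(-1) ^ c.1)
      (fun c d => (c.1 ≤ d.1 ∧ d.1 < c.2 ∧ c.2 ≤ d.2) ∧ c ≠ d) =
      ∑ c ∈ triangle (n + 1), (((c.2 : ℝ) - c.1) - 1) + ∑ c ∈ triangle n, (-1 : ℝ) := by
    unfold chordSum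
    rw [sum_gammaIndex]
    congr 1
    · refine Finset.sum_congr rfl fun c hc => ?_
      refine Eq.trans (Finset.sum_congr rfl fun d _ => ?_) (even c hc)
      congr!
    · refine Finset.sum_congr rfl fun c hc => ?_
      refine Eq.trans (Finset.sum_congr rfl fun d _ => ?_) (odd c hc)
      congr!
  rw [key, Finset.sum_sub_distrib, Finset.sum_neg_distrib, sum_triangle_sub, sum_triangle_one,
    sum_triangle_one, cast_choose_three]
  push_cast
  ring

theorem interSum_Gamma {n : ℕ} (hn : 1 ≤ n) : interSum (Gamma n) = n.choose 3 := by
  unfold interSum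
  rw [pairSum_eq_chordSum (bijOn_gammaChord hn), ← chordSum_gammaIndex n]
  exact chordSum_congr (fun c hc => sign_cross_gammaChord hn hc)
    fun c hc d hd => interleaved_gammaChord hn hc hd

theorem doubleCount_Gamma {n : ℕ} (hn : 1 ≤ n) : (doubleCount (Gamma n) : ℝ) = (n : ℝ) ^ 2 := by
  rw [doubleCount_eq_card (bijOn_gammaChord hn)]
  have : ((gammaIndex n).card : ℝ) = ∑ c ∈ gammaIndex n, (1 : ℝ) := by simp
  rw [this, sum_gammaIndex, sum_triangle_one, sum_triangle_one]
  push_cast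
  ring

/-- The overpass is the second passage, so the frame (over, under) is the reverse of the frame
(first, second). -/
theorem crossingSign_diagramD (n : ℕ) (p : ℝ × ℝ) :
    crossingSign (diagramD n) p = -doubleSign (Gamma n) p := by
  unfold crossingSign doubleSign diagramD
  rw [if_pos (mem_univ p), cross_swap, Real.sign_neg]

/-- Even chords are positive crossings and odd chords negative ones: `(n + 1).choose 2 - n.choose 2
= n`. -/
theorem writhe_diagramD {n : ℕ} (hn : 1 ≤ n) : writhe (diagramD n) = n := by
  have h := bijOn_gammaChord hn
  have : writhe (diagramD n) = ∑ c ∈ gammaIndex n, (-1 : ℝ) ^ c.1 := by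
    unfold writhe
    rw [← finsum_mem_coe_finset]
    refine (finsum_mem_eq_of_bijOn (gammaChord n) h fun c hc => ?_).symm
    rw [crossingSign_diagramD, sign_cross_gammaChord hn hc, neg_neg]
  rw [this, sum_gammaIndex]
  have h1 : ∑ c ∈ triangle (n + 1), (-1 : ℝ) ^ (2 * c.1) = ∑ _c ∈ triangle (n + 1), (1 : ℝ) :=
    Finset.sum_congr rfl fun c _ => by rw [pow_mul]; norm_num
  have h2 : ∑ c ∈ triangle n, (-1 : ℝ) ^ (2 * c.1 + 1) = ∑ _c ∈ triangle n, (-1 : ℝ) :=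
    Finset.sum_congr rfl fun c _ => by rw [pow_succ, pow_mul]; norm_num
  dsimp only
  rw [h1, h2, Finset.sum_neg_distrib, sum_triangle_one, sum_triangle_one]
  push_cast
  ring

theorem cowrithe_diagramD (n : ℕ) : cowrithe (diagramD n) = interSum (Gamma n) := by
  unfold cowrithe interSum pairSum
  refine finsum_mem_congr rfl fun q _ => ?_
  rw [crossingSign_diagramD, crossingSign_diagramD, neg_mul_neg]

end GammaSums

theorem isArnoldTriple : IsArnoldTriple Jplus Jminus St where
  reverse _ hγ := arnold_eq_iff.mp (arnold_comp_neg hγ)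
  isotopy _ h hgen := arnold_eq_iff.mp (arnold_eq_of_isotopy h hgen)
  direct _ _ h hD hc := arnold_direct h hD hc
  inverse _ _ h hI hc := arnold_inverse h hI hc
  triple _ _ _ _ h hs := arnold_triple h hs
  figure_eight := arnold_figureEight
  kinked_circle := arnold_kinkedCircle

end PlaneCurves

theorem proposition3p1 :
    IsArnoldTriple Jplus Jminus St ∧
    ∀ n : ℕ, 2 ≤ n →
      IsGenericCurve (diagramD n).curve ∧
      (Jminus (diagramD n).curve / 2 + St (diagramD n).curve - writhe (diagramD n) / 2
          = -((n.choose 1 : ℝ) + (n.choose 2 : ℝ) + (n.choose 3 : ℝ)) ∧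
        -((n.choose 1 : ℝ) + (n.choose 2 : ℝ) + (n.choose 3 : ℝ))
          = -((n : ℝ) * ((n : ℝ) ^ 2 + 5) / 6)) ∧
      (Jplus (diagramD n).curve / 2 + St (diagramD n).curve = -cowrithe (diagramD n) ∧
        -cowrithe (diagramD n) = -(n.choose 3 : ℝ) ∧
        -(n.choose 3 : ℝ) = -(((n : ℝ) - 2) * ((n : ℝ) - 1) * (n : ℝ) / 6)) := by
  refine ⟨isArnoldTriple, fun n hn => ?_⟩
  have hn1 : 1 ≤ n := by omega
  have hS := interSum_Gamma hn1
  have hd := doubleCount_Gamma hn1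
  have hc1 : (n.choose 1 : ℝ) = n := by rw [Nat.choose_one_right]
  have hc2 := Nat.cast_choose_two ℝ n
  have hc3 := cast_choose_three n
  change IsGenericCurve (Gamma n) ∧ (Jminus (Gamma n) / 2 + St (Gamma n) - _ = _ ∧ _) ∧
    (Jplus (Gamma n) / 2 + St (Gamma n) = _ ∧ _)
  refine ⟨isGenericCurve_Gamma hn1, ⟨?_, ?_⟩, ?_, ?_, ?_⟩
  -- `J⁺` cancels, leaving `-d / 2 - S₃ - w / 2 = -(n ^ 2 + n) / 2 - n.choose 3`.
  · rw [writhe_diagramD hn1, Jminus_eq, St_eq, hS, hd, hc1, hc2]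
    ring
  · rw [hc1, hc2, hc3]
    ring
  · rw [cowrithe_diagramD, St_eq]
    ring
  · rw [cowrithe_diagramD, hS]
  · rw [hc3]
    ring
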